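/- Let $m\ge 1$ and let $X_1,X_2,\dots$ be i.i.d. random variables with the uniform distribution on $[0,1]$ (the null hypothesis $H_0$). Write $x_{(a)}$ for the $a$-th smallest of the numbers $x_1,\dots,x_k$, and consider the symmetric kernel of degree $m+1$ $$\Phi_m(x_1,\dots,x_{m+1})=\frac1{(m+1)!}\sum_{\pi\in S_{m+1}}\min(x_{\pi(1)},\dots,x_{\pi(m)})^2-\frac{2}{m+1}\,x_{(2)}+\frac{2}{(m+1)(m+2)},$$ where $x_{(2)}$ is the second smallest of $x_1,\dots,x_{m+1}$, and the corresponding U-statistic $$T^m_n=\binom{n}{m+1}^{-1}\sum_{1\le i_1<\dots<i_{m+1}\le n}\Phi_m(X_{i_1},\dots,X_{i_{m+1}}).$$ Then the following holds. (1) The first projection vanishes identically: $E(\Phi_m(X_1,\dots,X_{m+1})\mid X_{m+1}=s)=0$ for all $s\in[0,1]$. (2) The second projection $\varphi^*_m(s,t)=E(\Phi_m(X_1,\dots,X_{m+1})\mid X_m=s,\,X_{m+1}=t)$ is, for all $s,t\in[0,1]$, $$\varphi^*_m(s,t)=-\frac{2}{m(1+m)^2(2+m)}\Big(-2+2(1-t)^m+m^2\big(-(1-s)^{m+1}+(1-t)^mt\big)+m\big(-2(1-s)^{m+1}+(1-t)^m+2(1-t)^mt\big)\Big)+\frac{2}{m(1+m)}I\{s<t\}\big((1-t)^m-(1-s)^m\big),$$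 and it is not almost everywhere zero on $[0,1]^2$. Thus $\Phi_m$ is weakly degenerate. (3) Let $S$ be the integral operator $Sf(t)=\int_0^1\varphi^*_m(s,t)f(s)\,ds$ on $L^2[0,1]$. Its nonzero eigenvalues, repeated according to multiplicity, can be listed in a sequence $(\nu_i)_{i\ge1}$ (zero entries being allowed in the list), and for every such list and every i.i.d. sequence $\tau_1,\tau_2,\dots$ of standard normal variables the series $\sum_i\nu_i(\tau_i^2-1)$ converges almost surely and $$nT^m_n\xrightarrow{\ d\ }\binom{m+1}{2}\sum_{i=1}^\infty\nu_i(\tau_i^2-1)\qquad(n\to\infty).$$ (4) The eigenproblem reduces to a boundary value problem. For $\nu\in\mathbb R$ consider (a) $f\in L^2[0,1]$ with $\nu f(t)=\int_0^1\varphi^*_m(s,t)f(s)\,ds$ for almost every $t\in[0,1]$, $\int_0^1f=0$, $\int_0^1f^2=1$; (b) $y\in C^2[0,1]$ with $\nu y''(t)=-\frac{2(1-t)^{m-1}}{m+1}y(t)$ for all $t\in[0,1]$, $y(0)=y(1)=0$, $\int_0^1 y'(t)^2dt=1$. If $f$ solves (a), then $y(t)=\int_0^tf(s)\,ds$ solves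 (b); if $y$ solves (b), then $f=y'$ solves (a). Moreover, $\nu$ is a nonzero eigenvalue of $S$ if and only if (b) has a solution. -/

import Mathlib

open MeasureTheory ProbabilityTheory Filter Topology Set

noncomputable section

namespace UniformityTest

/-- The uniform distribution on `[0,1]`. -/
abbrev unif : Measure ℝ := volume.restrict (Icc (0 : ℝ) 1)

/-- The `a`-th order statistic (`1 ≤ a ≤ k`, counted from the smallest) of `x 0, …, x (k-1)`.
`Tuple.sort x` is a permutation such that `x ∘ Tuple.sort x` is monotone. -/
def orderStat {k : ℕ} (a : ℕ) (x : Fin k → ℝ) : ℝ :=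
  if h : 1 ≤ a ∧ a ≤ k then x (Tuple.sort x ⟨a - 1, by omega⟩) else 0

/-- The symmetric kernel `Φ_m` of degree `m + 1`: the square of the minimum of `m` of the `m + 1`
arguments, averaged over all orderings of the arguments, minus `2 / (m + 1)` times the second
smallest of all arguments, plus `2 / ((m + 1) (m + 2))`. -/
def kernelPhi (m : ℕ) (x : Fin (m + 1) → ℝ) : ℝ :=
  (1 / ((m + 1).factorial : ℝ)) *
      ∑ π : Equiv.Perm (Fin (m + 1)), orderStat 1 (fun j : Fin m => x (π j.castSucc)) ^ 2
    - 2 / ((m : ℝ) + 1) * orderStat 2 x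
    + 2 / (((m : ℝ) + 1) * ((m : ℝ) + 2))

open Classical in
/-- The test statistic `T^m_n`: the U-statistic with kernel `Φ_m` of a sample of size `n`, that is
the average of `Φ_m(x_{i_1}, …, x_{i_{m+1}})` over all `i_1 < ⋯ < i_{m+1}`. -/
def statT (m n : ℕ) (x : Fin n → ℝ) : ℝ :=
  (1 / (n.choose (m + 1) : ℝ)) *
    ∑ i ∈ (Finset.univ : Finset (Fin (m + 1) → Fin n)).filter StrictMono,
      kernelPhi m (fun j => x (i j))

/-- First projection under the null hypothesis: `E(Φ_m(X_1, …, X_{m+1}) | X_{m+1} = s)`, the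
expectation over independent uniform arguments with the last argument frozen at `s`. -/
def firstProj (m : ℕ) (s : ℝ) : ℝ :=
  ∫ x : Fin (m + 1) → ℝ, kernelPhi m (Function.update x (Fin.last m) s)
    ∂(Measure.pi fun _ => unif)

/-- Second projection `φ*_m` under the null hypothesis (for `m ≥ 1`):
`E(Φ_m(X_1, …, X_{m+1}) | X_m = s, X_{m+1} = t)`, the expectation over independent uniform
arguments with the last two arguments frozen at `s` and `t`. -/
def secondProj (m : ℕ) (s t : ℝ) : ℝ :=
  ∫ x : Fin (m + 1) → ℝ,
      kernelPhi m (Function.update (Function.update x ⟨m - 1, by omega⟩ s) (Fin.last m) t)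
    ∂(Measure.pi fun _ => unif)

/-- The real Hilbert space `L²[0,1]`. -/
abbrev L2 : Type := Lp ℝ 2 unif

/-- A square integrable kernel maps `L²[0,1]` to `L²[0,1]`. -/
theorem memLp_integral {K : ℝ → ℝ → ℝ}
    (hK : MemLp (Function.uncurry K) 2 (unif.prod unif)) (f : L2) :
    (∀ᵐ t ∂unif, Integrable (fun s => K s t * f s) unif) ∧
      MemLp (fun t => ∫ s, K s t * f s ∂unif) 2 unif := by
  have hKs : AEStronglyMeasurable (fun p : ℝ × ℝ => K p.2 p.1) (unif.prod unif) :=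
    hK.1.prod_swap
  have hK2 : Integrable (fun p : ℝ × ℝ => K p.2 p.1 ^ 2) (unif.prod unif) :=
    ((memLp_two_iff_integrable_sq hK.1).1 hK).swap
  have hf : MemLp f 2 unif := Lp.memLp f
  have hsec : ∀ᵐ t ∂unif, MemLp (fun s => K s t) 2 unif := by
    filter_upwards [hK2.prod_right_ae, hKs.prodMk_left] with t h1 h2
    exact (memLp_two_iff_integrable_sq h2).2 h1
  refine ⟨?_, ?_⟩
  · filter_upwards [hsec] with t ht
    exact ht.integrable_mul hf
  · have hmeas : AEStronglyMeasurable (fun t => ∫ s, K s t * f s ∂unif) unif :=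
      (hKs.mul (hf.1.comp_snd (μ := unif))).integral_prod_right'
    refine (memLp_two_iff_integrable_sq hmeas).2 ?_
    refine Integrable.mono' (hK2.integral_prod_left.mul_const (∫ s, f s ^ 2 ∂unif))
      (hmeas.pow 2) ?_
    filter_upwards [hsec] with t ht
    have hcs := integral_mul_norm_le_Lp_mul_Lq (μ := unif) Real.HolderConjugate.two_two
      (by simpa using ht) (by simpa using hf)
    simp only [Real.norm_eq_abs, Real.rpow_two, sq_abs] at hcs
    rw [← Real.sqrt_eq_rpow, ← Real.sqrt_eq_rpow] at hcs
    have h0 : |∫ s, K s t * f s ∂unif| ≤ ∫ s, |K s t| * |f s| ∂unif := by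
      simpa only [Real.norm_eq_abs, abs_mul] using
        norm_integral_le_integral_norm (μ := unif) (fun s => K s t * f s)
    rw [Real.norm_eq_abs, abs_pow]
    calc |∫ s, K s t * f s ∂unif| ^ 2
        ≤ (√(∫ s, K s t ^ 2 ∂unif) * √(∫ s, f s ^ 2 ∂unif)) ^ 2 :=
          pow_le_pow_left₀ (abs_nonneg _) (h0.trans hcs) 2
      _ = (∫ s, K s t ^ 2 ∂unif) * ∫ s, f s ^ 2 ∂unif := by
          rw [mul_pow, Real.sq_sqrt (integral_nonneg fun s => sq_nonneg _),
            Real.sq_sqrt (integral_nonneg fun s => sq_nonneg _)]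

open Classical in
/-- The integral operator `(S f)(t) = ∫₀¹ K(s,t) f(s) ds` on `L²[0,1]`, for a square integrable
kernel `K` (and the zero operator for any other `K`). -/
def integralOperator (K : ℝ → ℝ → ℝ) : Module.End ℝ L2 :=
  if hK : MemLp (Function.uncurry K) 2 (unif.prod unif) then
    { toFun := fun f => (memLp_integral hK f).2.toLp
      map_add' := by
        intro f g
        rw [← MemLp.toLp_add, MemLp.toLp_eq_toLp_iff]
        filter_upwards [(memLp_integral hK f).1, (memLp_integral hK g).1] with t hf hg
        rw [Pi.add_apply, ← integral_add hf hg]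
        refine integral_congr_ae ?_
        filter_upwards [Lp.coeFn_add f g] with s hs
        rw [hs, Pi.add_apply, mul_add]
      map_smul' := by
        intro c f
        rw [RingHom.id_apply, ← MemLp.toLp_const_smul, MemLp.toLp_eq_toLp_iff]
        refine Eventually.of_forall fun t => ?_
        rw [Pi.smul_apply, ← integral_smul]
        refine integral_congr_ae ?_
        filter_upwards [Lp.coeFn_smul c f] with s hs
        rw [hs, Pi.smul_apply, smul_eq_mul, smul_eq_mul, mul_left_comm] }
  else 0

/-- The operator `S` with kernel `φ*_m`. -/
def opS (m : ℕ) : Module.End ℝ L2 := integralOperator (secondProj m)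

/-- `ν` lists the nonzero eigenvalues of `S`, each as often as the dimension of its eigenspace;
zero entries are allowed in between (or at the end). -/
def ListsEigenvalues (S : Module.End ℝ L2) (ν : ℕ → ℝ) : Prop :=
  ∀ c : ℝ, c ≠ 0 → {i | ν i = c}.encard = Cardinal.toENat (Module.rank ℝ (S.eigenspace c))

/-- The integral equation `ν f(t) = ∫₀¹ φ*_m(s,t) f(s) ds` in `L²[0,1]`, with the constraints
`∫₀¹ f = 0` and `∫₀¹ f² = 1`. -/
def SolvesIntegralEquation (m : ℕ) (ν : ℝ) (f : ℝ → ℝ) : Prop :=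
  MemLp f 2 unif ∧
    (∀ᵐ t ∂unif, ν * f t = ∫ s in (0 : ℝ)..1, secondProj m s t * f s) ∧
    ∫ s in (0 : ℝ)..1, f s = 0 ∧
    ∫ t in (0 : ℝ)..1, f t ^ 2 = 1

/-- The boundary value problem `ν y''(t) = -2 (1 - t)^(m-1) y(t) / (m + 1)` on `[0,1]` for
`y ∈ C²[0,1]`, with `y(0) = y(1) = 0` and `∫₀¹ y'(t)² dt = 1`. -/
def SolvesBoundaryProblem (m : ℕ) (ν : ℝ) (y : ℝ → ℝ) : Prop :=
  ContDiffOn ℝ 2 y (Icc 0 1) ∧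
    (∀ t ∈ Icc (0 : ℝ) 1,
      ν * iteratedDerivWithin 2 y (Icc 0 1) t =
        -2 * ((1 - t) ^ (m - 1) / ((m : ℝ) + 1)) * y t) ∧
    y 0 = 0 ∧ y 1 = 0 ∧
    ∫ t in (0 : ℝ)..1, derivWithin y (Icc 0 1) t ^ 2 = 1

end UniformityTest

end

/-!
The whole argument rests on one representation. For `x ∈ [0,1]^{m+1}` the squared minima and the
second smallest coordinate are integrals over thresholds `u` of exceedance indicators
`χ_j = 1{u < x_j}`, and by inclusion-exclusion `Φ_m(x)` is, up to a constant, the integral over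
`u ∈ [0,1]` of a multilinear form in the `χ_j` with coefficients depending on `q = 1 - u`
(`kernelPhi_eq`). This form has no first order part around the point `χ = (q, …, q)` of the means,
and its second order part is a multiple of `q^(m-1) (χ_i - q) (χ_j - q)` (`mulForm_two`). Hence the
first projection vanishes, and the second projection is the weighted Cramér–von Mises kernel
`covKer m s t = ∫ w(u) (1{u<s} - q) (1{u<t} - q) du` with `w(u) = 2 (1-u)^(m-1) / (m+1)`
(`secondProj_eq`), which can be integrated explicitly.

Consequently `S` is the Gram operator `∫ ⟪g_u, ·⟫ g_u du` of the map `g_u = √w(u) (1{u<·} - q)` into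
`L²[0,1]` (`opS_eq_gram`). It is compact, self-adjoint and positive, its eigenvalues are summable,
and they add up to `κ = ∫ ‖g_u‖² du = ∫ w(u) u (1-u) du` (`hasSum_eigenvalues`). As `κ > 0`, the
second projection is not zero. For centred `f` with primitive `y` one has `(S f)' = -w y`, which
gives the equivalence with the boundary value problem.

For the limit law, summing the representation over all subsamples expresses `T_n` through the number
`N(u)` of observations exceeding `u` (`statT_eq`). Expanding the binomial coefficients in `N(u)`
around their mean and bounding second and fourth moments gives
`E |n T_n - C(m+1,2) (Q_n - κ)| = O(n^{-1/2})` (`exists_integral_abs_statT_sub_le`), where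
`Q_n = (1/n) ∑_{i,j} covKer m (X_i) (X_j)`. With eigenfunctions `φ_k` and
`W_k = n^{-1/2} ∑_i φ_k(X_i)`, the difference `Q_n - ∑_{k<N} ν_k W_k²` is nonnegative, being the
quadratic form of a positive kernel, and its expectation is `κ - ∑_{k<N} ν_k`, since the terms off
the diagonal are centred. The trace formula makes this small uniformly in `n`. The multivariate
central limit theorem for `(W_k)_{k<N}` and a convergence-together argument
(`tendstoInDistribution_of_approx`) then yield the limit `∑ ν_k τ_k² - κ = ∑ ν_k (τ_k² - 1)`.
-/

namespace UniformityTest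

/-! ### The kernel as an integral over thresholds -/

/-- The exceedance indicator `1{u < s}`, real valued. -/
noncomputable def ind (u s : ℝ) : ℝ := if u < s then 1 else 0

lemma ind_nonneg (u s : ℝ) : 0 ≤ ind u s := by unfold ind; split_ifs <;> norm_num

lemma ind_le_one (u s : ℝ) : ind u s ≤ 1 := by unfold ind; split_ifs <;> norm_num

lemma abs_ind_le (u s : ℝ) : |ind u s| ≤ 1 := by
  rw [abs_of_nonneg (ind_nonneg u s)]; exact ind_le_one u s

@[fun_prop]
lemma measurable_ind {α : Type*} [MeasurableSpace α] {f g : α → ℝ} (hf : Measurable f)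
    (hg : Measurable g) : Measurable fun a => ind (f a) (g a) :=
  Measurable.ite (measurableSet_lt hf hg) measurable_const measurable_const

/-- The multilinear form `q ∑ᵢ ∏_{j ≠ i} p_j - m ∏_j p_j` in `m + 1` variables. At `q = 1 - u` and
`p_j = 1{u < x_j}` it is the integrand of the representation of the kernel over thresholds `u`. -/
noncomputable def mulForm {m : ℕ} (q : ℝ) (p : Fin (m + 1) → ℝ) : ℝ :=
  q * ∑ i, ∏ j ∈ Finset.univ.erase i, p j - m * ∏ j, p j

lemma prod_ind {ι : Type*} (s : Finset ι) (u : ℝ) (x : ι → ℝ) :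
    ∏ j ∈ s, ind u (x j) = if ∀ j ∈ s, u < x j then 1 else 0 := by
  classical
  split_ifs with h
  · exact Finset.prod_eq_one fun j hj => if_pos (h j hj)
  · push Not at h
    obtain ⟨j, hj, hx⟩ := h
    exact Finset.prod_eq_zero hj (if_neg (not_lt.2 hx))

lemma lt_orderStat_one_iff {k : ℕ} (hk : 1 ≤ k) (u : ℝ) (z : Fin k → ℝ) :
    u < orderStat 1 z ↔ ∀ j, u < z j := by
  unfold orderStat
  rw [dif_pos ⟨le_rfl, hk⟩]
  refine ⟨fun h j => h.trans_le ?_, fun h => h _⟩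
  have := Tuple.monotone_sort z
    (show (⟨1 - 1, by omega⟩ : Fin k) ≤ (Tuple.sort z).symm j from Nat.zero_le _)
  simpa using this

/-- The second smallest of `m + 1` numbers exceeds `u` when at most one of them does not; by
inclusion-exclusion this is a combination of products of exceedance indicators. -/
lemma ind_orderStat_two {m : ℕ} (hm : 1 ≤ m) (u : ℝ) (x : Fin (m + 1) → ℝ) :
    ind u (orderStat 2 x) =
      ∑ i, ∏ j ∈ Finset.univ.erase i, ind u (x j) - m * ∏ j, ind u (x j) := by
  set σ := Tuple.sort x with hσ
  set y := x ∘ σ with hy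
  have hmono : Monotone y := Tuple.monotone_sort x
  have h1 : ∏ j, ind u (x j) = ∏ j, ind u (y j) :=
    (Equiv.prod_comp σ fun j => ind u (x j)).symm
  have h2 : ∑ i, ∏ j ∈ Finset.univ.erase i, ind u (x j) =
      ∑ i, ∏ j ∈ Finset.univ.erase i, ind u (y j) := by
    rw [← Equiv.sum_comp σ]
    refine Finset.sum_congr rfl fun i _ => ?_
    symm
    refine Finset.prod_equiv σ (fun j => ?_) fun j _ => rfl
    simp
  have h3 : orderStat 2 x = y ⟨1, by omega⟩ := by
    unfold orderStat
    rw [dif_pos ⟨by norm_num, by omega⟩]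
    rfl
  rw [h1, h2, h3]
  have y01 : y 0 ≤ y ⟨1, by omega⟩ := hmono (Fin.zero_le _)
  by_cases c0 : u < y 0
  · have hall : ∀ j, u < y j := fun j => c0.trans_le (hmono (Fin.zero_le _))
    simp [ind, hall]
  · by_cases c1 : u < y ⟨1, by omega⟩
    · have hne : ¬ ∀ j ∈ Finset.univ, u < y j := fun h => c0 (h 0 (Finset.mem_univ _))
      have hi : ∀ i : Fin (m + 1),
          ∏ j ∈ Finset.univ.erase i, ind u (y j) = if i = 0 then 1 else 0 := by
        intro i
        rw [prod_ind]
        by_cases hi : i = 0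
        · subst hi
          rw [if_pos rfl, if_pos]
          intro j hj
          refine c1.trans_le (hmono ?_)
          have : j ≠ 0 := Finset.ne_of_mem_erase hj
          rw [Fin.le_def]
          exact Nat.one_le_iff_ne_zero.2 fun h => this (Fin.ext h)
        · rw [if_neg hi, if_neg]
          exact fun h => c0 (h 0 (Finset.mem_erase.2 ⟨Ne.symm hi, Finset.mem_univ _⟩))
      rw [prod_ind, if_neg hne, Finset.sum_congr rfl fun i _ => hi i]
      simp [ind, c1]
    · have hne : ¬ ∀ j ∈ Finset.univ, u < y j := fun h => c0 (h 0 (Finset.mem_univ _))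
      have hi : ∀ i : Fin (m + 1),
          ∏ j ∈ Finset.univ.erase i, ind u (y j) = 0 := by
        intro i
        rw [prod_ind, if_neg]
        intro h
        by_cases hi : i = 0
        · subst hi
          exact c1 (h _ (Finset.mem_erase.2 ⟨by simp [Fin.ext_iff], Finset.mem_univ _⟩))
        · exact c0 (h 0 (Finset.mem_erase.2 ⟨Ne.symm hi, Finset.mem_univ _⟩))
      rw [prod_ind, if_neg hne, Finset.sum_congr rfl fun i _ => hi i]
      simp [ind, c1]

/-- The layer cake formula: a function integrated against `1{u < v}` in the variable `u`. -/
lemma integral_mul_ind {φ : ℝ → ℝ} {v : ℝ} (hv : v ∈ Icc (0 : ℝ) 1) :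
    ∫ u, φ u * ind u v ∂unif = ∫ u in (0 : ℝ)..v, φ u := by
  have h : (fun u => φ u * ind u v) = (Iio v).indicator φ := by
    ext u
    by_cases hu : u < v <;> simp [ind, hu]
  have h' : Iio v ∩ Icc 0 1 = Ico 0 v := by
    ext u
    simp only [mem_inter_iff, mem_Iio, mem_Icc, mem_Ico]
    exact ⟨fun h => ⟨h.2.1, h.1⟩, fun h => ⟨h.2, h.1, h.2.le.trans hv.2⟩⟩
  rw [h, integral_indicator measurableSet_Iio, Measure.restrict_restrict measurableSet_Iio, h',
    intervalIntegral.integral_of_le hv.1, integral_Ico_eq_integral_Ioo,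
    integral_Ioc_eq_integral_Ioo]

lemma integral_unif (φ : ℝ → ℝ) : ∫ u, φ u ∂unif = ∫ u in (0 : ℝ)..1, φ u := by
  rw [intervalIntegral.integral_of_le zero_le_one, integral_Icc_eq_integral_Ioc]

instance : IsProbabilityMeasure unif := ⟨by simp⟩

lemma ae_unif_mem : ∀ᵐ u ∂unif, u ∈ Icc (0 : ℝ) 1 := ae_restrict_mem measurableSet_Icc

lemma integrable_unif_of_bound {φ : ℝ → ℝ} (hφ : Measurable φ) (C : ℝ)
    (h : ∀ u ∈ Icc (0 : ℝ) 1, |φ u| ≤ C) : Integrable φ unif :=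
  Integrable.of_bound hφ.aestronglyMeasurable C (ae_unif_mem.mono h)

/-- A function of the image of the last point, averaged over all permutations. -/
lemma sum_perm_last {k : ℕ} (f : Fin (k + 1) → ℝ) :
    (1 / ((k + 1).factorial : ℝ)) * ∑ π : Equiv.Perm (Fin (k + 1)), f (π (Fin.last k)) =
      1 / ((k : ℝ) + 1) * ∑ i, f i := by
  have h : ∀ i, ∑ π : Equiv.Perm (Fin (k + 1)), f (π i) =
      ∑ π : Equiv.Perm (Fin (k + 1)), f (π (Fin.last k)) := by
    intro i
    rw [← Equiv.sum_comp (Equiv.mulRight (Equiv.swap i (Fin.last k)))]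
    simp
  have h2 : ((k : ℝ) + 1) * ∑ π : Equiv.Perm (Fin (k + 1)), f (π (Fin.last k)) =
      ((k + 1).factorial : ℝ) * ∑ i, f i := by
    calc ((k : ℝ) + 1) * ∑ π : Equiv.Perm (Fin (k + 1)), f (π (Fin.last k))
        = ∑ i : Fin (k + 1), ∑ π : Equiv.Perm (Fin (k + 1)), f (π i) := by
          simp [h]
      _ = ∑ π : Equiv.Perm (Fin (k + 1)), ∑ i, f (π i) := Finset.sum_comm
      _ = ((k + 1).factorial : ℝ) * ∑ i, f i := by
          simp [Equiv.sum_comp, Fintype.card_perm]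
  have : ((k + 1).factorial : ℝ) ≠ 0 := by positivity
  have : (k : ℝ) + 1 ≠ 0 := by positivity
  field_simp
  linarith

lemma orderStat_mem_Icc {k a : ℕ} {x : Fin k → ℝ} (hx : ∀ j, x j ∈ Icc (0 : ℝ) 1) :
    orderStat a x ∈ Icc (0 : ℝ) 1 := by
  unfold orderStat
  split_ifs
  · exact hx _
  · simp

lemma abs_prod_ind_le {ι : Type*} (s : Finset ι) (u : ℝ) (x : ι → ℝ) :
    |∏ j ∈ s, ind u (x j)| ≤ 1 := by
  rw [prod_ind]; split_ifs <;> simp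

/-- On `[0,1]^{m+1}` the kernel is an integral over thresholds `u` of a multilinear form in the
exceedance indicators `1{u < x_j}`. -/
lemma kernelPhi_eq {m : ℕ} (hm : 1 ≤ m) {x : Fin (m + 1) → ℝ} (hx : ∀ j, x j ∈ Icc (0 : ℝ) 1) :
    kernelPhi m x = 2 / (((m : ℝ) + 1) * ((m : ℝ) + 2))
      - 2 / ((m : ℝ) + 1) * ∫ u, mulForm (1 - u) (fun j => ind u (x j)) ∂unif := by
  -- `v² = ∫₀^v 2u du` for the minimum `v`, which exceeds `u` exactly when all its arguments do
  have hA : ∀ π : Equiv.Perm (Fin (m + 1)),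
      orderStat 1 (fun j : Fin m => x (π j.castSucc)) ^ 2 =
        ∫ u, 2 * u * ∏ j ∈ Finset.univ.erase (π (Fin.last m)), ind u (x j) ∂unif := by
    intro π
    have hv : orderStat 1 (fun j : Fin m => x (π j.castSucc)) ∈ Icc (0 : ℝ) 1 :=
      orderStat_mem_Icc fun j => hx _
    have h1 : ∀ u, ∏ j ∈ Finset.univ.erase (π (Fin.last m)), ind u (x j) =
        ind u (orderStat 1 (fun j : Fin m => x (π j.castSucc))) := by
      intro u
      rw [prod_ind, ind]
      congr 1
      rw [lt_orderStat_one_iff hm, eq_iff_iff]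
      constructor
      · intro h j
        exact h _ (Finset.mem_erase.2 ⟨fun h' => (Fin.castSucc_lt_last j).ne (π.injective h'),
          Finset.mem_univ _⟩)
      · intro h j hj
        have hj' : π.symm j ≠ Fin.last m := fun h' =>
          Finset.ne_of_mem_erase hj (by rw [← h', Equiv.apply_symm_apply])
        obtain ⟨i, hi⟩ := Fin.exists_castSucc_eq.2 hj'
        have := h i
        rwa [hi, Equiv.apply_symm_apply] at this
    simp only [h1]
    rw [integral_mul_ind hv, intervalIntegral.integral_const_mul, integral_id]
    ring
  have hB : orderStat 2 x =
      ∫ u, (∑ i, ∏ j ∈ Finset.univ.erase i, ind u (x j) - m * ∏ j, ind u (x j)) ∂unif := by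
    simp only [← ind_orderStat_two hm]
    have := integral_mul_ind (φ := fun _ => 1) (orderStat_mem_Icc (a := 2) hx)
    simpa using this.symm
  have i1 : ∀ i, Integrable (fun u => 2 * u * ∏ j ∈ Finset.univ.erase i, ind u (x j)) unif := by
    intro i
    refine integrable_unif_of_bound (by fun_prop) 2 fun u hu => ?_
    rw [abs_mul, abs_of_nonneg (by linarith [hu.1] : (0 : ℝ) ≤ 2 * u)]
    have := abs_prod_ind_le (Finset.univ.erase i) u x
    have := abs_nonneg (∏ j ∈ Finset.univ.erase i, ind u (x j))
    nlinarith [hu.1, hu.2]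
  have i2 : ∀ i, Integrable (fun u => ∏ j ∈ Finset.univ.erase i, ind u (x j)) unif := fun i =>
    integrable_unif_of_bound (by fun_prop) 1 fun u _ => abs_prod_ind_le _ _ _
  have i3 : Integrable (fun u => (m : ℝ) * ∏ j, ind u (x j)) unif :=
    (integrable_unif_of_bound (by fun_prop) 1 fun u _ => abs_prod_ind_le _ _ _).const_mul _
  have i4 : Integrable (fun u => ∑ i, ∏ j ∈ Finset.univ.erase i, ind u (x j)
      - m * ∏ j, ind u (x j)) unif := (integrable_finsetSum _ fun i _ => i2 i).sub i3
  unfold kernelPhi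
  rw [Finset.sum_congr rfl fun π _ => hA π,
    sum_perm_last fun i => ∫ u, 2 * u * ∏ j ∈ Finset.univ.erase i, ind u (x j) ∂unif,
    ← integral_finsetSum _ fun i _ => i1 i, hB]
  have : ∫ u, mulForm (1 - u) (fun j => ind u (x j)) ∂unif =
      ∫ u, (∑ i, ∏ j ∈ Finset.univ.erase i, ind u (x j) - m * ∏ j, ind u (x j)) ∂unif
        - (1 / 2) * ∫ u, ∑ i, 2 * u * ∏ j ∈ Finset.univ.erase i, ind u (x j) ∂unif := by
    rw [← integral_const_mul, ← integral_sub i4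
      ((integrable_finsetSum _ fun i _ => i1 i).const_mul _)]
    refine integral_congr_ae (Eventually.of_forall fun u => ?_)
    simp only [mulForm, ← Finset.mul_sum]
    ring
  rw [this]
  have : (m : ℝ) + 1 ≠ 0 := by positivity
  have : (m : ℝ) + 2 ≠ 0 := by positivity
  field_simp
  ring

/-! ### The projections of the kernel -/

/-- The centred exceedance indicator `1{u < s} - (1 - u)`. -/
noncomputable def cind (u s : ℝ) : ℝ := ind u s - (1 - u)

@[fun_prop]
lemma measurable_cind {α : Type*} [MeasurableSpace α] {f g : α → ℝ} (hf : Measurable f)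
    (hg : Measurable g) : Measurable fun a => cind (f a) (g a) :=
  (measurable_ind hf hg).sub (measurable_const.sub hf)

lemma abs_cind_le {u : ℝ} (hu : u ∈ Icc (0 : ℝ) 1) (s : ℝ) : |cind u s| ≤ 1 := by
  have := ind_nonneg u s
  have := ind_le_one u s
  unfold cind
  rw [abs_le]
  constructor <;> linarith [hu.1, hu.2]

/-- The weight `w(u) = 2 (1 - u)^(m-1) / (m + 1)`. It is used for `m ≥ 1`, where the subtraction in
the exponent does not truncate. -/
noncomputable def wt (m : ℕ) (u : ℝ) : ℝ := 2 / ((m : ℝ) + 1) * (1 - u) ^ (m - 1)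

@[fun_prop]
lemma continuous_wt (m : ℕ) : Continuous (wt m) := by unfold wt; fun_prop

lemma wt_nonneg (m : ℕ) {u : ℝ} (hu : u ∈ Icc (0 : ℝ) 1) : 0 ≤ wt m u :=
  mul_nonneg (by positivity) (pow_nonneg (by linarith [hu.2]) _)

lemma wt_le_two (m : ℕ) {u : ℝ} (hu : u ∈ Icc (0 : ℝ) 1) : wt m u ≤ 2 := by
  have h1 : (1 - u) ^ (m - 1) ≤ 1 := pow_le_one₀ (by linarith [hu.2]) (by linarith [hu.1])
  have h2 : 2 / ((m : ℝ) + 1) ≤ 2 :=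
    div_le_self (by norm_num) (by linarith [m.cast_nonneg (α := ℝ)])
  have h3 : 0 ≤ 2 / ((m : ℝ) + 1) := by positivity
  calc wt m u ≤ 2 / ((m : ℝ) + 1) * 1 := mul_le_mul_of_nonneg_left h1 h3
    _ ≤ 2 := by linarith

lemma abs_wt_le (m : ℕ) {u : ℝ} (hu : u ∈ Icc (0 : ℝ) 1) : |wt m u| ≤ 2 := by
  rw [abs_of_nonneg (wt_nonneg m hu)]; exact wt_le_two m hu

/-- The weighted Cramér–von Mises kernel `∫₀¹ w(u) (1{u<s} - (1-u)) (1{u<t} - (1-u)) du`. -/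
noncomputable def covKer (m : ℕ) (s t : ℝ) : ℝ := ∫ u, wt m u * (cind u s * cind u t) ∂unif

lemma integral_ind {u : ℝ} (hu : u ∈ Icc (0 : ℝ) 1) : ∫ s, ind u s ∂unif = 1 - u := by
  have h : (fun s => ind u s) = (Ioi u).indicator 1 := by
    ext s
    by_cases hs : u < s <;> simp [ind, hs]
  have h' : Ioi u ∩ Icc 0 1 = Ioc u 1 := by
    ext s
    simp only [mem_inter_iff, mem_Ioi, mem_Icc, mem_Ioc]
    exact ⟨fun h => ⟨h.1, h.2.2⟩, fun h => ⟨h.1, hu.1.trans h.1.le, h.2⟩⟩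
  rw [h, integral_indicator_one measurableSet_Ioi, measureReal_restrict_apply measurableSet_Ioi, h']
  simp [hu.2]

lemma integral_cind {u : ℝ} (hu : u ∈ Icc (0 : ℝ) 1) : ∫ s, cind u s ∂unif = 0 := by
  unfold cind
  rw [integral_sub (integrable_unif_of_bound (by fun_prop) 1 fun s _ => abs_ind_le u s)
    (integrable_const _), integral_ind hu]
  simp

lemma integral_cind_sq {u : ℝ} (hu : u ∈ Icc (0 : ℝ) 1) :
    ∫ s, cind u s ^ 2 ∂unif = (1 - u) * u := by
  have h : ∀ s, cind u s ^ 2 = (1 - 2 * (1 - u)) * ind u s + (1 - u) ^ 2 := by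
    intro s
    unfold cind ind
    split_ifs <;> ring
  simp only [h]
  rw [integral_add
    ((integrable_unif_of_bound (by fun_prop) 1 fun s _ => abs_ind_le u s).const_mul _)
    (integrable_const _), integral_const_mul, integral_ind hu]
  simp
  ring

lemma ae_pi_mem {ι : Type*} [Fintype ι] :
    ∀ᵐ x ∂(Measure.pi fun _ : ι => unif), ∀ j, x j ∈ Icc (0 : ℝ) 1 := by
  rw [ae_all_iff]
  exact fun j => (Measure.quasiMeasurePreserving_eval _ j).ae ae_unif_mem

lemma abs_mulForm_ind_le {m : ℕ} {u : ℝ} (hu : u ∈ Icc (0 : ℝ) 1) (x : Fin (m + 1) → ℝ) :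
    |mulForm (1 - u) (fun j => ind u (x j))| ≤ 2 * m + 1 := by
  unfold mulForm
  have h1 : |∑ i, ∏ j ∈ Finset.univ.erase i, ind u (x j)| ≤ (m : ℝ) + 1 := by
    refine (Finset.abs_sum_le_sum_abs _ _).trans
      ((Finset.sum_le_sum fun i _ => abs_prod_ind_le _ _ _).trans ?_)
    simp
  have h2 : |(1 - u) * ∑ i, ∏ j ∈ Finset.univ.erase i, ind u (x j)| ≤ (m : ℝ) + 1 := by
    rw [abs_mul]
    have : |1 - u| ≤ 1 := by rw [abs_le]; constructor <;> linarith [hu.1, hu.2]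
    calc _ ≤ 1 * ((m : ℝ) + 1) := mul_le_mul this h1 (abs_nonneg _) zero_le_one
      _ = _ := one_mul _
  have h3 : |(m : ℝ) * ∏ j, ind u (x j)| ≤ m := by
    rw [abs_mul, abs_of_nonneg m.cast_nonneg]
    exact mul_le_of_le_one_right m.cast_nonneg (abs_prod_ind_le _ _ _)
  refine (abs_sub _ _).trans ?_
  linarith

@[fun_prop]
lemma measurable_mulForm {α : Type*} [MeasurableSpace α] {m : ℕ} {q : α → ℝ}
    {p : Fin (m + 1) → α → ℝ} (hq : Measurable q) (hp : ∀ j, Measurable (p j)) :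
    Measurable fun a => mulForm (q a) (fun j => p j a) := by
  unfold mulForm
  fun_prop

/-- Expectation of the kernel with the arguments in `A` frozen: by independence each free
exceedance indicator is replaced by its mean `1 - u`. -/
lemma integral_kernelPhi_frozen {m : ℕ} (hm : 1 ≤ m) (A : Finset (Fin (m + 1)))
    {a : Fin (m + 1) → ℝ} (ha : ∀ j ∈ A, a j ∈ Icc (0 : ℝ) 1) :
    ∫ x : Fin (m + 1) → ℝ, kernelPhi m (fun j => if j ∈ A then a j else x j)
      ∂(Measure.pi fun _ => unif) =
    2 / (((m : ℝ) + 1) * ((m : ℝ) + 2)) - 2 / ((m : ℝ) + 1) *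
      ∫ u, mulForm (1 - u) (fun j => if j ∈ A then ind u (a j) else 1 - u) ∂unif := by
  set z : (Fin (m + 1) → ℝ) → Fin (m + 1) → ℝ := fun x j => if j ∈ A then a j else x j with hz
  have hzm : ∀ j, Measurable fun x => z x j := by
    intro j
    by_cases hj : j ∈ A <;> simp only [hz, hj, if_true, if_false] <;> fun_prop
  have h1 : ∀ᵐ x ∂(Measure.pi fun _ : Fin (m + 1) => unif), kernelPhi m (z x) =
      2 / (((m : ℝ) + 1) * ((m : ℝ) + 2))
      - 2 / ((m : ℝ) + 1) * ∫ u, mulForm (1 - u) (fun j => ind u (z x j)) ∂unif := by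
    filter_upwards [ae_pi_mem] with x hx
    refine kernelPhi_eq hm fun j => ?_
    by_cases hj : j ∈ A
    · simpa [hz, hj] using ha j hj
    · simpa [hz, hj] using hx j
  have hjm : Measurable fun y : (Fin (m + 1) → ℝ) × ℝ =>
      mulForm (1 - y.2) (fun j => ind y.2 (z y.1 j)) := by
    refine measurable_mulForm (by fun_prop) fun j => ?_
    exact measurable_ind measurable_snd ((hzm j).comp measurable_fst)
  have hji : Integrable (fun y : (Fin (m + 1) → ℝ) × ℝ =>
      mulForm (1 - y.2) (fun j => ind y.2 (z y.1 j)))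
      ((Measure.pi fun _ : Fin (m + 1) => unif).prod unif) := by
    refine Integrable.of_bound hjm.aestronglyMeasurable (2 * m + 1) ?_
    have := (Measure.quasiMeasurePreserving_snd
      (μ := Measure.pi fun _ : Fin (m + 1) => unif) (ν := unif)).ae ae_unif_mem
    filter_upwards [this] with y hy
    exact abs_mulForm_ind_le hy _
  have hprod : ∀ u ∈ Icc (0 : ℝ) 1, ∀ B : Finset (Fin (m + 1)),
      ∫ x, ∏ j ∈ B, ind u (z x j) ∂(Measure.pi fun _ => unif) =
        ∏ j ∈ B, (if j ∈ A then ind u (a j) else 1 - u) := by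
    intro u hu B
    have e1 : ∀ x, ∏ j ∈ B, ind u (z x j) =
        ∏ j, (if j ∈ B then (if j ∈ A then ind u (a j) else ind u (x j)) else 1) := by
      intro x
      rw [Finset.prod_ite_mem, Finset.univ_inter]
      refine Finset.prod_congr rfl fun j _ => ?_
      by_cases hj : j ∈ A <;> simp [hz, hj]
    simp only [e1]
    rw [integral_fintype_prod_eq_prod
      (fun j y => if j ∈ B then (if j ∈ A then ind u (a j) else ind u y) else 1),
      ← Finset.univ_inter B, ← Finset.prod_ite_mem]
    refine Finset.prod_congr rfl fun j _ => ?_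
    by_cases hB : j ∈ B <;> by_cases hA : j ∈ A <;> simp [hB, hA, integral_ind hu]
  have hint : ∀ u, ∀ B : Finset (Fin (m + 1)), Integrable (fun x => ∏ j ∈ B, ind u (z x j))
      (Measure.pi fun _ => unif) := by
    intro u B
    refine Integrable.of_bound (Measurable.aestronglyMeasurable ?_) 1
      (Eventually.of_forall fun x => abs_prod_ind_le _ _ _)
    exact Finset.measurable_prod _ fun j _ => measurable_ind measurable_const (hzm j)
  rw [integral_congr_ae h1, integral_sub (integrable_const _) (hji.integral_prod_left.const_mul _),
    integral_const_mul, integral_integral_swap hji]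
  congr 2
  · simp
  · refine integral_congr_ae ?_
    filter_upwards [ae_unif_mem] with u hu
    unfold mulForm
    rw [integral_sub ((integrable_finsetSum _ fun i _ => hint u _).const_mul _)
      ((hint u _).const_mul _), integral_const_mul, integral_const_mul,
      integral_finsetSum _ fun i _ => hint u _, hprod u hu]
    simp only [hprod u hu]

/-- The multilinear form has no first order terms around the constant vector `q`. -/
lemma mulForm_two {m : ℕ} {e f : Fin (m + 1)} (hef : e ≠ f) (q a b : ℝ) (hm : 1 ≤ m) :
    mulForm q (fun j => if j = e then a else if j = f then b else q) =
      q ^ (m + 1) - q ^ (m - 1) * ((a - q) * (b - q)) := by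
  obtain ⟨k, rfl⟩ : ∃ k, m = k + 1 := ⟨m - 1, by omega⟩
  set p : Fin (k + 1 + 1) → ℝ := fun j => if j = e then a else if j = f then b else q with hp
  have pe : p e = a := by simp [hp]
  have pf : p f = b := by simp [hp, hef.symm]
  have pq : ∀ j, j ≠ e → j ≠ f → p j = q := fun j h1 h2 => by simp [hp, h1, h2]
  have hconst : ∀ B : Finset (Fin (k + 1 + 1)), e ∉ B → f ∉ B → ∏ j ∈ B, p j = q ^ B.card :=
    fun B he hf => by
      rw [Finset.prod_congr rfl fun j hj => pq j (fun h => he (h ▸ hj)) (fun h => hf (h ▸ hj)),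
        Finset.prod_const]
  have hR : ((Finset.univ.erase e).erase f).card = k := by
    rw [Finset.card_erase_of_mem (by simp [hef.symm]), Finset.card_erase_of_mem (by simp)]
    simp
  have h1 : ∏ j ∈ Finset.univ.erase e, p j = b * q ^ k := by
    rw [← Finset.mul_prod_erase _ _ (show f ∈ Finset.univ.erase e by simp [hef.symm]), pf,
      hconst _ (by simp) (by simp), hR]
  have h2 : ∏ j ∈ Finset.univ.erase f, p j = a * q ^ k := by
    rw [← Finset.mul_prod_erase _ _ (show e ∈ Finset.univ.erase f by simp [hef]), pe,
      hconst _ (by simp) (by simp), Finset.erase_right_comm, hR]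
  have h0 : ∏ j, p j = a * (b * q ^ k) := by
    rw [← Finset.mul_prod_erase _ _ (Finset.mem_univ e), pe, h1]
  have h3 : ∀ i ∈ (Finset.univ.erase e).erase f,
      ∏ j ∈ Finset.univ.erase i, p j = a * (b * q ^ (k - 1)) := by
    intro i hi
    have hie : i ≠ e := by simp at hi; exact hi.2
    have hif : i ≠ f := by simp at hi; exact hi.1
    rw [← Finset.mul_prod_erase _ _ (show e ∈ Finset.univ.erase i by simp [hie.symm]), pe,
      ← Finset.mul_prod_erase _ _ (show f ∈ (Finset.univ.erase i).erase e by
        simp [hef.symm, hif.symm]), pf, hconst _ (by simp) (by simp)]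
    congr 3
    rw [Finset.card_erase_of_mem (by simp [hef.symm, hif.symm]),
      Finset.card_erase_of_mem (by simp [hie.symm]), Finset.card_erase_of_mem (by simp)]
    simp
  unfold mulForm
  rw [h0, ← Finset.add_sum_erase _ _ (Finset.mem_univ e),
    ← Finset.add_sum_erase _ _ (show f ∈ Finset.univ.erase e by simp [hef.symm]), h1, h2,
    Finset.sum_congr rfl h3, Finset.sum_const, hR]
  have hk : q * (k * (a * (b * q ^ (k - 1)))) = (k : ℝ) * (a * (b * q ^ k)) := by
    rcases k with _ | k
    · simp
    · simp only [Nat.add_sub_cancel]; ring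
  rw [nsmul_eq_mul, mul_add, mul_add, hk]
  simp only [Nat.add_sub_cancel]
  push_cast
  ring

lemma integral_unif_pow (k : ℕ) : ∫ u, (1 - u) ^ k ∂unif = 1 / ((k : ℝ) + 1) := by
  rw [integral_unif, intervalIntegral.integral_comp_sub_left (fun u => u ^ k)]
  simp

/-- With one argument frozen only zeroth and first order terms of the multilinear form remain; the
latter vanish, and the former cancels against the constant of the kernel. -/
lemma firstProj_eq_zero {m : ℕ} (hm : 1 ≤ m) {s : ℝ} (hs : s ∈ Icc (0 : ℝ) 1) :
    firstProj m s = 0 := by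
  have h := integral_kernelPhi_frozen hm {Fin.last m} (a := fun _ => s) fun _ _ => hs
  have hu : ∀ x : Fin (m + 1) → ℝ, Function.update x (Fin.last m) s =
      fun j => if j ∈ ({Fin.last m} : Finset _) then s else x j := by
    intro x
    ext j
    simp [Function.update_apply]
  have h0 : (0 : Fin (m + 1)) ≠ Fin.last m := by
    simp [Fin.ext_iff]; omega
  have hf : ∀ u, mulForm (1 - u) (fun j => if j ∈ ({Fin.last m} : Finset _) then ind u s
      else 1 - u) = (1 - u) ^ (m + 1) := by
    intro u
    have := mulForm_two h0 (1 - u) (1 - u) (ind u s) hm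
    rw [sub_self, zero_mul, mul_zero, sub_zero] at this
    rw [← this]
    congr 1
    ext j
    by_cases h1 : j = Fin.last m
    · subst h1; simp [h0.symm]
    · simp [h1]
  unfold firstProj
  simp only [hu]
  rw [h]
  simp only [hf]
  rw [integral_unif_pow]
  push_cast
  have : (m : ℝ) + 1 ≠ 0 := by positivity
  have : (m : ℝ) + 2 ≠ 0 := by positivity
  have : (m : ℝ) + 1 + 1 ≠ 0 := by positivity
  field_simp
  ring

/-- The second projection is a weighted Cramér–von Mises kernel. -/
lemma secondProj_eq {m : ℕ} (hm : 1 ≤ m) {s t : ℝ} (hs : s ∈ Icc (0 : ℝ) 1)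
    (ht : t ∈ Icc (0 : ℝ) 1) : secondProj m s t = covKer m s t := by
  set e : Fin (m + 1) := ⟨m - 1, by omega⟩ with he
  have hne : e ≠ Fin.last m := by
    simp [he, Fin.ext_iff]; omega
  have h := integral_kernelPhi_frozen hm {e, Fin.last m} (a := fun j => if j = e then s else t)
    fun j _ => by split_ifs; exacts [hs, ht]
  have hu : ∀ x : Fin (m + 1) → ℝ,
      Function.update (Function.update x e s) (Fin.last m) t =
      fun j => if j ∈ ({e, Fin.last m} : Finset _) then (if j = e then s else t) else x j := by
    intro x
    ext j
    by_cases h1 : j = Fin.last m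
    · subst h1; simp [hne.symm]
    · by_cases h2 : j = e
      · subst h2; simp [hne]
      · simp [h1, h2]
  have hf : ∀ u, mulForm (1 - u) (fun j => if j ∈ ({e, Fin.last m} : Finset _) then
      ind u (if j = e then s else t) else 1 - u) =
      (1 - u) ^ (m + 1) - (1 - u) ^ (m - 1) * (cind u s * cind u t) := by
    intro u
    unfold cind
    rw [← mulForm_two hne (1 - u) (ind u s) (ind u t) hm]
    congr 1
    ext j
    by_cases h1 : j = e
    · simp [h1]
    · by_cases h2 : j = Fin.last m
      · simp [h2, hne.symm]
      · simp [h1, h2]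
  have hi : Integrable (fun u => (1 - u) ^ (m - 1) * (cind u s * cind u t)) unif := by
    refine integrable_unif_of_bound (by fun_prop) 1 fun u hu => ?_
    rw [abs_mul, abs_mul, abs_pow]
    have h1 : |1 - u| ≤ 1 := by rw [abs_le]; constructor <;> linarith [hu.1, hu.2]
    exact mul_le_one₀ (pow_le_one₀ (abs_nonneg _) h1) (by positivity)
      (mul_le_one₀ (abs_cind_le hu s) (abs_nonneg _) (abs_cind_le hu t))
  have hi' : Integrable (fun u : ℝ => (1 - u) ^ (m + 1)) unif :=
    integrable_unif_of_bound (by fun_prop) 1 fun u hu => by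
      rw [abs_pow]
      exact pow_le_one₀ (abs_nonneg _) (by rw [abs_le]; constructor <;> linarith [hu.1, hu.2])
  unfold secondProj
  simp only [← he, hu]
  rw [h]
  simp only [hf]
  rw [integral_sub hi' hi, integral_unif_pow]
  have hc : covKer m s t = 2 / ((m : ℝ) + 1) *
      ∫ u, (1 - u) ^ (m - 1) * (cind u s * cind u t) ∂unif := by
    unfold covKer wt
    rw [← integral_const_mul]
    simp only [mul_assoc]
  rw [hc]
  push_cast
  have : (m : ℝ) + 1 ≠ 0 := by positivity
  have : (m : ℝ) + 2 ≠ 0 := by positivity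
  have : (m : ℝ) + 1 + 1 ≠ 0 := by positivity
  field_simp
  ring

lemma integral_pow_to (k : ℕ) (v : ℝ) :
    ∫ u in (0 : ℝ)..v, (1 - u) ^ k = (1 - (1 - v) ^ (k + 1)) / ((k : ℝ) + 1) := by
  rw [intervalIntegral.integral_comp_sub_left (fun u => u ^ k)]
  simp

lemma covKer_eq {m : ℕ} (hm : 1 ≤ m) {s t : ℝ} (hs : s ∈ Icc (0 : ℝ) 1)
    (ht : t ∈ Icc (0 : ℝ) 1) :
    covKer m s t = 2 / ((m : ℝ) + 1) * ((1 - (1 - min s t) ^ m) / m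
      - (1 - (1 - s) ^ (m + 1)) / ((m : ℝ) + 1) - (1 - (1 - t) ^ (m + 1)) / ((m : ℝ) + 1)
      + 1 / ((m : ℝ) + 2)) := by
  obtain ⟨k, rfl⟩ : ∃ k, m = k + 1 := ⟨m - 1, by omega⟩
  have hb : ∀ (j : ℕ) (v : ℝ), Integrable (fun u => (1 - u) ^ j * ind u v) unif := fun j v =>
    integrable_unif_of_bound (by fun_prop) 1 fun u hu => by
      rw [abs_mul, abs_pow]
      exact mul_le_one₀ (pow_le_one₀ (abs_nonneg _)
        (by rw [abs_le]; constructor <;> linarith [hu.1, hu.2])) (abs_nonneg _) (abs_ind_le u v)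
  have hb' : Integrable (fun u : ℝ => (1 - u) ^ (k + 2)) unif :=
    integrable_unif_of_bound (by fun_prop) 1 fun u hu => by
      rw [abs_pow]
      exact pow_le_one₀ (abs_nonneg _) (by rw [abs_le]; constructor <;> linarith [hu.1, hu.2])
  have hmin : min s t ∈ Icc (0 : ℝ) 1 := ⟨le_min hs.1 ht.1, (min_le_left _ _).trans hs.2⟩
  have hexp : ∀ u, (1 - u) ^ k * (cind u s * cind u t) = (1 - u) ^ k * ind u (min s t)
      - (1 - u) ^ (k + 1) * ind u s - (1 - u) ^ (k + 1) * ind u t + (1 - u) ^ (k + 2) := by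
    intro u
    have : ind u (min s t) = ind u s * ind u t := by
      unfold ind
      simp only [lt_min_iff]
      by_cases h1 : u < s <;> by_cases h2 : u < t <;> simp [h1, h2]
    rw [this]
    unfold cind
    ring
  unfold covKer wt
  simp only [mul_assoc, Nat.add_sub_cancel]
  rw [integral_const_mul]
  simp only [hexp]
  have i1 := (hb k (min s t)).sub (hb (k + 1) s)
  have i2 := i1.sub (hb (k + 1) t)
  simp only [Pi.sub_def] at i1 i2
  rw [integral_add i2 hb', integral_sub i1 (hb _ _), integral_sub (hb _ _) (hb _ _),
    integral_mul_ind (φ := fun u => (1 - u) ^ k) hmin,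
    integral_mul_ind (φ := fun u => (1 - u) ^ (k + 1)) hs,
    integral_mul_ind (φ := fun u => (1 - u) ^ (k + 1)) ht, integral_pow_to, integral_pow_to,
    integral_pow_to, integral_unif_pow]
  push_cast
  ring_nf

/-- The formula is not symmetric in `s` and `t` as written: the powers of `1 - min s t` are split
according to the order of the arguments. -/
lemma covKer_formula {m : ℕ} (hm : 1 ≤ m) {s t : ℝ} (hs : s ∈ Icc (0 : ℝ) 1)
    (ht : t ∈ Icc (0 : ℝ) 1) :
    covKer m s t = -(2 / ((m : ℝ) * (1 + m) ^ 2 * (2 + m))) *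
            (-2 + 2 * (1 - t) ^ m
              + (m : ℝ) ^ 2 * (-(1 - s) ^ (m + 1) + (1 - t) ^ m * t)
              + (m : ℝ) * (-2 * (1 - s) ^ (m + 1) + (1 - t) ^ m + 2 * (1 - t) ^ m * t))
          + 2 / ((m : ℝ) * (1 + m)) *
            (if s < t then (1 - t) ^ m - (1 - s) ^ m else 0) := by
  have h0 : (m : ℝ) ≠ 0 := by positivity
  have h1 : (m : ℝ) + 1 ≠ 0 := by positivity
  have h2 : (m : ℝ) + 2 ≠ 0 := by positivity
  have h1' : 1 + (m : ℝ) ≠ 0 := by positivity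
  have h2' : 2 + (m : ℝ) ≠ 0 := by positivity
  rw [covKer_eq hm hs ht, pow_succ (1 - s), pow_succ (1 - t)]
  split_ifs with h
  · rw [min_eq_left h.le]
    generalize (1 - s) ^ m = x
    generalize (1 - t) ^ m = y
    field_simp
    ring
  · rw [min_eq_right (not_lt.1 h)]
    generalize (1 - s) ^ m = x
    generalize (1 - t) ^ m = y
    field_simp
    ring

/-! ### Spectral theory of Gram operators -/

section Gram

variable {U : Type*} [MeasurableSpace U] {μ : Measure U}
  {H : Type*} [NormedAddCommGroup H] [InnerProductSpace ℝ H]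

open scoped RealInnerProductSpace

/-- An orthonormal family in a separable space is countable: the balls of radius `1/2` around its
members are disjoint. -/
lemma countable_of_orthonormal [SecondCountableTopology H] {ι : Type*} {e : ι → H}
    (he : Orthonormal ℝ e) : Countable ι := by
  have hd : (univ : Set ι).PairwiseDisjoint fun i => Metric.ball (e i) (1 / 2) := by
    intro i _ j _ hij
    refine Metric.ball_disjoint_ball ?_
    have h2 : ‖e i - e j‖ ^ 2 = 2 := by
      rw [norm_sub_sq_real, he.1 i, he.1 j, he.2 hij]; norm_num
    rw [dist_eq_norm]
    nlinarith [norm_nonneg (e i - e j)]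
  have := hd.countable_of_isOpen (fun i _ => Metric.isOpen_ball)
    (fun i _ => ⟨e i, Metric.mem_ball_self (by norm_num)⟩)
  exact countable_univ_iff.1 this

/-- The Gram operator `∫ ⟪g u, ·⟫ g u dμ(u)` of a Hilbert space valued map `g`, as a Bochner
integral of operators of rank one; it is meaningful for `g` in `L²`. -/
noncomputable def gram (μ : Measure U) (g : U → H) : H →L[ℝ] H :=
  ∫ u, InnerProductSpace.rankOne ℝ (g u) (g u) ∂μ

lemma integrable_rankOne {g : U → H} (hg : MemLp g 2 μ) :
    Integrable (fun u => InnerProductSpace.rankOne ℝ (g u) (g u)) μ := by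
  have hm : AEStronglyMeasurable (fun u => InnerProductSpace.rankOne ℝ (g u) (g u)) μ := by
    have hc : Continuous fun x : H => InnerProductSpace.rankOne ℝ x x :=
      (InnerProductSpace.rankOne ℝ (E := H) (F := H)).continuous.clm_apply continuous_id
    exact hc.comp_aestronglyMeasurable hg.1
  refine (integrable_norm_iff hm).1 ?_
  simp only [InnerProductSpace.norm_rankOne, ← sq]
  exact hg.integrable_norm_pow two_ne_zero

variable [CompleteSpace H]

lemma inner_gram {g : U → H} (hg : MemLp g 2 μ) (x y : H) :
    ⟪gram μ g x, y⟫ = ∫ u, ⟪g u, x⟫ * ⟪g u, y⟫ ∂μ := by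
  have hi := integrable_rankOne hg
  rw [gram, ContinuousLinearMap.integral_apply hi, real_inner_comm,
    ← integral_inner (hi.apply_continuousLinearMap x)]
  refine integral_congr_ae (Eventually.of_forall fun u => ?_)
  simp only [InnerProductSpace.rankOne_apply, inner_smul_right]
  rw [real_inner_comm y]

lemma gram_isSymmetric {g : U → H} (hg : MemLp g 2 μ) : (gram μ g).IsSymmetric := by
  intro x y
  change ⟪gram μ g x, y⟫ = ⟪x, gram μ g y⟫
  rw [real_inner_comm (gram μ g y) x, inner_gram hg, inner_gram hg]
  simp only [mul_comm]

/-- A Gram operator is an average of operators of rank one, hence compact. -/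
lemma gram_isCompactOperator [IsProbabilityMeasure μ] {g : U → H} (hg : MemLp g 2 μ) :
    IsCompactOperator (gram μ g) := by
  have hclosed : IsClosed {f : H →L[ℝ] H | IsCompactOperator f} :=
    isClosed_setOfPred_isCompactOperator
  have hconv : Convex ℝ {f : H →L[ℝ] H | IsCompactOperator f} :=
    (compactOperator (RingHom.id ℝ) H H).convex
  refine hconv.integral_mem hclosed (Eventually.of_forall fun u => ?_) (integrable_rankOne hg)
  have h1 : IsCompactOperator (innerSL ℝ (g u)) :=
    isCompactOperator_of_locallyCompactSpace_dom (innerSL ℝ (g u))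
  exact h1.clm_comp (ContinuousLinearMap.toSpanSingleton ℝ (g u))

/-- For a compact self-adjoint operator, every list of the nonzero eigenvalues with multiplicity
comes with an orthonormal family of eigenvectors whose orthogonal complement is in the kernel. -/
theorem exists_orthonormal_of_lists {T : H →L[ℝ] H} (hT : IsCompactOperator T)
    (hT' : T.IsSymmetric) {ν : ℕ → ℝ}
    (hν : ∀ c : ℝ, c ≠ 0 → {i | ν i = c}.encard =
      Cardinal.toENat (Module.rank ℝ (Module.End.eigenspace (T : Module.End ℝ H) c))) :
    ∃ e : {i // ν i ≠ 0} → H, Orthonormal ℝ e ∧ (∀ i, T (e i) = ν i • e i) ∧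
      ∀ x, (∀ i, ⟪e i, x⟫ = 0) → T x = 0 := by
  have hfin : ∀ c : ℝ, c ≠ 0 →
      FiniteDimensional ℝ (Module.End.eigenspace (T : Module.End ℝ H) c) :=
    fun c hc => ContinuousLinearMap.finite_dimensional_eigenspace hT c hc
  have hequiv : ∀ c : ℝ, c ≠ 0 → Nonempty ({i // ν i = c} ≃
      Fin (Module.finrank ℝ (Module.End.eigenspace (T : Module.End ℝ H) c))) := by
    intro c hc
    have := hfin c hc
    have h1 : {i | ν i = c}.encard =
        (Module.finrank ℝ (Module.End.eigenspace (T : Module.End ℝ H) c) : ℕ∞) := by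
      rw [hν c hc, ← Module.finrank_eq_rank]
      simp
    have hf : {i | ν i = c}.Finite := Set.finite_of_encard_eq_coe h1
    have : Finite {i // ν i = c} := hf
    refine ⟨Finite.equivFinOfCardEq ?_⟩
    rw [hf.encard_eq_coe_toFinset_card] at h1
    rw [← ENat.natCast_inj.1 h1, ← Set.ncard_eq_toFinset_card _ hf]
    rfl
  let φ := fun c : {c : ℝ // c ≠ 0} => (hequiv c c.2).some
  let b := fun c : {c : ℝ // c ≠ 0} =>
    haveI := hfin c c.2
    stdOrthonormalBasis ℝ (Module.End.eigenspace (T : Module.End ℝ H) (c : ℝ))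
  let e : {i // ν i ≠ 0} → H := fun i => b ⟨ν i, i.2⟩ (φ ⟨ν i, i.2⟩ ⟨i, rfl⟩)
  have hmem : ∀ i : {i // ν i ≠ 0},
      e i ∈ Module.End.eigenspace (T : Module.End ℝ H) (ν i) := fun i =>
    Subtype.coe_prop (b ⟨ν i, i.2⟩ (φ ⟨ν i, i.2⟩ ⟨i, rfl⟩))
  have he' : ∀ (c : {c : ℝ // c ≠ 0}) (i : {i // ν i ≠ 0}) (h : ν i = c),
      e i = b c (φ c ⟨i, h⟩) := by
    rintro ⟨c, hc⟩ i h
    change ν i = c at h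
    subst h
    rfl
  refine ⟨e, ⟨fun i => ?_, fun i j hij => ?_⟩, fun i => ?_, fun x hx => ?_⟩
  · exact (b ⟨ν i, i.2⟩).norm_eq_one _
  · by_cases h : ν i = ν j
    · change ⟪e i, e j⟫ = 0
      rw [he' ⟨ν j, j.2⟩ i h, he' ⟨ν j, j.2⟩ j rfl, ← Submodule.coe_inner,
        (b ⟨ν j, j.2⟩).inner_eq_zero]
      intro h'
      have := (φ ⟨ν j, j.2⟩).injective h'
      exact hij (Subtype.ext (by simpa using this))
    · exact hT'.orthogonalFamily_eigenspaces h ⟨e i, hmem i⟩ ⟨e j, hmem j⟩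
  · exact Module.End.mem_eigenspace_iff.1 (hmem i)
  · -- `x` is orthogonal to all eigenspaces except the kernel, and so is its component
    -- orthogonal to the kernel, which therefore vanishes by the spectral theorem.
    have hperp : ∀ c : ℝ, c ≠ 0 → ∀ y ∈ Module.End.eigenspace (T : Module.End ℝ H) c,
        ⟪y, x⟫ = 0 := by
      intro c hc y hy
      have hb : ∀ k, ⟪(b ⟨c, hc⟩ k : H), x⟫ = 0 := by
        intro k
        have h := hx ⟨(φ ⟨c, hc⟩).symm k, by rw [((φ ⟨c, hc⟩).symm k).2]; exact hc⟩
        rw [he' ⟨c, hc⟩ _ ((φ ⟨c, hc⟩).symm k).2] at h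
        simpa using h
      have hy' := (b ⟨c, hc⟩).sum_repr ⟨y, hy⟩
      have hy'' : y = ∑ k, (b ⟨c, hc⟩).repr ⟨y, hy⟩ k • (b ⟨c, hc⟩ k : H) := by
        conv_lhs => rw [show y = ((⟨y, hy⟩ :
          Module.End.eigenspace (T : Module.End ℝ H) c) : H) from rfl, ← hy']
        simp
      rw [hy'', sum_inner]
      exact Finset.sum_eq_zero fun k _ => by rw [inner_smul_left, hb k, mul_zero]
    set K := Module.End.eigenspace (T : Module.End ℝ H) 0 with hK
    have hKc : IsClosed (K : Set H) := by
      have : (K : Set H) = T ⁻¹' {0} := by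
        ext z
        simp [hK]
      rw [this]
      exact isClosed_singleton.preimage T.continuous
    have : CompleteSpace K := hKc.completeSpace_coe
    obtain ⟨y, hy, z, hz, hxyz⟩ := K.exists_add_mem_mem_orthogonal x
    have hz0 : z ∈ (⨆ c, Module.End.eigenspace (T : Module.End ℝ H) c)ᗮ := by
      rw [← Submodule.iInf_orthogonal, Submodule.mem_iInf]
      intro c
      rw [Submodule.mem_orthogonal]
      intro v hv
      by_cases hc : c = 0
      · subst hc
        exact (Submodule.mem_orthogonal _ _).1 hz v hv
      · have h1 := hperp c hc v hv
        have h2 : ⟪v, y⟫ = 0 := hT'.orthogonalFamily_eigenspaces hc ⟨v, hv⟩ ⟨y, hy⟩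
        rw [hxyz, inner_add_right, h2, zero_add] at h1
        exact h1
    rw [ContinuousLinearMap.orthogonalComplement_iSup_eigenspaces_eq_bot hT hT',
      Submodule.mem_bot] at hz0
    rw [hxyz, hz0, add_zero]
    simpa using Module.End.mem_eigenspace_iff.1 hy

/-- The nonzero eigenvalues of a compact self-adjoint operator on a separable space can be listed
with multiplicity. -/
theorem exists_lists [SecondCountableTopology H] {T : H →L[ℝ] H} (hT : IsCompactOperator T)
    (hT' : T.IsSymmetric) :
    ∃ ν : ℕ → ℝ, ∀ c : ℝ, c ≠ 0 → {i | ν i = c}.encard =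
      Cardinal.toENat (Module.rank ℝ (Module.End.eigenspace (T : Module.End ℝ H) c)) := by
  have hfin : ∀ c : ℝ, c ≠ 0 →
      FiniteDimensional ℝ (Module.End.eigenspace (T : Module.End ℝ H) c) :=
    fun c hc => ContinuousLinearMap.finite_dimensional_eigenspace hT c hc
  let b := fun c : {c : ℝ // c ≠ 0} =>
    haveI := hfin c c.2
    stdOrthonormalBasis ℝ (Module.End.eigenspace (T : Module.End ℝ H) (c : ℝ))
  let ι := Σ c : {c : ℝ // c ≠ 0},
    Fin (Module.finrank ℝ (Module.End.eigenspace (T : Module.End ℝ H) (c : ℝ)))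
  let e : ι → H := fun i => b i.1 i.2
  have he : Orthonormal ℝ e := by
    refine ⟨fun i => (b i.1).norm_eq_one _, ?_⟩
    rintro ⟨c, i⟩ ⟨d, j⟩ hij
    by_cases h : c = d
    · subst h
      change ⟪((b c i : _) : H), b c j⟫ = 0
      rw [← Submodule.coe_inner, (b c).inner_eq_zero]
      rintro rfl
      exact hij rfl
    · exact hT'.orthogonalFamily_eigenspaces (fun h' => h (Subtype.ext h')) (b c i) (b d j)
  have : Countable ι := countable_of_orthonormal he
  obtain ⟨f, hf⟩ := Countable.exists_injective_nat ι
  classical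
  refine ⟨fun n => if h : ∃ i, f i = n then (h.choose.1 : ℝ) else 0, fun c hc => ?_⟩
  have hval : ∀ i, (if h : ∃ j, f j = f i then (h.choose.1 : ℝ) else 0) = i.1 := by
    intro i
    have h : ∃ j, f j = f i := ⟨i, rfl⟩
    rw [dif_pos h, hf h.choose_spec]
  have hset : {n | (if h : ∃ i, f i = n then (h.choose.1 : ℝ) else 0) = c} =
      (fun k => f ⟨⟨c, hc⟩, k⟩) '' univ := by
    ext n
    simp only [mem_ofPred_eq, image_univ, mem_range]
    constructor
    · intro h
      by_cases hn : ∃ i, f i = n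
      · obtain ⟨⟨⟨d, hd⟩, k⟩, rfl⟩ := hn
        rw [hval] at h
        simp only at h
        subst h
        exact ⟨k, rfl⟩
      · rw [dif_neg hn] at h
        exact absurd h.symm hc
    · rintro ⟨k, rfl⟩
      rw [hval]
  rw [hset, Function.Injective.encard_image (fun k l hkl => eq_of_heq (Sigma.mk.inj (hf hkl)).2)]
  have := hfin c hc
  rw [← Module.finrank_eq_rank]
  simp

/-- The trace formula: the eigenvalues of a Gram operator sum up to `∫ ‖g u‖² dμ(u)`. The
eigenvectors are completed to a Hilbert basis, along which `‖g u‖²` is expanded; the added basis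
vectors lie in the kernel of the operator and contribute nothing. -/
theorem hasSum_eigenvalues [SecondCountableTopology H] {g : U → H} (hg : MemLp g 2 μ)
    {ν : ℕ → ℝ} {e : {i // ν i ≠ 0} → H} (he : Orthonormal ℝ e)
    (hev : ∀ i, gram μ g (e i) = ν i • e i)
    (hker : ∀ x, (∀ i, ⟪e i, x⟫ = 0) → gram μ g x = 0) :
    HasSum ν (∫ u, ‖g u‖ ^ 2 ∂μ) := by
  obtain ⟨w, b, hw, hb⟩ := he.toSubtypeRange.exists_hilbertBasis_extension
  have hwo : Orthonormal ℝ ((↑) : w → H) := hb ▸ b.orthonormal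
  have : Countable w := countable_of_orthonormal hwo
  have hin : ∀ x : H, Integrable (fun u => ⟪g u, x⟫ ^ 2) μ := fun x =>
    (hg.inner_const (𝕜 := ℝ) x).integrable_sq
  have hpars : ∀ u, HasSum (fun x : w => ⟪g u, (x : H)⟫ ^ 2) (‖g u‖ ^ 2) := by
    intro u
    have := b.hasSum_inner_mul_inner (g u) (g u)
    rw [real_inner_self_eq_norm_sq] at this
    convert! this using 2 with x
    rw [hb, real_inner_comm (g u), sq]
  have hsumInt : HasSum (fun x : w => ∫ u, ⟪g u, (x : H)⟫ ^ 2 ∂μ) (∫ u, ‖g u‖ ^ 2 ∂μ) := by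
    refine hasSum_integral_of_dominated_convergence (fun x u => ⟪g u, (x : H)⟫ ^ 2)
      (fun x => (hin x).1) (fun x => Eventually.of_forall fun u => ?_)
      (Eventually.of_forall fun u => (hpars u).summable) ?_ (Eventually.of_forall hpars)
    · rw [Real.norm_of_nonneg (sq_nonneg _)]
    · simp only [fun u => (hpars u).tsum_eq]
      exact hg.integrable_norm_pow two_ne_zero
  have hinj : Function.Injective fun i : {i // ν i ≠ 0} => (⟨e i, hw ⟨i, rfl⟩⟩ : w) := by
    intro i j hij
    exact he.linearIndependent.injective (congrArg Subtype.val hij)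
  have hzero : ∀ x ∉ range fun i : {i // ν i ≠ 0} => (⟨e i, hw ⟨i, rfl⟩⟩ : w),
      ∫ u, ⟪g u, (x : H)⟫ ^ 2 ∂μ = 0 := by
    intro x hx
    have h := hker x fun i => hwo.2 (i := ⟨e i, hw ⟨i, rfl⟩⟩) fun h => hx ⟨i, h⟩
    have := inner_gram hg (x : H) x
    rw [h, inner_zero_left] at this
    simp only [sq]
    exact this.symm
  have h1 := (hinj.hasSum_iff hzero).2 hsumInt
  have h2 : HasSum (fun i : {i // ν i ≠ 0} => ν i) (∫ u, ‖g u‖ ^ 2 ∂μ) := by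
    convert! h1 using 2 with i
    have := inner_gram hg (e i) (e i)
    rw [hev, inner_smul_left, real_inner_self_eq_norm_sq, he.1 i] at this
    simpa [sq] using this
  exact (hasSum_subtype_iff_of_support_subset (s := {i | ν i ≠ 0}) (fun i hi => hi)).1 h2

end Gram

/-! ### The integral operator as a Gram operator -/

open scoped RealInnerProductSpace

/-- The integral of `f` against the centred exceedance indicator at `u`. -/
noncomputable def cF (f : ℝ → ℝ) (u : ℝ) : ℝ := ∫ s, cind u s * f s ∂unif

lemma covKer_symm (m : ℕ) (s t : ℝ) : covKer m s t = covKer m t s := by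
  unfold covKer
  simp only [mul_comm (cind _ s)]

lemma ae_prod_mem : ∀ᵐ p ∂(unif.prod unif), p.1 ∈ Icc (0 : ℝ) 1 ∧ p.2 ∈ Icc (0 : ℝ) 1 :=
  (Measure.quasiMeasurePreserving_fst.ae ae_unif_mem).and
    (Measure.quasiMeasurePreserving_snd.ae ae_unif_mem)

lemma abs_wt_mul_cind_le (m : ℕ) {u : ℝ} (hu : u ∈ Icc (0 : ℝ) 1) (s t : ℝ) :
    |wt m u * (cind u s * cind u t)| ≤ 2 := by
  rw [abs_mul, abs_mul]
  calc _ ≤ 2 * (1 * 1) := mul_le_mul (abs_wt_le m hu)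
        (mul_le_mul (abs_cind_le hu s) (abs_cind_le hu t) (abs_nonneg _) zero_le_one)
        (by positivity) (by norm_num)
    _ = 2 := by norm_num

lemma integrable_wt_cind (m : ℕ) (s t : ℝ) :
    Integrable (fun u => wt m u * (cind u s * cind u t)) unif :=
  integrable_unif_of_bound (by fun_prop) 2 fun _ hu => abs_wt_mul_cind_le m hu s t

lemma abs_covKer_le (m : ℕ) (s t : ℝ) : |covKer m s t| ≤ 2 := by
  have h := norm_integral_le_of_norm_le_const (μ := unif) (C := 2)
    (f := fun u => wt m u * (cind u s * cind u t))
    (ae_unif_mem.mono fun u hu => abs_wt_mul_cind_le m hu s t)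
  simpa [covKer] using h

lemma measurable_covKer (m : ℕ) : Measurable (Function.uncurry (covKer m)) := by
  have : StronglyMeasurable fun p : (ℝ × ℝ) × ℝ =>
      wt m p.2 * (cind p.2 p.1.1 * cind p.2 p.1.2) := by
    apply Measurable.stronglyMeasurable
    fun_prop
  exact this.integral_prod_right'.measurable

lemma secondProj_ae_eq {m : ℕ} (hm : 1 ≤ m) :
    Function.uncurry (secondProj m) =ᵐ[unif.prod unif] Function.uncurry (covKer m) := by
  filter_upwards [ae_prod_mem] with p hp
  exact secondProj_eq hm hp.1 hp.2

lemma memLp_secondProj {m : ℕ} (hm : 1 ≤ m) :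
    MemLp (Function.uncurry (secondProj m)) 2 (unif.prod unif) := by
  refine MemLp.ae_eq (secondProj_ae_eq hm).symm ?_
  exact MemLp.of_bound (measurable_covKer m).aestronglyMeasurable 2
    (Eventually.of_forall fun p => abs_covKer_le m p.1 p.2)

lemma integrable_cind_mul {f : ℝ → ℝ} (hf : Integrable f unif) (u : ℝ) :
    Integrable (fun s => cind u s * f s) unif := by
  refine hf.bdd_mul (c := 1 + |1 - u|) (by fun_prop) (Eventually.of_forall fun s => ?_)
  refine (abs_sub _ _).trans ?_
  linarith [abs_ind_le u s]

lemma abs_cF_le {f : ℝ → ℝ} (hf : Integrable f unif) {u : ℝ} (hu : u ∈ Icc (0 : ℝ) 1) :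
    |cF f u| ≤ ∫ s, |f s| ∂unif := by
  refine (norm_integral_le_integral_norm _).trans (integral_mono (integrable_cind_mul hf u).norm
    hf.abs fun s => ?_)
  simp only [norm_mul, Real.norm_eq_abs]
  exact mul_le_of_le_one_left (abs_nonneg _) (abs_cind_le hu s)

lemma aestronglyMeasurable_cF {f : ℝ → ℝ} (hf : Integrable f unif) :
    AEStronglyMeasurable (cF f) unif := by
  have : AEStronglyMeasurable (fun p : ℝ × ℝ => cind p.1 p.2 * f p.2) (unif.prod unif) :=
    (Measurable.aestronglyMeasurable (by fun_prop)).mul hf.1.comp_snd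
  exact this.integral_prod_right'

lemma ae_snd_mem : ∀ᵐ p ∂(unif.prod unif), p.2 ∈ Icc (0 : ℝ) 1 := ae_prod_mem.mono fun _ h => h.2

/-- Exchange of the integrals over the argument and over the threshold. -/
lemma integral_mul_integral_wt (m : ℕ) {h F : ℝ → ℝ} (hh : Integrable h unif)
    (hF : AEStronglyMeasurable F unif) {C : ℝ} (hC : ∀ u ∈ Icc (0 : ℝ) 1, |F u| ≤ C) :
    ∫ t, h t * ∫ u, wt m u * (cind u t * F u) ∂unif ∂unif =
      ∫ u, wt m u * (cF h u * F u) ∂unif := by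
  have hC0 : 0 ≤ C := (abs_nonneg _).trans (hC 0 (by simp))
  have hi : Integrable (fun p : ℝ × ℝ => h p.1 * (wt m p.2 * (cind p.2 p.1 * F p.2)))
      (unif.prod unif) := by
    have hb : ∀ᵐ p ∂(unif.prod unif), ‖wt m p.2 * (cind p.2 p.1 * F p.2)‖ ≤ 2 * (1 * C) := by
      filter_upwards [ae_snd_mem] with p hp
      rw [Real.norm_eq_abs, abs_mul, abs_mul]
      exact mul_le_mul (abs_wt_le m hp)
        (mul_le_mul (abs_cind_le hp _) (hC _ hp) (abs_nonneg _) zero_le_one)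
        (by positivity) (by norm_num)
    refine (hh.comp_fst unif).mul_bdd (c := 2 * (1 * C)) ?_ hb
    exact (Measurable.aestronglyMeasurable (by fun_prop)).mul
      ((Measurable.aestronglyMeasurable (by fun_prop)).mul hF.comp_snd)
  calc _ = ∫ t, ∫ u, h t * (wt m u * (cind u t * F u)) ∂unif ∂unif := by
        simp only [integral_const_mul]
    _ = ∫ u, ∫ t, h t * (wt m u * (cind u t * F u)) ∂unif ∂unif := integral_integral_swap hi
    _ = _ := by
        refine integral_congr_ae (Eventually.of_forall fun u => ?_)
        simp only [cF]
        rw [← integral_mul_const, ← integral_const_mul]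
        refine integral_congr_ae (Eventually.of_forall fun t => ?_)
        simp only
        ring

lemma integral_covKer_mul (m : ℕ) {f : ℝ → ℝ} (hf : Integrable f unif) (t : ℝ) :
    ∫ s, covKer m s t * f s ∂unif = ∫ u, wt m u * (cind u t * cF f u) ∂unif := by
  have h := integral_mul_integral_wt m hf (F := fun u => cind u t)
    (Measurable.aestronglyMeasurable (by fun_prop)) (C := 1) fun u hu => abs_cind_le hu t
  unfold covKer
  simp only [mul_comm _ (f _)]
  rw [h]
  simp only [mul_comm (cF f _)]

lemma memLp_cind (u : ℝ) : MemLp (cind u) 2 unif :=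
  MemLp.of_bound (Measurable.aestronglyMeasurable (by fun_prop)) (1 + |1 - u|)
    (Eventually.of_forall fun s => (abs_sub _ _).trans (by linarith [abs_ind_le u s]))

/-- The centred exceedance indicator at `u` as an element of `L²[0,1]`. -/
noncomputable def cindL (u : ℝ) : L2 := (memLp_cind u).toLp

/-- The feature map `u ↦ √w(u) (1{u < ·} - (1 - u))` of the kernel. -/
noncomputable def feat (m : ℕ) (u : ℝ) : L2 := √(wt m u) • cindL u

lemma continuous_cindL : Continuous cindL := by
  have h1 : Continuous fun u : ℝ => indicatorConstLp (μ := unif) 2 (measurableSet_Ioi (a := u))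
      (measure_ne_top _ _) (1 : ℝ) := by
    refine continuous_indicatorConstLp_set (by norm_num) fun x => ?_
    have hle : ∀ y, unif (symmDiff (Ioi y) (Ioi x)) ≤ ENNReal.ofReal |x - y| := by
      intro y
      refine (Measure.restrict_apply_le _ _).trans ?_
      have : symmDiff (Ioi y) (Ioi x) ⊆ uIoc x y := by
        intro z hz
        rw [Set.mem_symmDiff] at hz
        rw [Set.mem_uIoc]
        rcases hz with ⟨h1, h2⟩ | ⟨h1, h2⟩
        · right; exact ⟨h1, not_lt.1 h2⟩
        · left; exact ⟨h1, not_lt.1 h2⟩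
      refine (measure_mono this).trans ?_
      rw [Real.volume_uIoc, abs_sub_comm]
    refine tendsto_of_tendsto_of_tendsto_of_le_of_le tendsto_const_nhds ?_ (fun _ => zero_le) hle
    have : Continuous fun y : ℝ => ENNReal.ofReal |x - y| :=
      ENNReal.continuous_ofReal.comp (by fun_prop)
    simpa using this.tendsto x
  have h2 : cindL = fun u => indicatorConstLp (μ := unif) 2 (measurableSet_Ioi (a := u))
      (measure_ne_top _ _) (1 : ℝ) - (1 - u) • indicatorConstLp (μ := unif) 2 MeasurableSet.univ
      (measure_ne_top _ _) (1 : ℝ) := by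
    ext1 u
    ext1
    refine (memLp_cind u).coeFn_toLp.trans ?_
    filter_upwards [Lp.coeFn_sub (indicatorConstLp (μ := unif) 2 (measurableSet_Ioi (a := u))
      (measure_ne_top _ _) (1 : ℝ)) ((1 - u) • indicatorConstLp (μ := unif) 2 MeasurableSet.univ
      (measure_ne_top _ _) (1 : ℝ)), Lp.coeFn_smul (1 - u) (indicatorConstLp (μ := unif) 2
      MeasurableSet.univ (measure_ne_top _ _) (1 : ℝ)),
      indicatorConstLp_coeFn (μ := unif) (p := 2) (hs := measurableSet_Ioi (a := u))
        (hμs := measure_ne_top _ _) (c := (1 : ℝ)),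
      indicatorConstLp_coeFn (μ := unif) (p := 2) (hs := MeasurableSet.univ)
        (hμs := measure_ne_top _ _) (c := (1 : ℝ))] with s e1 e2 e3 e4
    rw [e1, Pi.sub_apply, e2, Pi.smul_apply, e3, e4]
    by_cases hs : u < s <;> simp [cind, ind, hs]
  rw [h2]
  exact h1.sub ((continuous_const.sub continuous_id).smul continuous_const)

lemma inner_cindL (u : ℝ) (f : L2) : ⟪cindL u, f⟫ = cF f u := by
  rw [L2.inner_def, cF]
  refine integral_congr_ae ?_
  filter_upwards [(memLp_cind u).coeFn_toLp] with s hs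
  change ⟪((memLp_cind u).toLp : L2) s, f s⟫ = _
  rw [hs]
  simp [mul_comm]

lemma norm_sq_cindL {u : ℝ} (hu : u ∈ Icc (0 : ℝ) 1) : ‖cindL u‖ ^ 2 = (1 - u) * u := by
  rw [← real_inner_self_eq_norm_sq, inner_cindL, ← integral_cind_sq hu, cF]
  refine integral_congr_ae ?_
  filter_upwards [(memLp_cind u).coeFn_toLp] with s hs
  change cind u s * ((memLp_cind u).toLp : L2) s = _
  rw [hs, sq]

lemma norm_sq_feat (m : ℕ) {u : ℝ} (hu : u ∈ Icc (0 : ℝ) 1) :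
    ‖feat m u‖ ^ 2 = wt m u * ((1 - u) * u) := by
  rw [feat, norm_smul, mul_pow, norm_sq_cindL hu, Real.norm_eq_abs, sq_abs,
    Real.sq_sqrt (wt_nonneg m hu)]

lemma memLp_feat (m : ℕ) : MemLp (feat m) 2 unif := by
  have hc : Continuous (feat m) := (continuous_wt m).sqrt.smul continuous_cindL
  refine MemLp.of_bound hc.aestronglyMeasurable 2 ?_
  filter_upwards [ae_unif_mem] with u hu
  refine abs_le_of_sq_le_sq' ?_ (by norm_num) |>.2
  rw [norm_sq_feat m hu]
  have h1 : (1 - u) * u ≤ 1 := by nlinarith [hu.1, hu.2]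
  have h2 : 0 ≤ (1 - u) * u := mul_nonneg (by linarith [hu.2]) hu.1
  nlinarith [wt_nonneg m hu, wt_le_two m hu]

lemma integrable_coe_L2 (f : L2) : Integrable f unif := (Lp.memLp f).integrable one_le_two

lemma inner_gram_feat (m : ℕ) (f h : L2) :
    ⟪gram unif (feat m) f, h⟫ = ∫ u, wt m u * (cF h u * cF f u) ∂unif := by
  rw [inner_gram (memLp_feat m)]
  refine integral_congr_ae ?_
  filter_upwards [ae_unif_mem] with u hu
  simp only [feat, real_inner_smul_left, inner_cindL]
  have := Real.mul_self_sqrt (wt_nonneg m hu)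
  linear_combination (cF f u * cF h u) * this

lemma opS_coeFn {m : ℕ} (hm : 1 ≤ m) (f : L2) :
    opS m f =ᵐ[unif] fun t => ∫ s, covKer m s t * f s ∂unif := by
  have h : opS m f = (memLp_integral (memLp_secondProj hm) f).2.toLp := by
    unfold opS integralOperator
    rw [dif_pos (memLp_secondProj hm)]
    rfl
  rw [h]
  refine (MemLp.coeFn_toLp _).trans ?_
  filter_upwards [ae_unif_mem] with t ht
  refine integral_congr_ae ?_
  filter_upwards [ae_unif_mem] with s hs
  simp only [secondProj_eq hm hs ht]

/-- The operator `S` is the Gram operator of the feature map; in particular it is compact,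
self-adjoint and positive. -/
theorem opS_eq_gram {m : ℕ} (hm : 1 ≤ m) :
    opS m = ((gram unif (feat m) : L2 →L[ℝ] L2) : Module.End ℝ L2) := by
  ext1 f
  refine ext_inner_right ℝ fun h => ?_
  change ⟪opS m f, h⟫ = ⟪gram unif (feat m) f, h⟫
  rw [inner_gram_feat, ← integral_mul_integral_wt m (integrable_coe_L2 h)
    (aestronglyMeasurable_cF (integrable_coe_L2 f)) fun u hu => abs_cF_le (integrable_coe_L2 f) hu,
    L2.inner_def]
  refine integral_congr_ae ?_
  filter_upwards [opS_coeFn hm f] with t ht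
  rw [ht, integral_covKer_mul m (integrable_coe_L2 f)]
  simp

/-! ### Reduction of the eigenproblem to a boundary value problem -/

lemma intervalIntegrable_of_unif {f : ℝ → ℝ} (hf : Integrable f unif) {a b : ℝ}
    (ha : a ∈ Icc (0 : ℝ) 1) (hb : b ∈ Icc (0 : ℝ) 1) : IntervalIntegrable f volume a b := by
  refine (IntegrableOn.mono_set (t := Icc 0 1) hf ?_).intervalIntegrable
  exact uIcc_subset_Icc ha hb

lemma integral_unif_ind_mul {f : ℝ → ℝ} (hf : Integrable f unif) {u : ℝ}
    (hu : u ∈ Icc (0 : ℝ) 1) :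
    ∫ s, ind u s * f s ∂unif = ∫ s, f s ∂unif - ∫ s in (0 : ℝ)..u, f s := by
  have h : (fun s => ind u s * f s) = (Ioi u).indicator f := by
    ext s
    by_cases hs : u < s <;> simp [ind, hs]
  have h' : Ioi u ∩ Icc 0 1 = Ioc u 1 := by
    ext s
    simp only [mem_inter_iff, mem_Ioi, mem_Icc, mem_Ioc]
    exact ⟨fun h => ⟨h.1, h.2.2⟩, fun h => ⟨h.1, hu.1.trans h.1.le, h.2⟩⟩
  rw [h, integral_indicator measurableSet_Ioi, Measure.restrict_restrict measurableSet_Ioi, h',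
    ← intervalIntegral.integral_of_le hu.2, integral_unif, eq_sub_iff_add_eq, add_comm,
    intervalIntegral.integral_add_adjacent_intervals] <;>
  exact intervalIntegrable_of_unif hf (by simp [hu.1, hu.2]) (by simp [hu.1, hu.2])

/-- For a centred function, integration against the centred indicator is minus the primitive. -/
lemma cF_eq {f : ℝ → ℝ} (hf : Integrable f unif) (h0 : ∫ s, f s ∂unif = 0) {u : ℝ}
    (hu : u ∈ Icc (0 : ℝ) 1) : cF f u = -∫ s in (0 : ℝ)..u, f s := by
  have hi : Integrable (fun s => ind u s * f s) unif :=
    hf.bdd_mul (c := 1) (by fun_prop) (Eventually.of_forall fun s => abs_ind_le u s)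
  have := integral_unif_ind_mul hf hu
  unfold cF cind
  simp only [sub_mul (ind _ _)]
  rw [integral_sub hi (hf.const_mul _), integral_const_mul, h0, this, h0]
  ring

lemma integral_secondProj_mul {m : ℕ} (hm : 1 ≤ m) (f : ℝ → ℝ) {t : ℝ}
    (ht : t ∈ Icc (0 : ℝ) 1) :
    ∫ s in (0 : ℝ)..1, secondProj m s t * f s = ∫ s, covKer m s t * f s ∂unif := by
  rw [← integral_unif]
  refine integral_congr_ae ?_
  filter_upwards [ae_unif_mem] with s hs
  rw [secondProj_eq hm hs ht]

/-- For centred `f` with primitive `y`, the function `S f` has derivative `-w y`. -/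
lemma exists_integral_covKer_eq {m : ℕ} {f : ℝ → ℝ} (hf : Integrable f unif)
    (h0 : ∫ s, f s ∂unif = 0) {y : ℝ → ℝ} (hy : Continuous y)
    (hfy : ∀ u ∈ Icc (0 : ℝ) 1, ∫ s in (0 : ℝ)..u, f s = y u) :
    ∃ C : ℝ, ∀ t ∈ Icc (0 : ℝ) 1,
      ∫ s, covKer m s t * f s ∂unif = C - ∫ v in (0 : ℝ)..t, wt m v * y v := by
  refine ⟨∫ u, wt m u * ((1 - u) * y u) ∂unif, fun t ht => ?_⟩
  have hw : Continuous fun u => wt m u * y u := by fun_prop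
  have hi1 : Integrable (fun u => wt m u * ((1 - u) * y u)) unif :=
    Continuous.integrableOn_Icc (by fun_prop)
  have hi2 : Integrable (fun u => wt m u * y u * ind u t) unif :=
    (hw.integrableOn_Icc : Integrable _ unif).mul_bdd (c := 1) (by fun_prop)
      (Eventually.of_forall fun u => abs_ind_le u t)
  rw [integral_covKer_mul m hf, ← integral_mul_ind (φ := fun u => wt m u * y u) ht,
    ← integral_sub hi1 hi2]
  refine integral_congr_ae ?_
  filter_upwards [ae_unif_mem] with u hu
  rw [cF_eq hf h0 hu, hfy u hu]
  unfold cind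
  ring

/-- An integrable function on `[0,1]` with vanishing primitive vanishes almost everywhere. -/
lemma ae_eq_zero_of_primitive_eq_zero {f : ℝ → ℝ} (hf : Integrable f unif)
    (h : ∀ u ∈ Icc (0 : ℝ) 1, ∫ s in (0 : ℝ)..u, f s = 0) : f =ᵐ[unif] 0 := by
  have h1 : ∫ s, f s ∂unif = 0 := by rw [integral_unif]; exact h 1 (by simp)
  have hIoi : ∀ u, ∫ s in Ioi u, f s ∂unif = 0 := by
    intro u
    rcases lt_or_ge u 0 with hu | hu
    · rw [← h1]
      refine setIntegral_eq_integral_of_ae_compl_eq_zero ?_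
      filter_upwards [ae_unif_mem] with s hs hn
      exact absurd (hu.trans_le hs.1) hn
    rcases le_or_gt u 1 with hu1 | hu1
    · have := integral_unif_ind_mul hf ⟨hu, hu1⟩
      rw [h1, h u ⟨hu, hu1⟩, sub_zero] at this
      rw [← this, ← integral_indicator measurableSet_Ioi]
      congr 1
      ext s
      by_cases hs : u < s <;> simp [ind, hs]
    · refine setIntegral_eq_zero_of_ae_eq_zero ?_
      filter_upwards [ae_unif_mem] with s hs hn
      exact absurd (hs.2.trans_lt hu1) (not_lt.2 (le_of_lt hn))
  refine hf.ae_eq_zero_of_forall_setIntegral_eq_zero fun s hs _ => ?_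
  refine MeasurableSpace.induction_on_inter (C := fun s _ => ∫ x in s, f x ∂unif = 0)
    (borel_eq_generateFrom_Ioi ℝ ▸ BorelSpace.measurable_eq) isPiSystem_Ioi (by simp) ?_ ?_ ?_ s hs
  · rintro _ ⟨u, rfl⟩
    exact hIoi u
  · intro t ht h
    have := integral_add_compl ht hf
    rw [h, h1, zero_add] at this
    exact this
  · intro t hd ht h
    rw [integral_iUnion ht hd hf.integrableOn]
    simp [h]

lemma wt_pos (m : ℕ) {u : ℝ} (hu : u < 1) : 0 < wt m u :=
  mul_pos (by positivity) (pow_pos (by linarith) _)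

/-- If a primitive of `w y` is constant then `y` vanishes. This excludes `ν = 0` in both
eigenproblems. -/
lemma eq_zero_of_integral_wt_eq_zero {m : ℕ} {y : ℝ → ℝ} (hy : Continuous y) {C : ℝ}
    (h : ∀ t ∈ Icc (0 : ℝ) 1, C - ∫ v in (0 : ℝ)..t, wt m v * y v = 0) :
    ∀ t ∈ Icc (0 : ℝ) 1, y t = 0 := by
  have hw : Continuous fun u => wt m u * y u := by fun_prop
  have h1 : ∀ t ∈ Ioo (0 : ℝ) 1, y t = 0 := by
    intro t ht
    have hd : HasDerivAt (fun t => C - ∫ v in (0 : ℝ)..t, wt m v * y v) (-(wt m t * y t)) t :=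
      (intervalIntegral.integral_hasDerivAt_right (hw.intervalIntegrable _ _)
        (hw.stronglyMeasurableAtFilter _ _) hw.continuousAt).const_sub C
    have hz : HasDerivAt (fun t => C - ∫ v in (0 : ℝ)..t, wt m v * y v) 0 t := by
      refine (hasDerivAt_const t (0 : ℝ)).congr_of_eventuallyEq ?_
      filter_upwards [Ioo_mem_nhds ht.1 ht.2] with v hv
      exact h v ⟨hv.1.le, hv.2.le⟩
    have := hd.unique hz
    have hp := wt_pos m ht.2
    have h2 : wt m t * y t = 0 := by linarith
    exact (mul_eq_zero.1 h2).resolve_left hp.ne'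
  intro t ht
  have hcl : Icc (0 : ℝ) 1 ⊆ closure (Ioo 0 1) := by rw [closure_Ioo zero_ne_one]
  exact closure_minimal (fun t ht => h1 t ht) (isClosed_singleton.preimage hy) (hcl ht)

/-- A solution of the integral equation agrees with a `C¹` function, and its primitive with a
`C²` function. -/
lemma boundary_of_integral {m : ℕ} (hm : 1 ≤ m) {ν : ℝ} {f : ℝ → ℝ}
    (h : SolvesIntegralEquation m ν f) :
    SolvesBoundaryProblem m ν (fun t => ∫ s in (0 : ℝ)..t, f s) := by
  obtain ⟨hf2, heq, hf0, hf1⟩ := h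
  have hf : Integrable f unif := hf2.integrable one_le_two
  have h0 : ∫ s, f s ∂unif = 0 := by rw [integral_unif]; exact hf0
  -- extended by zero, `f` has a primitive `y` that is continuous on the whole line
  set f' : ℝ → ℝ := (Icc (0 : ℝ) 1).indicator f with hf'
  have hf'i : Integrable f' volume := (integrable_indicator_iff measurableSet_Icc).2 hf
  set y : ℝ → ℝ := fun t => ∫ s in (0 : ℝ)..t, f' s with hy
  have hyc : Continuous y :=
    intervalIntegral.continuous_primitive (fun _ _ => hf'i.intervalIntegrable) 0
  have hfy : ∀ u ∈ Icc (0 : ℝ) 1, ∫ s in (0 : ℝ)..u, f s = y u := by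
    intro u hu
    refine intervalIntegral.integral_congr fun s hs => ?_
    rw [uIcc_of_le hu.1] at hs
    have : s ∈ Icc (0 : ℝ) 1 := ⟨hs.1, hs.2.trans hu.2⟩
    simp [hf', this]
  obtain ⟨C, hC⟩ := exists_integral_covKer_eq (m := m) hf h0 hyc hfy
  set G : ℝ → ℝ := fun t => C - ∫ v in (0 : ℝ)..t, wt m v * y v with hG
  have hw : Continuous fun u => wt m u * y u := by fun_prop
  have hGd : ∀ t, HasDerivAt G (-(wt m t * y t)) t := fun t =>
    (intervalIntegral.integral_hasDerivAt_right (hw.intervalIntegrable _ _)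
      (hw.stronglyMeasurableAtFilter _ _) hw.continuousAt).const_sub C
  have hGc : Continuous G := continuous_iff_continuousAt.2 fun t => (hGd t).continuousAt
  have hfG : ∀ᵐ t ∂unif, ν * f t = G t := by
    filter_upwards [heq, ae_unif_mem] with t ht htm
    rw [ht, integral_secondProj_mul hm f htm, hC t htm]
  have hν : ν ≠ 0 := by
    rintro rfl
    have hGz : ∀ t ∈ Icc (0 : ℝ) 1, G t = 0 := by
      refine Measure.eqOn_Icc_of_ae_eq volume zero_ne_one ?_ hGc.continuousOn
        (continuousOn_const (c := (0 : ℝ)))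
      filter_upwards [hfG] with t ht
      rw [← ht, zero_mul]
    have hyz := eq_zero_of_integral_wt_eq_zero hyc hGz
    have hfz := ae_eq_zero_of_primitive_eq_zero hf fun u hu => (hfy u hu).trans (hyz u hu)
    rw [← integral_unif, integral_congr_ae (g := fun _ => 0)
      (hfz.mono fun t ht => by simp [ht])] at hf1
    simp at hf1
  -- `G / ν` is a `C¹` version of `f`, and its primitive `Y` agrees with that of `f` on `[0,1]`
  set Y : ℝ → ℝ := fun t => ∫ s in (0 : ℝ)..t, G s / ν with hY
  have hGν : Continuous fun t => G t / ν := hGc.div_const _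
  have hYd : ∀ t, HasDerivAt Y (G t / ν) t := fun t =>
    intervalIntegral.integral_hasDerivAt_right (hGν.intervalIntegrable _ _)
      (hGν.stronglyMeasurableAtFilter _ _) hGν.continuousAt
  have hdY : deriv Y = fun t => G t / ν := funext fun t => (hYd t).deriv
  have hdG : deriv G = fun t => -(wt m t * y t) := funext fun t => (hGd t).deriv
  have hddY : deriv (deriv Y) = fun t => -(wt m t * y t) / ν := by
    rw [hdY]
    exact funext fun t => ((hGd t).div_const ν).deriv
  have hG1 : ContDiff ℝ 1 (fun t => G t / ν) := by
    refine ContDiff.div_const (contDiff_one_iff_deriv.2 ⟨fun t => (hGd t).differentiableAt, ?_⟩) ν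
    rw [hdG]
    exact hw.neg
  have hY2 : ContDiff ℝ 2 Y := by
    have : (2 : WithTop ℕ∞) = 1 + 1 := by norm_num
    rw [this, contDiff_succ_iff_deriv]
    exact ⟨fun t => (hYd t).differentiableAt, by simp, hdY ▸ hG1⟩
  have hfG' : ∀ᵐ t ∂unif, f t = G t / ν := by
    filter_upwards [hfG] with t ht
    rw [← ht, mul_div_cancel_left₀ _ hν]
  have hEq : EqOn (fun t => ∫ s in (0 : ℝ)..t, f s) Y (Icc 0 1) := by
    intro u hu
    refine intervalIntegral.integral_congr_ae ?_
    have := (ae_restrict_iff' measurableSet_Icc).1 hfG'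
    filter_upwards [this] with s hs hsu
    rw [uIoc_of_le hu.1] at hsu
    exact hs ⟨hsu.1.le, hsu.2.trans hu.2⟩
  have hU := uniqueDiffOn_Icc (zero_lt_one (α := ℝ))
  refine ⟨hY2.contDiffOn.congr hEq, fun t ht => ?_, by simp, hf0, ?_⟩
  · rw [iteratedDerivWithin_congr hEq ht,
      iteratedDerivWithin_eq_iteratedDeriv hU hY2.contDiffAt ht, iteratedDeriv_succ,
      iteratedDeriv_one, hddY]
    simp only [hfy t ht]
    unfold wt
    field_simp
  · refine Eq.trans ?_ hf1
    rw [← integral_unif, ← integral_unif]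
    refine integral_congr_ae ?_
    filter_upwards [hfG', ae_unif_mem] with t ht htm
    rw [derivWithin_congr hEq (hEq htm),
      (hYd t).differentiableAt.derivWithin (hU t htm), hdY, ht]

/-- The range of the integral operator consists of centred functions. -/
lemma integral_integral_covKer_mul (m : ℕ) {f : ℝ → ℝ} (hf : Integrable f unif) :
    ∫ t, ∫ s, covKer m s t * f s ∂unif ∂unif = 0 := by
  have h := integral_mul_integral_wt m (h := fun _ => 1) (integrable_const _)
    (aestronglyMeasurable_cF hf) fun u hu => abs_cF_le hf hu
  simp only [one_mul] at h
  simp only [integral_covKer_mul m hf]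
  rw [h]
  have hz : ∀ᵐ u ∂unif, wt m u * (cF (fun _ => 1) u * cF f u) = 0 := by
    filter_upwards [ae_unif_mem] with u hu
    have : cF (fun _ => 1) u = 0 := by simpa [cF] using integral_cind hu
    rw [this]
    ring
  rw [integral_congr_ae hz]
  simp

/-- For a solution `y` of the boundary value problem, `ν y'` and `S y'` have the same derivative
`-w y`, and both are centred, so they agree. -/
lemma integral_of_boundary {m : ℕ} (hm : 1 ≤ m) {ν : ℝ} {y : ℝ → ℝ}
    (h : SolvesBoundaryProblem m ν y) :
    SolvesIntegralEquation m ν (derivWithin y (Icc 0 1)) ∧ ν ≠ 0 := by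
  obtain ⟨hy2, hode, hy0, hy1, hnorm⟩ := h
  have hU := uniqueDiffOn_Icc (zero_lt_one (α := ℝ))
  set z := derivWithin y (Icc 0 1) with hz
  have hz1 : ContDiffOn ℝ 1 z (Icc 0 1) := hy2.derivWithin hU (by norm_num)
  have hzc : ContinuousOn z (Icc 0 1) := hz1.continuousOn
  have hzi : Integrable z unif := hzc.integrableOn_Icc
  have hyc : ContinuousOn y (Icc 0 1) := hy2.continuousOn
  have hd : ∀ (g : ℝ → ℝ), ContDiffOn ℝ 1 g (Icc 0 1) → ∀ t ∈ Icc (0 : ℝ) 1,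
      ∫ s in (0 : ℝ)..t, derivWithin g (Icc 0 1) s = g t - g 0 := by
    intro g hg t ht
    have hsub : Icc 0 t ⊆ Icc (0 : ℝ) 1 := Icc_subset_Icc_right ht.2
    refine intervalIntegral.integral_eq_sub_of_hasDerivAt_of_le ht.1
      (hg.continuousOn.mono hsub) (fun s hs => ?_) ?_
    · have hs' : s ∈ Icc (0 : ℝ) 1 := ⟨hs.1.le, hs.2.le.trans ht.2⟩
      exact ((hg.differentiableOn one_ne_zero s hs').hasDerivWithinAt).hasDerivAt
        (Icc_mem_nhds hs.1 (hs.2.trans_le ht.2))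
    · refine ContinuousOn.intervalIntegrable ?_
      rw [uIcc_of_le ht.1]
      exact (hg.continuousOn_derivWithin hU le_rfl).mono hsub
  have hfy : ∀ u ∈ Icc (0 : ℝ) 1, ∫ s in (0 : ℝ)..u, z s = y u := by
    intro u hu
    rw [hd y (hy2.of_le (by norm_num)) u hu, hy0, sub_zero]
  -- a globally continuous extension of `y`
  set Y : ℝ → ℝ := fun t => y (projIcc 0 1 zero_le_one t) with hY
  have hYc : Continuous Y :=
    hyc.comp_continuous (continuous_subtype_val.comp continuous_projIcc) fun t =>
      (projIcc (0 : ℝ) 1 zero_le_one t).2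
  have hYy : ∀ u ∈ Icc (0 : ℝ) 1, Y u = y u := by
    intro u hu
    simp [hY, projIcc_of_mem zero_le_one hu]
  have h0 : ∫ s, z s ∂unif = 0 := by rw [integral_unif, hfy 1 (by simp), hy1]
  obtain ⟨C, hC⟩ := exists_integral_covKer_eq (m := m) hzi h0 hYc
    fun u hu => (hfy u hu).trans (hYy u hu).symm
  have hνz : ∀ t ∈ Icc (0 : ℝ) 1,
      ν * z t = ν * z 0 - ∫ v in (0 : ℝ)..t, wt m v * Y v := by
    intro t ht
    have h1 := hd z hz1 t ht
    have h2 : ν * ∫ s in (0 : ℝ)..t, derivWithin z (Icc 0 1) s =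
        -∫ v in (0 : ℝ)..t, wt m v * Y v := by
      rw [← intervalIntegral.integral_const_mul, ← intervalIntegral.integral_neg]
      refine intervalIntegral.integral_congr fun s hs => ?_
      rw [uIcc_of_le ht.1] at hs
      have hs' : s ∈ Icc (0 : ℝ) 1 := ⟨hs.1, hs.2.trans ht.2⟩
      have := hode s hs'
      rw [iteratedDerivWithin_succ, iteratedDerivWithin_one] at this
      rw [hYy s hs', this]
      unfold wt
      ring
    rw [h1] at h2
    linarith
  have hdiff : ∀ t ∈ Icc (0 : ℝ) 1,
      ν * z t - ∫ s, covKer m s t * z s ∂unif = ν * z 0 - C := by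
    intro t ht
    rw [hC t ht, hνz t ht]
    ring
  have hSi : Integrable (fun t => ∫ s, covKer m s t * z s ∂unif) unif := by
    have hw : Continuous fun u => wt m u * Y u := by fun_prop
    have : Continuous fun t => C - ∫ v in (0 : ℝ)..t, wt m v * Y v :=
      continuous_const.sub (intervalIntegral.continuous_primitive
        (fun _ _ => hw.intervalIntegrable _ _) 0)
    refine Integrable.congr (this.integrableOn_Icc : Integrable _ unif) ?_
    filter_upwards [ae_unif_mem] with t ht
    rw [hC t ht]
  have hD : ν * z 0 - C = 0 := by
    have h1 : ∫ t, (ν * z t - ∫ s, covKer m s t * z s ∂unif) ∂unif = ν * z 0 - C := by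
      rw [integral_congr_ae (g := fun _ => ν * z 0 - C)
        (ae_unif_mem.mono fun t ht => hdiff t ht)]
      simp
    rw [integral_sub (hzi.const_mul _) hSi, integral_const_mul, h0,
      integral_integral_covKer_mul m hzi] at h1
    linarith
  refine ⟨⟨?_, ?_, ?_, hnorm⟩, ?_⟩
  · obtain ⟨B, hB⟩ := isCompact_Icc.exists_bound_of_continuousOn hzc
    exact MemLp.of_bound hzi.1 B (ae_unif_mem.mono hB)
  · filter_upwards [ae_unif_mem] with t ht
    rw [integral_secondProj_mul hm z ht]
    linarith [hdiff t ht]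
  · rw [← integral_unif, h0]
  · rintro rfl
    have hYz := eq_zero_of_integral_wt_eq_zero (m := m) hYc (C := 0) fun t ht => by
      have := hνz t ht
      linarith
    have hzz := ae_eq_zero_of_primitive_eq_zero hzi fun u hu =>
      (hfy u hu).trans ((hYy u hu).symm.trans (hYz u hu))
    rw [← integral_unif, integral_congr_ae (g := fun _ => 0)
      (hzz.mono fun t ht => by simp [ht])] at hnorm
    simp at hnorm

/-- An eigenvector for a nonzero eigenvalue is centred, so after normalisation it satisfies all the
constraints of the integral equation. -/
theorem hasEigenvalue_iff {m : ℕ} (hm : 1 ≤ m) (ν : ℝ) :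
    ((opS m).HasEigenvalue ν ∧ ν ≠ 0) ↔ ∃ y : ℝ → ℝ, SolvesBoundaryProblem m ν y := by
  constructor
  · rintro ⟨hev, hν⟩
    obtain ⟨f, hf⟩ := hev.exists_hasEigenvector
    have hfi := integrable_coe_L2 f
    have heq : ∀ᵐ t ∂unif, ν * f t = ∫ s, covKer m s t * f s ∂unif := by
      have h1 : opS m f = ν • f := hf.apply_eq_smul
      filter_upwards [opS_coeFn hm f, Lp.coeFn_smul ν f] with t e1 e2
      rw [← e1, h1, e2]
      rfl
    have h0 : ∫ s, f s ∂unif = 0 := by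
      have h2 := integral_integral_covKer_mul m hfi
      rw [← integral_congr_ae heq, integral_const_mul] at h2
      exact (mul_eq_zero.1 h2).resolve_left hν
    have hn : ‖f‖ ≠ 0 := norm_ne_zero_iff.2 hf.2
    have hsq : ∫ t, f t ^ 2 ∂unif = ‖f‖ ^ 2 := by
      rw [← real_inner_self_eq_norm_sq, L2.inner_def]
      simp [sq]
    refine ⟨_, boundary_of_integral hm (f := fun t => ‖f‖⁻¹ * f t) ⟨?_, ?_, ?_, ?_⟩⟩
    · exact (Lp.memLp f).const_mul _
    · filter_upwards [heq, ae_unif_mem] with t e1 ht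
      rw [integral_secondProj_mul hm _ ht, mul_left_comm, e1, ← integral_const_mul]
      congr 1
      ext s
      ring
    · rw [← integral_unif, integral_const_mul, h0, mul_zero]
    · rw [← integral_unif]
      simp only [mul_pow]
      rw [integral_const_mul, hsq]
      field_simp
  · rintro ⟨y, hy⟩
    obtain ⟨⟨hz2, heq, -, hnorm⟩, hν⟩ := integral_of_boundary hm hy
    refine ⟨?_, hν⟩
    set z := derivWithin y (Icc 0 1) with hz
    refine Module.End.hasEigenvalue_of_hasEigenvector (x := hz2.toLp) ⟨?_, ?_⟩
    · rw [Module.End.mem_eigenspace_iff]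
      ext1
      filter_upwards [opS_coeFn hm hz2.toLp, Lp.coeFn_smul ν hz2.toLp, hz2.coeFn_toLp, heq,
        ae_unif_mem] with t e1 e2 e3 e4 ht
      rw [e1, e2, Pi.smul_apply, e3, smul_eq_mul, e4, integral_secondProj_mul hm z ht]
      refine integral_congr_ae ?_
      filter_upwards [hz2.coeFn_toLp] with s hs
      rw [hs]
    · intro h
      have : z =ᵐ[unif] 0 := hz2.coeFn_toLp.symm.trans (Lp.eq_zero_iff_ae_eq_zero.1 h)
      rw [← integral_unif, integral_congr_ae (g := fun _ => 0)
        (this.mono fun t ht => by simp [ht])] at hnorm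
      simp at hnorm

/-! ### The statistic as a functional of the empirical distribution -/

section Counting

open Classical in
/-- A sum over increasing maps `Fin d → Fin n` is a sum over `d`-element subsets. -/
lemma sum_strictMono_eq {d n : ℕ} (F : (Fin d → Fin n) → ℝ) (G : Finset (Fin n) → ℝ)
    (h : ∀ i, StrictMono i → F i = G (Finset.univ.image i)) :
    ∑ i ∈ (Finset.univ : Finset (Fin d → Fin n)).filter StrictMono, F i =
      ∑ T ∈ Finset.univ.powersetCard d, G T := by
  refine Finset.sum_bij (fun i _ => Finset.univ.image i) ?_ ?_ ?_ ?_
  · intro i hi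
    rw [Finset.mem_powersetCard_univ, Finset.card_image_of_injective _
      (Finset.mem_filter.1 hi).2.injective]
    simp
  · intro i hi j hj hij
    have hi' := (Finset.mem_filter.1 hi).2
    have hj' := (Finset.mem_filter.1 hj).2
    have hc : (Finset.univ.image i).card = d := by
      rw [Finset.card_image_of_injective _ hi'.injective]; simp
    exact (Finset.orderEmbOfFin_unique hc
        (fun x => Finset.mem_image_of_mem _ (Finset.mem_univ x)) hi').trans
      (Finset.orderEmbOfFin_unique hc (f := j) (fun x => by
        rw [hij]; exact Finset.mem_image_of_mem _ (Finset.mem_univ x)) hj').symm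
  · intro T hT
    have hc := Finset.mem_powersetCard_univ.1 hT
    refine ⟨T.orderEmbOfFin hc, ?_, ?_⟩
    · simp [OrderEmbedding.strictMono]
    · apply Finset.coe_injective
      simp
  · intro i hi
    exact h i (Finset.mem_filter.1 hi).2

/-- The number of sample points exceeding `u`. -/
noncomputable def cnt {n : ℕ} (u : ℝ) (x : Fin n → ℝ) : ℕ :=
  (Finset.univ.filter fun k => u < x k).card

/-- A product of exceedance indicators over `T` counts the sets `T` of points exceeding `u`. -/
lemma sum_prod_ind {n : ℕ} (d : ℕ) (u : ℝ) (x : Fin n → ℝ) :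
    ∑ T ∈ Finset.univ.powersetCard d, ∏ t ∈ T, ind u (x t) = ((cnt u x).choose d : ℝ) := by
  have hsub : (Finset.univ.filter fun k => u < x k).powersetCard d ⊆ Finset.univ.powersetCard d :=
    Finset.powersetCard_mono (Finset.subset_univ _)
  rw [← Finset.sum_subset hsub fun T hT hT' => ?_,
    Finset.sum_congr rfl (g := fun _ => (1 : ℝ)) fun T hT => ?_]
  · simp [cnt]
  · rw [prod_ind, if_pos]
    exact fun t ht => (Finset.mem_filter.1 ((Finset.mem_powersetCard.1 hT).1 ht)).2
  · rw [prod_ind, if_neg]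
    exact fun h => hT' (Finset.mem_powersetCard.2
      ⟨fun t ht => Finset.mem_filter.2 ⟨Finset.mem_univ t, h t ht⟩,
        (Finset.mem_powersetCard.1 hT).2⟩)

/-- Double counting: every `m`-element set arises from `n - m` pairs of an `(m + 1)`-element set and
one of its points by removing the point. -/
lemma sum_sum_prod_erase {n : ℕ} (m : ℕ) (f : Fin n → ℝ) (hmn : m ≤ n) :
    ∑ T ∈ Finset.univ.powersetCard (m + 1), ∑ a ∈ T, ∏ t ∈ T.erase a, f t =
      ((n : ℝ) - m) * ∑ T ∈ Finset.univ.powersetCard m, ∏ t ∈ T, f t := by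
  have h : ∑ T ∈ Finset.univ.powersetCard (m + 1), ∑ a ∈ T, ∏ t ∈ T.erase a, f t =
      ∑ T ∈ Finset.univ.powersetCard m, ∑ _a ∈ Tᶜ, ∏ t ∈ T, f t := by
    rw [Finset.sum_sigma', Finset.sum_sigma']
    refine Finset.sum_bij' (fun p _ => ⟨p.1.erase p.2, p.2⟩) (fun p _ => ⟨insert p.2 p.1, p.2⟩)
      ?_ ?_ ?_ ?_ ?_
    · rintro ⟨T, a⟩ hp
      simp only [Finset.mem_sigma, Finset.mem_powersetCard_univ] at hp
      simp [Finset.mem_sigma, Finset.card_erase_of_mem hp.2, hp.1]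
    · rintro ⟨T, a⟩ hp
      simp only [Finset.mem_sigma, Finset.mem_powersetCard_univ, Finset.mem_compl] at hp
      simp [Finset.mem_sigma, Finset.card_insert_of_notMem hp.2, hp.1]
    · rintro ⟨T, a⟩ hp
      simp only [Finset.mem_sigma] at hp
      simp [Finset.insert_erase hp.2]
    · rintro ⟨T, a⟩ hp
      simp only [Finset.mem_sigma, Finset.mem_compl] at hp
      simp [Finset.erase_insert hp.2]
    · rintro ⟨T, a⟩ _
      rfl
  rw [h, Finset.mul_sum]
  refine Finset.sum_congr rfl fun T hT => ?_
  rw [Finset.sum_const, Finset.card_compl, Finset.mem_powersetCard_univ.1 hT, nsmul_eq_mul,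
    Fintype.card_fin, Nat.cast_sub hmn]

open Classical in
lemma sum_mulForm {m n : ℕ} (hmn : m ≤ n) (u : ℝ) (x : Fin n → ℝ) :
    ∑ i ∈ (Finset.univ : Finset (Fin (m + 1) → Fin n)).filter StrictMono,
      mulForm (1 - u) (fun j => ind u (x (i j))) =
    (1 - u) * (((n : ℝ) - m) * ((cnt u x).choose m : ℝ)) - m * ((cnt u x).choose (m + 1) : ℝ) := by
  rw [sum_strictMono_eq _ fun T => (1 - u) * ∑ a ∈ T, ∏ t ∈ T.erase a, ind u (x t)
    - m * ∏ t ∈ T, ind u (x t)]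
  · rw [Finset.sum_sub_distrib, ← Finset.mul_sum, ← Finset.mul_sum, sum_sum_prod_erase m _ hmn,
      sum_prod_ind, sum_prod_ind]
  · intro i hi
    rw [mulForm, Finset.sum_image hi.injective.injOn, Finset.prod_image hi.injective.injOn]
    congr 2
    refine Finset.sum_congr rfl fun a _ => ?_
    rw [← Finset.image_erase hi.injective, Finset.prod_image hi.injective.injOn]

/-- The normalised integrand of the statistic, as a function of the number `N` of sample points
exceeding the threshold `1 - q`. -/
noncomputable def stInt (m n N : ℕ) (q : ℝ) : ℝ :=
  q ^ (m + 1) - ((m + 1) * q * ((N.choose m : ℝ) / n.choose m)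
    - m * ((N.choose (m + 1) : ℝ) / n.choose (m + 1)))

lemma measurable_cnt {α : Type*} [MeasurableSpace α] {n : ℕ} {f : α → ℝ} {x : α → Fin n → ℝ}
    (hf : Measurable f) (hx : Measurable x) : Measurable fun a => cnt (f a) (x a) := by
  unfold cnt
  simp only [Finset.card_filter]
  refine Finset.measurable_sum _ fun k _ => ?_
  exact Measurable.ite (measurableSet_lt hf (by fun_prop)) measurable_const measurable_const

lemma measurable_stInt_cnt {α : Type*} [MeasurableSpace α] (m : ℕ) {n : ℕ} {f : α → ℝ}
    {x : α → Fin n → ℝ} (hf : Measurable f) (hx : Measurable x) :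
    Measurable fun a => stInt m n (cnt (f a) (x a)) (1 - f a) := by
  have h : ∀ k : ℕ, Measurable fun a => (((cnt (f a) (x a)).choose k : ℕ) : ℝ) := fun k =>
    (measurable_from_nat (f := fun N : ℕ => ((N.choose k : ℕ) : ℝ))).comp (measurable_cnt hf hx)
  have h1 := h m
  have h2 := h (m + 1)
  unfold stInt
  fun_prop

/-- The statistic depends on the sample only through the numbers of points exceeding the
thresholds `u`. -/
lemma statT_eq {m n : ℕ} (hm : 1 ≤ m) (hn : m + 1 ≤ n) {x : Fin n → ℝ}
    (hx : ∀ k, x k ∈ Icc (0 : ℝ) 1) :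
    statT m n x = 2 / ((m : ℝ) + 1) * ∫ u, stInt m n (cnt u x) (1 - u) ∂unif := by
  classical
  have hc : ((n.choose (m + 1) : ℕ) : ℝ) ≠ 0 := by
    exact_mod_cast (Nat.choose_pos hn).ne'
  have hc' : ((n.choose m : ℕ) : ℝ) ≠ 0 := by
    exact_mod_cast (Nat.choose_pos (by omega : m ≤ n)).ne'
  have hm1 : (m : ℝ) + 1 ≠ 0 := by positivity
  have hm2 : (m : ℝ) + 2 ≠ 0 := by positivity
  have hrel : ((n.choose (m + 1) : ℕ) : ℝ) * ((m : ℝ) + 1) = n.choose m * ((n : ℝ) - m) := by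
    have := Nat.choose_succ_right_eq n m
    rw [← Nat.cast_sub (by omega : m ≤ n)]
    exact_mod_cast this
  have hcard : ((Finset.univ : Finset (Fin (m + 1) → Fin n)).filter StrictMono).card =
      n.choose (m + 1) := by
    have := sum_strictMono_eq (d := m + 1) (n := n) (fun _ => 1) (fun _ => 1) fun _ _ => rfl
    simp only [Finset.sum_const, Finset.card_powersetCard, Finset.card_univ, Fintype.card_fin,
      nsmul_eq_mul, mul_one] at this
    exact_mod_cast this
  have hi : ∀ i : Fin (m + 1) → Fin n,
      Integrable (fun u => mulForm (1 - u) (fun j => ind u (x (i j)))) unif := fun i =>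
    integrable_unif_of_bound (by fun_prop) (2 * m + 1) fun u hu => abs_mulForm_ind_le hu _
  have hpow : Integrable (fun u : ℝ => (1 - u) ^ (m + 1)) unif :=
    Continuous.integrableOn_Icc (by fun_prop)
  unfold statT
  rw [Finset.sum_congr rfl fun i _ => kernelPhi_eq hm (x := fun j => x (i j)) fun j => hx _,
    Finset.sum_sub_distrib, Finset.sum_const, ← Finset.mul_sum,
    ← integral_finsetSum _ fun i _ => hi i]
  have hst : ∀ u, stInt m n (cnt u x) (1 - u) = (1 - u) ^ (m + 1) - (1 / (n.choose (m + 1) : ℝ)) *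
      ∑ i ∈ (Finset.univ : Finset (Fin (m + 1) → Fin n)).filter StrictMono,
        mulForm (1 - u) (fun j => ind u (x (i j))) := by
    intro u
    rw [sum_mulForm (by omega : m ≤ n), stInt]
    congr 1
    field_simp
    linear_combination ((1 - u) * ((cnt u x).choose m : ℝ)) * hrel
  simp only [hst]
  rw [integral_sub hpow ((integrable_finsetSum _ fun i _ => hi i).const_mul _),
    integral_const_mul, integral_unif_pow, hcard, nsmul_eq_mul]
  push_cast
  have : (m : ℝ) + 1 + 1 ≠ 0 := by positivity
  field_simp
  ring

end Counting

/-! ### Expansion of the integrand around the mean -/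

section Expansion

/-- Second order expansion of the ratio of binomial coefficients. In the step from `k` to `k + 1`
the ratio is multiplied by `(N - k) / (n - k) = p - (k / n + O(n⁻²)) (1 - p)` with `p = N / n`. -/
lemma abs_choose_ratio_le (k : ℕ) : ∃ C : ℝ, 0 ≤ C ∧ ∀ n N : ℕ, 1 ≤ n → 2 * k ≤ n → N ≤ n →
    |(N.choose k : ℝ) / n.choose k - (((N : ℝ) / n) ^ k
      - k.choose 2 * ((N : ℝ) / n) ^ (k - 1) * (1 - (N : ℝ) / n) / n)| ≤ C / (n : ℝ) ^ 2 := by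
  induction k with
  | zero => exact ⟨0, le_rfl, fun n N _ _ _ => by simp⟩
  | succ k ih =>
    obtain ⟨C, hC0, hC⟩ := ih
    refine ⟨C + 2 * k ^ 2 + 2 * k * k.choose 2, by positivity, fun n N hn hkn hN => ?_⟩
    have hn0 : (0 : ℝ) < n := by exact_mod_cast hn
    have hkn' : 2 * (k : ℝ) + 2 ≤ n := by exact_mod_cast (by omega : 2 * k + 2 ≤ n)
    have hk0 : (0 : ℝ) ≤ k := k.cast_nonneg
    have hnk : (0 : ℝ) < n - k := by linarith
    have hN' : (N : ℝ) ≤ n := by exact_mod_cast hN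
    have hNnn : (0 : ℝ) ≤ N := N.cast_nonneg
    set p : ℝ := (N : ℝ) / n with hp
    have hp0 : 0 ≤ p := by positivity
    have hp1 : p ≤ 1 := (div_le_one hn0).2 hN'
    set r : ℝ := ((N : ℝ) - k) / (n - k) with hr
    set δ : ℝ := k ^ 2 / (n * (n - k)) with hδ
    have hrp : r = p - (k / n + δ) * (1 - p) := by
      rw [hr, hδ, hp]
      field_simp
      ring
    have hrabs : |r| ≤ 1 := by
      rw [hr, abs_div, abs_of_pos hnk, div_le_one hnk, abs_le]
      constructor <;> linarith
    have hcn : ((n.choose k : ℕ) : ℝ) ≠ 0 := by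
      exact_mod_cast (Nat.choose_pos (by omega : k ≤ n)).ne'
    have hcn1 : ((n.choose (k + 1) : ℕ) : ℝ) ≠ 0 := by
      exact_mod_cast (Nat.choose_pos (by omega : k + 1 ≤ n)).ne'
    have hrel : ∀ M : ℕ, ((M.choose (k + 1) : ℕ) : ℝ) * ((k : ℝ) + 1) =
        M.choose k * ((M : ℝ) - k) := by
      intro M
      rcases le_or_gt k M with h | h
      · rw [← Nat.cast_sub h]
        exact_mod_cast Nat.choose_succ_right_eq M k
      · rw [Nat.choose_eq_zero_of_lt h, Nat.choose_eq_zero_of_lt (by omega)]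
        simp
    have hb : (N.choose (k + 1) : ℝ) / n.choose (k + 1) = (N.choose k : ℝ) / n.choose k * r := by
      rw [hr, div_mul_div_comm, div_eq_div_iff hcn1 (mul_ne_zero hcn hnk.ne')]
      have h1 := hrel N
      have h2 := hrel n
      have hk1 : (k : ℝ) + 1 ≠ 0 := by positivity
      refine mul_right_cancel₀ hk1 ?_
      calc _ = (N.choose (k + 1) * ((k : ℝ) + 1)) * (n.choose k * ((n : ℝ) - k)) := by ring
        _ = (N.choose k * ((N : ℝ) - k)) * (n.choose (k + 1) * ((k : ℝ) + 1)) := by rw [h1, h2]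
        _ = _ := by ring
    have hc2 : (((k + 1).choose 2 : ℕ) : ℝ) = k.choose 2 + k := by
      rw [Nat.choose_succ_succ' k 1]
      push_cast
      rw [Nat.choose_one_right]
      ring
    have hpk : (k.choose 2 : ℝ) * p ^ (k - 1) * p = k.choose 2 * p ^ k := by
      rcases k with _ | k
      · simp
      · rw [Nat.add_sub_cancel, pow_succ]; ring
    have hδ0 : 0 ≤ δ := by positivity
    have hδ1 : δ ≤ 2 * k ^ 2 / (n : ℝ) ^ 2 := by
      rw [hδ, div_le_div_iff₀ (by positivity) (by positivity)]
      have : (n : ℝ) ≤ 2 * (n - k) := by linarith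
      nlinarith [mul_nonneg (mul_nonneg (sq_nonneg (k : ℝ)) hn0.le) (sub_nonneg.2 this)]
    have hkδ : k / n + δ ≤ 2 * k / n := by
      have : k / n + δ = k / (n - k) := by
        rw [hδ]; field_simp; ring
      rw [this, div_le_div_iff₀ hnk hn0]
      nlinarith
    rw [hb, hc2, Nat.add_sub_cancel]
    set b : ℝ := (N.choose k : ℝ) / n.choose k with hbdef
    set c : ℝ := (k.choose 2 : ℝ) with hcdef
    have hc0 : 0 ≤ c := Nat.cast_nonneg _
    set t : ℝ := p ^ k - c * p ^ (k - 1) * (1 - p) / n with ht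
    have hid : b * r - (p ^ (k + 1) - (c + k) * p ^ k * (1 - p) / n) =
        (b - t) * r - δ * (p ^ k * (1 - p))
          + (c / n * (k / n + δ)) * (p ^ (k - 1) * (1 - p) ^ 2) := by
      have h1 : t * r = p ^ (k + 1) - (c * p ^ (k - 1) * p) * (1 - p) / n
          - k / n * (p ^ k * (1 - p)) - δ * (p ^ k * (1 - p))
          + (c / n * (k / n + δ)) * (p ^ (k - 1) * (1 - p) ^ 2) := by
        rw [ht, hrp]; ring
      rw [hpk] at h1
      linear_combination h1
    rw [hid]
    have e1 : |(b - t) * r| ≤ C / (n : ℝ) ^ 2 := by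
      rw [abs_mul]
      calc _ ≤ C / (n : ℝ) ^ 2 * 1 := mul_le_mul (hC n N hn (by omega) hN) hrabs (abs_nonneg _)
            (by positivity)
        _ = _ := mul_one _
    have h1p : 0 ≤ 1 - p := by linarith
    have e2 : |δ * (p ^ k * (1 - p))| ≤ 2 * k ^ 2 / (n : ℝ) ^ 2 := by
      rw [abs_of_nonneg (by positivity)]
      refine (mul_le_of_le_one_right hδ0 ?_).trans hδ1
      exact mul_le_one₀ (pow_le_one₀ hp0 hp1) h1p (by linarith)
    have e3 : |(c / n * (k / n + δ)) * (p ^ (k - 1) * (1 - p) ^ 2)| ≤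
        2 * k * c / (n : ℝ) ^ 2 := by
      rw [abs_of_nonneg (by positivity)]
      have : c / n * (k / n + δ) ≤ c / n * (2 * k / n) :=
        mul_le_mul_of_nonneg_left hkδ (by positivity)
      refine (mul_le_of_le_one_right (by positivity) ?_).trans (this.trans (le_of_eq ?_))
      · exact mul_le_one₀ (pow_le_one₀ hp0 hp1) (by positivity) (pow_le_one₀ h1p (by linarith))
      · field_simp
    refine (abs_add_le _ _).trans ((add_le_add_left (abs_sub _ _) _).trans ?_)
    rw [add_div, add_div]
    linarith

lemma abs_pow_sub_pow_le' {p q : ℝ} (hp : p ∈ Icc (0 : ℝ) 1) (hq : q ∈ Icc (0 : ℝ) 1) (k : ℕ) :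
    |p ^ k - q ^ k| ≤ k * |p - q| := by
  induction k with
  | zero => simp
  | succ k ih =>
    have h : p ^ (k + 1) - q ^ (k + 1) = (p ^ k - q ^ k) * p + q ^ k * (p - q) := by ring
    rw [h]
    refine (abs_add_le _ _).trans ?_
    rw [abs_mul, abs_mul, abs_of_nonneg hp.1, abs_of_nonneg (pow_nonneg hq.1 k)]
    have h1 : |p ^ k - q ^ k| * p ≤ k * |p - q| :=
      (mul_le_of_le_one_right (abs_nonneg _) hp.2).trans ih
    have h2 : q ^ k * |p - q| ≤ |p - q| :=
      mul_le_of_le_one_left (abs_nonneg _) (pow_le_one₀ hq.1 hq.2)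
    push_cast
    linarith

/-- The Taylor expansion of `q^(k+2) - (k+2) q p^(k+1) + (k+1) p^(k+2)` around `p = q` starts with
a quadratic term. -/
lemma abs_quadratic_le {p q : ℝ} (hp : p ∈ Icc (0 : ℝ) 1) (hq : q ∈ Icc (0 : ℝ) 1) (k : ℕ) :
    |q ^ (k + 2) - (k + 2) * q * p ^ (k + 1) + (k + 1) * p ^ (k + 2)
      - (k + 1) * (k + 2) / 2 * q ^ k * (p - q) ^ 2| ≤ (k * (k + 2) ^ 2) * |p - q| ^ 3 := by
  induction k with
  | zero =>
    have : q ^ (0 + 2) - ((0 : ℕ) + 2) * q * p ^ (0 + 1) + ((0 : ℕ) + 1) * p ^ (0 + 2)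
      - ((0 : ℕ) + 1) * ((0 : ℕ) + 2) / 2 * q ^ 0 * (p - q) ^ 2 = 0 := by push_cast; ring
    rw [this]
    simp
  | succ k ih =>
    set E := q ^ (k + 2) - (k + 2) * q * p ^ (k + 1) + (k + 1) * p ^ (k + 2)
      - (k + 1) * (k + 2) / 2 * q ^ k * (p - q) ^ 2 with hE
    have h : q ^ (k + 1 + 2) - ((k + 1 : ℕ) + 2) * q * p ^ (k + 1 + 1)
        + ((k + 1 : ℕ) + 1) * p ^ (k + 1 + 2)
        - ((k + 1 : ℕ) + 1) * ((k + 1 : ℕ) + 2) / 2 * q ^ (k + 1) * (p - q) ^ 2 =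
        q * E + (k + 2) * (p ^ (k + 1) - q ^ (k + 1)) * (p - q) ^ 2 := by
      rw [hE]
      push_cast
      ring
    rw [h]
    refine (abs_add_le _ _).trans ?_
    have h1 : |q * E| ≤ (k * (k + 2) ^ 2) * |p - q| ^ 3 := by
      rw [abs_mul, abs_of_nonneg hq.1]
      exact (mul_le_of_le_one_left (abs_nonneg _) hq.2).trans ih
    have h2 : |(k + 2) * (p ^ (k + 1) - q ^ (k + 1)) * (p - q) ^ 2| ≤
        (k + 2) * (k + 1) * |p - q| ^ 3 := by
      rw [abs_mul, abs_mul, abs_of_nonneg (by positivity : (0 : ℝ) ≤ k + 2), abs_pow]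
      have := abs_pow_sub_pow_le' hp hq (k + 1)
      push_cast at this
      calc _ ≤ (k + 2) * ((k + 1) * |p - q|) * |p - q| ^ 2 := by gcongr
        _ = _ := by ring
    refine (add_le_add h1 h2).trans ?_
    rw [← add_mul]
    refine mul_le_mul_of_nonneg_right ?_ (by positivity)
    have hk : (0 : ℝ) ≤ k := k.cast_nonneg
    push_cast
    nlinarith [mul_nonneg hk hk]

/-- The integrand of `n T` is, up to an error of order `n |p - q|³ + |p - q| + 1/n`, the integrand
of a weighted Cramér–von Mises statistic minus its mean; here `p = N / n` is the empirical
counterpart of `q`. -/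
lemma abs_stInt_sub_le {m : ℕ} (hm : 1 ≤ m) : ∃ C : ℝ, 0 ≤ C ∧ ∀ n N : ℕ, 2 * (m + 1) ≤ n → N ≤ n →
    ∀ q ∈ Icc (0 : ℝ) 1,
    |n * stInt m n N q - ((m + 1).choose 2 : ℝ) * q ^ (m - 1) *
      (n * ((N : ℝ) / n - q) ^ 2 - q * (1 - q))| ≤
      C * (n * |(N : ℝ) / n - q| ^ 3 + |(N : ℝ) / n - q| + 1 / n) := by
  obtain ⟨k, rfl⟩ : ∃ k, m = k + 1 := ⟨m - 1, by omega⟩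
  obtain ⟨C₁, hC₁, h₁⟩ := abs_choose_ratio_le (k + 1)
  obtain ⟨C₂, hC₂, h₂⟩ := abs_choose_ratio_le (k + 1 + 1)
  refine ⟨k * (k + 2) ^ 2 + (k + 1) * (k + 2) / 2 * (2 * k + 2) + ((k + 2) * C₁ + (k + 1) * C₂),
    by positivity, fun n N hn hN q hq => ?_⟩
  have hn0 : (0 : ℝ) < n := by exact_mod_cast (by omega : 0 < n)
  specialize h₁ n N (by omega) (by omega) hN
  specialize h₂ n N (by omega) (by omega) hN
  have hN' : (N : ℝ) ≤ n := by exact_mod_cast hN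
  set p : ℝ := (N : ℝ) / n with hpdef
  have hp : p ∈ Icc (0 : ℝ) 1 := ⟨by positivity, (div_le_one hn0).2 hN'⟩
  have hA := abs_quadratic_le hp hq k
  set d : ℝ := |p - q| with hd
  have hd0 : 0 ≤ d := abs_nonneg _
  have c1 : (((k + 1).choose 2 : ℕ) : ℝ) = (k + 1) * k / 2 := by
    rw [Nat.cast_choose_two]; push_cast; ring
  have c2 : (((k + 1 + 1).choose 2 : ℕ) : ℝ) = (k + 2) * (k + 1) / 2 := by
    rw [Nat.cast_choose_two]; push_cast; ring
  rw [c1] at h₁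
  rw [c2] at h₂
  simp only [Nat.add_sub_cancel] at h₁ h₂ ⊢
  rw [c2]
  set b₁ : ℝ := (N.choose (k + 1) : ℝ) / n.choose (k + 1) with hb₁
  set b₂ : ℝ := (N.choose (k + 1 + 1) : ℝ) / n.choose (k + 1 + 1) with hb₂
  set E₁ : ℝ := b₁ - (p ^ (k + 1) - (k + 1) * k / 2 * p ^ k * (1 - p) / n) with hE₁
  set E₂ : ℝ := b₂ - (p ^ (k + 1 + 1) - (k + 2) * (k + 1) / 2 * p ^ (k + 1) * (1 - p) / n) with hE₂
  set A : ℝ := q ^ (k + 2) - (k + 2) * q * p ^ (k + 1) + (k + 1) * p ^ (k + 2)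
      - (k + 1) * (k + 2) / 2 * q ^ k * (p - q) ^ 2 with hAdef
  have hid : n * stInt (k + 1) n N q - ((k : ℝ) + 2) * (k + 1) / 2 * q ^ k *
      (n * (p - q) ^ 2 - q * (1 - q)) =
      n * A + (k + 1) * (k + 2) / 2 * ((1 - p) * (k * p ^ k * (q - p)) +
        ((q ^ (k + 1) - p ^ (k + 1)) * (1 - p) + q ^ (k + 1) * (p - q)))
      + n * (-((k + 2) * q) * E₁ + (k + 1) * E₂) := by
    rw [stInt, ← hb₁, ← hb₂, hE₁, hE₂, hAdef]
    push_cast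
    field_simp
    ring
  rw [hid]
  have e1 : |n * A| ≤ (k * (k + 2) ^ 2) * (n * d ^ 3) := by
    rw [abs_mul, abs_of_pos hn0]
    calc _ ≤ (n : ℝ) * ((k * (k + 2) ^ 2) * d ^ 3) := mul_le_mul_of_nonneg_left hA hn0.le
      _ = _ := by ring
  have hp1 : |1 - p| ≤ 1 := by rw [abs_le]; constructor <;> linarith [hp.1, hp.2]
  have e2 : |(1 - p) * (k * p ^ k * (q - p)) +
        ((q ^ (k + 1) - p ^ (k + 1)) * (1 - p) + q ^ (k + 1) * (p - q))| ≤ (2 * k + 2) * d := by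
    have f1 : |(1 - p) * (k * p ^ k * (q - p))| ≤ k * d := by
      rw [abs_mul, abs_mul, abs_mul, abs_sub_comm q p, ← hd,
        abs_of_nonneg (pow_nonneg hp.1 k), abs_of_nonneg (k.cast_nonneg (α := ℝ))]
      have : (k : ℝ) * p ^ k * d ≤ k * 1 * d := by
        gcongr
        exact pow_le_one₀ hp.1 hp.2
      calc _ ≤ 1 * ((k : ℝ) * 1 * d) := mul_le_mul hp1 this
            (mul_nonneg (mul_nonneg k.cast_nonneg (pow_nonneg hp.1 k)) hd0) zero_le_one
        _ = _ := by ring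
    have f2 : |(q ^ (k + 1) - p ^ (k + 1)) * (1 - p)| ≤ (k + 1) * d := by
      rw [abs_mul, abs_sub_comm]
      have := abs_pow_sub_pow_le' hp hq (k + 1)
      push_cast at this
      calc _ ≤ ((k + 1) * d) * 1 := mul_le_mul this hp1 (abs_nonneg _) (by positivity)
        _ = _ := mul_one _
    have f3 : |q ^ (k + 1) * (p - q)| ≤ d := by
      rw [abs_mul, abs_of_nonneg (pow_nonneg hq.1 _)]
      exact mul_le_of_le_one_left hd0 (pow_le_one₀ hq.1 hq.2)
    have g1 := abs_add_le ((1 - p) * (k * p ^ k * (q - p)))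
      ((q ^ (k + 1) - p ^ (k + 1)) * (1 - p) + q ^ (k + 1) * (p - q))
    have g2 := abs_add_le ((q ^ (k + 1) - p ^ (k + 1)) * (1 - p)) (q ^ (k + 1) * (p - q))
    linarith
  have e2' : |((k : ℝ) + 1) * (k + 2) / 2 * ((1 - p) * (k * p ^ k * (q - p)) +
        ((q ^ (k + 1) - p ^ (k + 1)) * (1 - p) + q ^ (k + 1) * (p - q)))| ≤
        ((k : ℝ) + 1) * (k + 2) / 2 * (2 * k + 2) * d := by
    have h0 : (0 : ℝ) ≤ ((k : ℝ) + 1) * (k + 2) / 2 := by positivity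
    rw [abs_mul, abs_of_nonneg h0]
    exact (mul_le_mul_of_nonneg_left e2 h0).trans (le_of_eq (mul_assoc _ _ _).symm)
  have e3 : |n * (-((k + 2) * q) * E₁ + (k + 1) * E₂)| ≤
      ((k + 2) * C₁ + (k + 1) * C₂) * (1 / n) := by
    have f1 : |-((k + 2) * q) * E₁| ≤ (k + 2) * (C₁ / (n : ℝ) ^ 2) := by
      rw [abs_mul, abs_neg, abs_mul, abs_of_nonneg hq.1,
        abs_of_nonneg (by positivity : (0 : ℝ) ≤ (k : ℝ) + 2)]
      exact mul_le_mul (mul_le_of_le_one_right (by positivity) hq.2) h₁ (abs_nonneg _)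
        (by positivity)
    have f2 : |(k + 1) * E₂| ≤ (k + 1) * (C₂ / (n : ℝ) ^ 2) := by
      rw [abs_mul, abs_of_nonneg (by positivity : (0 : ℝ) ≤ (k : ℝ) + 1)]
      exact mul_le_mul_of_nonneg_left h₂ (by positivity)
    rw [abs_mul, abs_of_pos hn0]
    calc _ ≤ (n : ℝ) * ((k + 2) * (C₁ / (n : ℝ) ^ 2) + (k + 1) * (C₂ / (n : ℝ) ^ 2)) := by
          refine mul_le_mul_of_nonneg_left ((abs_add_le _ _).trans (add_le_add f1 f2)) hn0.le
      _ = _ := by field_simp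
  refine (abs_add_three _ _ _).trans ?_
  set c₁ : ℝ := k * (k + 2) ^ 2 with hc₁
  set c₂ : ℝ := ((k : ℝ) + 1) * (k + 2) / 2 * (2 * k + 2) with hc₂
  set c₃ : ℝ := (k + 2) * C₁ + (k + 1) * C₂ with hc₃
  have p1 : 0 ≤ c₁ := by positivity
  have p2 : 0 ≤ c₂ := by positivity
  have p3 : 0 ≤ c₃ := by positivity
  have z1 : 0 ≤ n * d ^ 3 := by positivity
  have z3 : (0 : ℝ) ≤ 1 / n := by positivity
  have := mul_nonneg p1 hd0
  have := mul_nonneg p1 z3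
  have := mul_nonneg p2 z1
  have := mul_nonneg p2 z3
  have := mul_nonneg p3 z1
  have := mul_nonneg p3 hd0
  linarith

end Expansion

/-! ### Moments of independent samples -/

section Moments

variable {Ω : Type*} [MeasurableSpace Ω] {P : Measure Ω} [IsProbabilityMeasure P]

lemma integrable_of_abs_le {f : Ω → ℝ} (hf : Measurable f) {C : ℝ} (h : ∀ ω, |f ω| ≤ C) :
    Integrable f P :=
  Integrable.of_bound hf.aestronglyMeasurable C (Eventually.of_forall h)

/-- Second and fourth moment of a sum of `n` independent centred variables bounded by one. The
bounds are proved by induction on `n`; for the fourth moment the step is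
`3n² + 6n + 1 ≤ 3(n + 1)²`. -/
lemma integral_sum_sq_pow_four_le {ξ : ℕ → Ω → ℝ} (hξ : ∀ i, Measurable (ξ i))
    (hb : ∀ i ω, |ξ i ω| ≤ 1) (h0 : ∀ i, ∫ ω, ξ i ω ∂P = 0) (hi : iIndepFun ξ P) (n : ℕ) :
    ∫ ω, (∑ i ∈ Finset.range n, ξ i ω) ^ 2 ∂P ≤ n ∧
      ∫ ω, (∑ i ∈ Finset.range n, ξ i ω) ^ 4 ∂P ≤ 3 * (n : ℝ) ^ 2 := by
  induction n with
  | zero => simp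
  | succ n ih =>
    set S : Ω → ℝ := fun ω => ∑ i ∈ Finset.range n, ξ i ω with hS
    have hSm : Measurable S := Finset.measurable_sum _ fun i _ => hξ i
    have hSb : ∀ ω, |S ω| ≤ n := fun ω => by
      refine (Finset.abs_sum_le_sum_abs _ _).trans ((Finset.sum_le_sum fun i _ => hb i ω).trans ?_)
      simp
    have hind : IndepFun S (ξ n) P := by
      have := hi.indepFun_finsetSum_of_notMem (s := Finset.range n) (i := n) hξ (by simp)
      rwa [show (∑ j ∈ Finset.range n, ξ j) = S from by ext ω; simp [hS]] at this
    have hprod : ∀ a b : ℕ, ∫ ω, S ω ^ a * ξ n ω ^ b ∂P =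
        (∫ ω, S ω ^ a ∂P) * ∫ ω, ξ n ω ^ b ∂P := fun a b =>
      hind.integral_fun_comp_mul_comp hSm.aemeasurable (hξ n).aemeasurable
        (f := fun x => x ^ a) (g := fun x => x ^ b)
        (measurable_id.pow_const a).aestronglyMeasurable
        (measurable_id.pow_const b).aestronglyMeasurable
    have hint : ∀ a b : ℕ, Integrable (fun ω => S ω ^ a * ξ n ω ^ b) P := fun a b => by
      refine integrable_of_abs_le (C := (n : ℝ) ^ a * 1 ^ b) (by fun_prop) fun ω => ?_
      rw [abs_mul, abs_pow, abs_pow]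
      exact mul_le_mul (pow_le_pow_left₀ (abs_nonneg _) (hSb ω) _)
        (pow_le_pow_left₀ (abs_nonneg _) (hb n ω) _) (by positivity) (by positivity)
    have hS0 : ∫ ω, S ω ∂P = 0 := by
      rw [hS, integral_finsetSum _ fun i _ => integrable_of_abs_le (hξ i) (hb i)]
      exact Finset.sum_eq_zero fun i _ => h0 i
    have hle : ∀ b : ℕ, ∫ ω, ξ n ω ^ b ∂P ≤ 1 := fun b => by
      have h := integral_mono (by simpa using hint 0 b) (integrable_const (μ := P) (1 : ℝ))
        fun ω => (le_abs_self (ξ n ω ^ b)).trans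
          (by rw [abs_pow]; exact pow_le_one₀ (abs_nonneg _) (hb n ω))
      simpa using h
    have hS2 : 0 ≤ ∫ ω, S ω ^ 2 ∂P := integral_nonneg fun ω => sq_nonneg _
    constructor
    · have e : ∀ ω, (∑ i ∈ Finset.range (n + 1), ξ i ω) ^ 2 =
          S ω ^ 2 * ξ n ω ^ 0 + 2 * (S ω ^ 1 * ξ n ω ^ 1) + S ω ^ 0 * ξ n ω ^ 2 := fun ω => by
        rw [Finset.sum_range_succ]; ring
      simp_rw [e]
      rw [integral_add ((hint 2 0).fun_add ((hint 1 1).const_mul 2)) (hint 0 2),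
        integral_add (hint 2 0) ((hint 1 1).const_mul 2), integral_const_mul, hprod, hprod, hprod]
      simp only [pow_one, pow_zero, h0, integral_const, probReal_univ, smul_eq_mul]
      push_cast
      linarith [hle 2, ih.1]
    · have e : ∀ ω, (∑ i ∈ Finset.range (n + 1), ξ i ω) ^ 4 =
          S ω ^ 4 * ξ n ω ^ 0 + 4 * (S ω ^ 3 * ξ n ω ^ 1) + 6 * (S ω ^ 2 * ξ n ω ^ 2) +
            4 * (S ω ^ 1 * ξ n ω ^ 3) + S ω ^ 0 * ξ n ω ^ 4 := fun ω => by
        rw [Finset.sum_range_succ]; ring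
      have i1 := (hint 3 1).const_mul 4
      have i2 := (hint 2 2).const_mul 6
      have i3 := (hint 1 3).const_mul 4
      simp_rw [e]
      rw [integral_add ((((hint 4 0).fun_add i1).fun_add i2).fun_add i3) (hint 0 4),
        integral_add (((hint 4 0).fun_add i1).fun_add i2) i3,
        integral_add ((hint 4 0).fun_add i1) i2,
        integral_add (hint 4 0) i1, integral_const_mul, integral_const_mul, integral_const_mul,
        hprod, hprod, hprod, hprod, hprod]
      simp only [pow_one, pow_zero, h0, hS0, integral_const, probReal_univ, smul_eq_mul]
      have h22 : (∫ ω, S ω ^ 2 ∂P) * ∫ ω, ξ n ω ^ 2 ∂P ≤ n * 1 :=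
        mul_le_mul ih.1 (hle 2) (integral_nonneg fun ω => sq_nonneg _) (by positivity)
      push_cast
      nlinarith [hle 4, ih.2]

/-- A degenerate symmetric statistic of an i.i.d. sample: only the diagonal terms contribute to the
expectation. -/
lemma integral_sum_sum_of_degenerate {X : ℕ → Ω → ℝ} (hX : ∀ i, HasLaw (X i) unif P)
    (hXm : ∀ i, Measurable (X i)) (hi : iIndepFun X P) {G : ℝ → ℝ → ℝ}
    (hG : Measurable (Function.uncurry G)) {C : ℝ} (hC : ∀ s t, |G s t| ≤ C)
    (h0 : ∫ t, ∫ s, G s t ∂unif ∂unif = 0) (n : ℕ) :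
    ∫ ω, ∑ i ∈ Finset.range n, ∑ j ∈ Finset.range n, G (X i ω) (X j ω) ∂P =
      n * ∫ s, G s s ∂unif := by
  have hGi : ∀ i j, Integrable (fun ω => G (X i ω) (X j ω)) P := fun i j =>
    integrable_of_abs_le (hG.comp ((hXm i).prodMk (hXm j))) fun ω => hC _ _
  have hGp : Integrable (Function.uncurry G) (unif.prod unif) :=
    Integrable.of_bound hG.aestronglyMeasurable C (Eventually.of_forall fun p => hC _ _)
  have hoff : ∀ i j, i ≠ j → ∫ ω, G (X i ω) (X j ω) ∂P = 0 := by
    intro i j hij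
    have hmap : P.map (fun ω => (X i ω, X j ω)) = unif.prod unif := by
      rw [(indepFun_iff_map_prod_eq_prod_map_map (hXm i).aemeasurable (hXm j).aemeasurable).1
        (hi.indepFun hij), (hX i).map_eq, (hX j).map_eq]
    have := integral_map (μ := P) (((hXm i).prodMk (hXm j)).aemeasurable)
      (f := Function.uncurry G) hG.aestronglyMeasurable
    simp only [Function.uncurry] at this
    rw [← this, hmap, ← h0]
    exact integral_prod_symm _ hGp
  have hdiag : ∀ i, ∫ ω, G (X i ω) (X i ω) ∂P = ∫ s, G s s ∂unif := fun i =>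
    (hX i).integral_comp (f := fun s => G s s)
      (hG.comp (measurable_id.prodMk measurable_id)).aestronglyMeasurable
  rw [integral_finsetSum _ fun i _ => integrable_finsetSum _ fun j _ => hGi i j]
  have : ∀ i ∈ Finset.range n, ∫ ω, ∑ j ∈ Finset.range n, G (X i ω) (X j ω) ∂P =
      ∫ s, G s s ∂unif := fun i hin => by
    rw [integral_finsetSum _ fun j _ => hGi i j,
      Finset.sum_eq_single_of_mem i hin fun j _ hj => hoff i j hj.symm, hdiag]
  rw [Finset.sum_congr rfl this]
  simp

end Moments

/-! ### Pointwise eigenfunctions and truncation of the quadratic form -/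

open scoped RealInnerProductSpace

/-- Orthonormal bounded centred functions `φ i` which satisfy the eigenvalue equation of the
integral operator with kernel `covKer m` at every point. -/
structure EigenSystem {ι : Type*} [DecidableEq ι] (m : ℕ) (ν : ι → ℝ) (φ : ι → ℝ → ℝ) : Prop where
  measurable : ∀ i, Measurable (φ i)
  bounded : ∀ i, ∃ C, ∀ s, |φ i s| ≤ C
  orthonormal : ∀ i j, ∫ s, φ i s * φ j s ∂unif = if i = j then 1 else 0
  centred : ∀ i, ∫ s, φ i s ∂unif = 0
  eigen : ∀ i s, ∫ u, wt m u * (cind u s * cF (φ i) u) ∂unif = ν i * φ i s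

lemma measurable_cF {f : ℝ → ℝ} (hf : Measurable f) : Measurable (cF f) := by
  have : StronglyMeasurable fun p : ℝ × ℝ => cind p.1 p.2 * f p.2 :=
    Measurable.stronglyMeasurable (by fun_prop)
  exact this.integral_prod_right'.measurable

/-- Eigenvectors in `L²` for nonzero eigenvalues have representatives that satisfy the integral
equation everywhere. -/
lemma exists_eigenSystem {ι : Type*} [DecidableEq ι] (m : ℕ) {ν : ι → ℝ} (hν : ∀ i, ν i ≠ 0)
    {e : ι → L2} (he : Orthonormal ℝ e) (hev : ∀ i, gram unif (feat m) (e i) = ν i • e i)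
    (hm : 1 ≤ m) : ∃ φ : ι → ℝ → ℝ, EigenSystem m ν φ := by
  -- the integral defining `S e_i` makes sense at every point and represents `ν_i e_i`
  set φ : ι → ℝ → ℝ := fun i s => (ν i)⁻¹ * ∫ u, wt m u * (cind u s * cF (e i) u) ∂unif with hφ
  have hem : ∀ i, Measurable (e i) := fun i => (Lp.stronglyMeasurable (e i)).measurable
  have hei : ∀ i, Integrable (e i) unif := fun i => integrable_coe_L2 (e i)
  have hνφ : ∀ i s, ν i * φ i s = ∫ u, wt m u * (cind u s * cF (e i) u) ∂unif := fun i s => by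
    rw [hφ]; exact mul_inv_cancel_left₀ (hν i) _
  have hae : ∀ i, φ i =ᵐ[unif] e i := fun i => by
    have h1 : opS m (e i) = ν i • e i := by rw [opS_eq_gram hm]; exact hev i
    filter_upwards [h1 ▸ opS_coeFn hm (e i), Lp.coeFn_smul (ν i) (e i)] with t h2 h3
    rw [integral_covKer_mul m (hei i), ← hνφ, h3] at h2
    exact (mul_left_cancel₀ (hν i) h2).symm
  have hcF : ∀ i u, cF (φ i) u = cF (e i) u := fun i u =>
    integral_congr_ae ((hae i).mono fun s hs => by simp only [hs])
  refine ⟨φ, fun i => ?_, fun i => ?_, fun i j => ?_, fun i => ?_, fun i s => ?_⟩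
  · have hm' := measurable_cF (hem i)
    have : StronglyMeasurable fun p : ℝ × ℝ => wt m p.2 * (cind p.2 p.1 * cF (e i) p.2) :=
      Measurable.stronglyMeasurable (by fun_prop)
    exact this.integral_prod_right'.measurable.const_mul _
  · refine ⟨|(ν i)⁻¹| * (2 * (1 * ∫ s, |e i s| ∂unif)), fun s => ?_⟩
    rw [hφ, abs_mul]
    refine mul_le_mul_of_nonneg_left ?_ (abs_nonneg _)
    have h := norm_integral_le_of_norm_le_const (μ := unif) (C := 2 * (1 * ∫ s, |e i s| ∂unif))
      (f := fun u => wt m u * (cind u s * cF (e i) u)) (ae_unif_mem.mono fun u hu => by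
        rw [Real.norm_eq_abs, abs_mul, abs_mul]
        exact mul_le_mul (abs_wt_le m hu) (mul_le_mul (abs_cind_le hu s) (abs_cF_le (hei i) hu)
          (abs_nonneg _) zero_le_one) (by positivity) (by norm_num))
    simpa using h
  · rw [← orthonormal_iff_ite.1 he i j, L2.inner_def]
    refine integral_congr_ae ?_
    filter_upwards [hae i, hae j] with s h1 h2
    rw [h1, h2]
    simp [mul_comm]
  · have h := integral_integral_covKer_mul m (hei i)
    simp only [integral_covKer_mul m (hei i), ← hνφ, integral_const_mul] at h
    exact (mul_eq_zero.1 h).resolve_left (hν i)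
  · simp only [hcF, hνφ]

namespace EigenSystem

variable {ι : Type*} [DecidableEq ι] {m : ℕ} {ν : ι → ℝ} {φ : ι → ℝ → ℝ}

lemma comp {κ : Type*} [DecidableEq κ] (h : EigenSystem m ν φ) {f : κ → ι}
    (hf : Function.Injective f) : EigenSystem m (ν ∘ f) (fun k => φ (f k)) where
  measurable k := h.measurable _
  bounded k := h.bounded _
  orthonormal i j := by rw [h.orthonormal]; simp only [hf.eq_iff]
  centred k := h.centred _
  eigen k s := h.eigen _ s

lemma integrable (h : EigenSystem m ν φ) (i : ι) : Integrable (φ i) unif := by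
  obtain ⟨C, hC⟩ := h.bounded i
  exact integrable_of_abs_le (h.measurable i) hC

lemma measurable_cF (h : EigenSystem m ν φ) (i : ι) : Measurable (cF (φ i)) :=
  UniformityTest.measurable_cF (h.measurable i)

/-- The functions `cF (φ i)` are orthogonal for the weight `w`, with squared norms `ν i`. -/
lemma integral_wt_cF_mul (h : EigenSystem m ν φ) (i j : ι) :
    ∫ u, wt m u * (cF (φ i) u * cF (φ j) u) ∂unif = if i = j then ν i else 0 := by
  rw [← integral_mul_integral_wt m (h.integrable i) (h.measurable_cF j).aestronglyMeasurable
    fun u hu => abs_cF_le (h.integrable j) hu]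
  simp only [h.eigen, mul_left_comm _ (ν j), integral_const_mul, h.orthonormal]
  split_ifs with hij
  · rw [hij, mul_one]
  · rw [mul_zero]

lemma nonneg (h : EigenSystem m ν φ) (i : ι) : 0 ≤ ν i := by
  have h1 := h.integral_wt_cF_mul i i
  rw [if_pos rfl] at h1
  rw [← h1]
  refine integral_nonneg_of_ae (ae_unif_mem.mono fun u hu => ?_)
  exact mul_nonneg (wt_nonneg m hu) (mul_self_nonneg _)

lemma integrable_sq (h : EigenSystem m ν φ) (k l : ι) :
    Integrable (fun s => φ k s * φ l s) unif := by
  obtain ⟨C, hC⟩ := h.bounded k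
  obtain ⟨C', hC'⟩ := h.bounded l
  have h1 := h.measurable
  refine integrable_of_abs_le (by fun_prop) (C := C * C') fun s => ?_
  rw [abs_mul]
  exact mul_le_mul (hC s) (hC' s) (abs_nonneg _) ((abs_nonneg _).trans (hC s))

variable [Fintype ι]

/-- The kernel with finitely many terms of its eigenfunction expansion removed. -/
noncomputable def residual (_ : EigenSystem m ν φ) (s t : ℝ) : ℝ :=
  covKer m s t - ∑ k, ν k * (φ k s * φ k t)

/-- The quadratic form of the truncated kernel in the sample. -/
lemma sum_sum_residual (h : EigenSystem m ν φ) (x : ℕ → ℝ) (n : ℕ) :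
    ∑ i ∈ Finset.range n, ∑ j ∈ Finset.range n, h.residual (x i) (x j) =
      ∫ u, wt m u * (∑ i ∈ Finset.range n, cind u (x i)) ^ 2 ∂unif -
        ∑ k, ν k * (∑ i ∈ Finset.range n, φ k (x i)) ^ 2 := by
  have h1 : ∑ i ∈ Finset.range n, ∑ j ∈ Finset.range n, covKer m (x i) (x j) =
      ∫ u, wt m u * (∑ i ∈ Finset.range n, cind u (x i)) ^ 2 ∂unif := by
    unfold covKer
    simp only [sq, Finset.sum_mul_sum]
    simp only [Finset.mul_sum]
    rw [integral_finsetSum _ fun i _ => integrable_finsetSum _ fun j _ => integrable_wt_cind m _ _]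
    exact Finset.sum_congr rfl fun i _ =>
      (integral_finsetSum _ fun j _ => integrable_wt_cind m _ _).symm
  have h2 : ∑ i ∈ Finset.range n, ∑ j ∈ Finset.range n, ∑ k, ν k * (φ k (x i) * φ k (x j)) =
      ∑ k, ν k * (∑ i ∈ Finset.range n, φ k (x i)) ^ 2 := by
    simp only [sq, Finset.sum_mul_sum]
    simp only [Finset.mul_sum]
    exact (Finset.sum_congr rfl fun i _ => Finset.sum_comm).trans Finset.sum_comm
  simp only [residual, Finset.sum_sub_distrib, h1, h2]

/-- The quadratic form of the truncated kernel is nonnegative: it is the squared norm of the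
empirical process `D` minus its projection onto the functions `cF (φ k)`, which are orthogonal with
squared norms `ν k` with respect to the weight. -/
lemma sum_sum_residual_nonneg (h : EigenSystem m ν φ) (x : ℕ → ℝ) (n : ℕ) :
    0 ≤ ∑ i ∈ Finset.range n, ∑ j ∈ Finset.range n, h.residual (x i) (x j) := by
  set D : ℝ → ℝ := fun u => ∑ i ∈ Finset.range n, cind u (x i) with hD
  set V : ι → ℝ := fun k => ∑ i ∈ Finset.range n, φ k (x i) with hV
  have hDm : Measurable D := by fun_prop
  have hc := h.measurable_cF
  have hDb : ∀ u ∈ Icc (0 : ℝ) 1, |D u| ≤ n := fun u hu =>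
    (Finset.abs_sum_le_sum_abs _ _).trans
      ((Finset.sum_le_sum fun i _ => abs_cind_le hu (x i)).trans (by simp))
  have hcb : ∀ k, ∀ u ∈ Icc (0 : ℝ) 1, |cF (φ k) u| ≤ ∫ s, |φ k s| ∂unif :=
    fun k u hu => abs_cF_le (h.integrable k) hu
  -- products of bounded measurable functions are integrable
  have hint : ∀ {f g : ℝ → ℝ} {A B : ℝ}, Measurable f → Measurable g →
      (∀ u ∈ Icc (0 : ℝ) 1, |f u| ≤ A) → (∀ u ∈ Icc (0 : ℝ) 1, |g u| ≤ B) →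
      Integrable (fun u => wt m u * (f u * g u)) unif := by
    intro f g A B hf hg hA hB
    refine integrable_unif_of_bound (by fun_prop) (2 * (A * B)) fun u hu => ?_
    have hA0 : 0 ≤ A := (abs_nonneg _).trans (hA u hu)
    rw [abs_mul, abs_mul]
    exact mul_le_mul (abs_wt_le m hu) (mul_le_mul (hA u hu) (hB u hu) (abs_nonneg _) hA0)
      (by positivity) (by norm_num)
  have hDc : ∀ k, ∫ u, wt m u * (D u * cF (φ k) u) ∂unif = ν k * V k := fun k => by
    simp only [hD, hV, Finset.sum_mul, Finset.mul_sum, ← h.eigen]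
    exact integral_finsetSum _ fun i _ => hint (by fun_prop) (hc k)
      (fun u hu => abs_cind_le hu (x i)) (hcb k)
  have key : ∫ u, wt m u * (D u - ∑ k, V k * cF (φ k) u) ^ 2 ∂unif =
      ∫ u, wt m u * D u ^ 2 ∂unif - ∑ k, ν k * V k ^ 2 := by
    have e : ∀ u, wt m u * (D u - ∑ k, V k * cF (φ k) u) ^ 2 =
        wt m u * (D u * D u) - (∑ k, 2 * V k * (wt m u * (D u * cF (φ k) u)) -
          ∑ k, ∑ l, V k * V l * (wt m u * (cF (φ k) u * cF (φ l) u))) := fun u => by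
      have e1 : ∑ k, 2 * V k * (wt m u * (D u * cF (φ k) u)) =
          2 * wt m u * D u * ∑ k, V k * cF (φ k) u := by
        rw [Finset.mul_sum]; exact Finset.sum_congr rfl fun k _ => by ring
      have e2 : ∑ k, ∑ l, V k * V l * (wt m u * (cF (φ k) u * cF (φ l) u)) =
          wt m u * ((∑ k, V k * cF (φ k) u) * ∑ k, V k * cF (φ k) u) := by
        rw [Finset.sum_mul_sum, Finset.mul_sum]
        refine Finset.sum_congr rfl fun k _ => ?_
        rw [Finset.mul_sum]; exact Finset.sum_congr rfl fun l _ => by ring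
      rw [e1, e2]; ring
    have i0 := hint hDm hDm hDb hDb
    have i1 : ∀ k, Integrable (fun u => 2 * V k * (wt m u * (D u * cF (φ k) u))) unif :=
      fun k => (hint hDm (hc k) hDb (hcb k)).const_mul _
    have i2 : ∀ k l, Integrable (fun u => V k * V l * (wt m u * (cF (φ k) u * cF (φ l) u))) unif :=
      fun k l => (hint (hc k) (hc l) (hcb k) (hcb l)).const_mul _
    have i1' := integrable_finsetSum (μ := unif) Finset.univ fun k _ => i1 k
    have i2' := integrable_finsetSum (μ := unif) Finset.univ fun k _ =>
      integrable_finsetSum (μ := unif) Finset.univ fun l _ => i2 k l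
    have i3 : Integrable (fun u => ∑ k, 2 * V k * (wt m u * (D u * cF (φ k) u)) -
        ∑ k, ∑ l, V k * V l * (wt m u * (cF (φ k) u * cF (φ l) u))) unif := i1'.sub i2'
    simp_rw [e]
    rw [integral_sub i0 i3, integral_sub i1' i2',
      integral_finsetSum _ fun k _ => i1 k,
      integral_finsetSum _ fun k _ => integrable_finsetSum _ fun l _ => i2 k l]
    have e3 : ∀ k, ∫ u, ∑ l, V k * V l * (wt m u * (cF (φ k) u * cF (φ l) u)) ∂unif =
        ν k * V k ^ 2 := fun k => by
      rw [integral_finsetSum _ fun l _ => i2 k l]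
      simp only [integral_const_mul, h.integral_wt_cF_mul]
      simp
      ring
    simp only [e3, integral_const_mul, hDc, ← sq]
    have e4 : ∑ k, 2 * V k * (ν k * V k) = 2 * ∑ k, ν k * V k ^ 2 := by
      rw [Finset.mul_sum]; exact Finset.sum_congr rfl fun k _ => by ring
    rw [e4]; ring
  rw [h.sum_sum_residual, ← key]
  exact integral_nonneg_of_ae (ae_unif_mem.mono fun u hu =>
    mul_nonneg (wt_nonneg m hu) (sq_nonneg _))

lemma exists_abs_residual_le (h : EigenSystem m ν φ) : ∃ C, ∀ s t, |h.residual s t| ≤ C := by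
  choose B hB using h.bounded
  refine ⟨2 + ∑ k, |ν k| * (B k * B k), fun s t => ?_⟩
  refine (abs_sub _ _).trans (add_le_add (abs_covKer_le m s t) ?_)
  refine (Finset.abs_sum_le_sum_abs _ _).trans (Finset.sum_le_sum fun k _ => ?_)
  rw [abs_mul, abs_mul]
  exact mul_le_mul_of_nonneg_left (mul_le_mul (hB k s) (hB k t) (abs_nonneg _)
    ((abs_nonneg _).trans (hB k s))) (abs_nonneg _)

lemma measurable_residual (h : EigenSystem m ν φ) : Measurable (Function.uncurry h.residual) := by
  have h1 := measurable_covKer m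
  have h2 := h.measurable
  have : Function.uncurry h.residual = fun p : ℝ × ℝ =>
      Function.uncurry (covKer m) p - ∑ k, ν k * (φ k p.1 * φ k p.2) := rfl
  rw [this]
  fun_prop

lemma integral_integral_residual (h : EigenSystem m ν φ) :
    ∫ t, ∫ s, h.residual s t ∂unif ∂unif = 0 := by
  have hin : ∀ t, ∫ s, h.residual s t ∂unif = ∫ s, covKer m s t * 1 ∂unif := fun t => by
    have hi : Integrable (fun s => covKer m s t) unif :=
      integrable_of_abs_le ((measurable_covKer m).comp (measurable_id.prodMk measurable_const))
        fun s => abs_covKer_le m s t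
    have hk : ∀ k, Integrable (fun s => ν k * (φ k s * φ k t)) unif := fun k =>
      ((h.integrable k).mul_const _).const_mul _
    simp only [residual, mul_one]
    rw [integral_sub hi (integrable_finsetSum _ fun k _ => hk k),
      integral_finsetSum _ fun k _ => hk k]
    simp [integral_const_mul, integral_mul_const, h.centred]
  simp only [hin]
  exact integral_integral_covKer_mul m (integrable_const _)

/-- The trace of the kernel. -/
lemma integral_covKer_diag (m : ℕ) :
    ∫ s, covKer m s s ∂unif = ∫ u, wt m u * ((1 - u) * u) ∂unif := by
  have hi : Integrable (fun p : ℝ × ℝ => wt m p.2 * (cind p.2 p.1 * cind p.2 p.1))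
      (unif.prod unif) :=
    Integrable.of_bound (Measurable.aestronglyMeasurable (by fun_prop)) 2
      (ae_snd_mem.mono fun p hp => abs_wt_mul_cind_le m hp _ _)
  unfold covKer
  rw [integral_integral_swap hi]
  refine integral_congr_ae (ae_unif_mem.mono fun u hu => ?_)
  simp only [integral_const_mul, ← sq, integral_cind_sq hu]

lemma integral_residual_diag (h : EigenSystem m ν φ) :
    ∫ s, h.residual s s ∂unif = ∫ u, wt m u * ((1 - u) * u) ∂unif - ∑ k, ν k := by
  have hi : Integrable (fun s => covKer m s s) unif :=
    integrable_of_abs_le ((measurable_covKer m).comp (measurable_id.prodMk measurable_id))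
      fun s => abs_covKer_le m s s
  have hk : ∀ k, Integrable (fun s => ν k * (φ k s * φ k s)) unif := fun k =>
    (h.integrable_sq k k).const_mul _
  simp only [residual]
  rw [integral_sub hi (integrable_finsetSum _ fun k _ => hk k),
    integral_finsetSum _ fun k _ => hk k, integral_covKer_diag]
  simp [integral_const_mul, h.orthonormal]

/-- The normalised quadratic form of the truncated kernel has the missing part of the trace as its
expectation, whatever the sample size. -/
lemma integral_sum_sum_residual (h : EigenSystem m ν φ) {Ω : Type*} [MeasurableSpace Ω]
    {P : Measure Ω} [IsProbabilityMeasure P] {X : ℕ → Ω → ℝ} (hX : ∀ i, HasLaw (X i) unif P)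
    (hXm : ∀ i, Measurable (X i)) (hi : iIndepFun X P) (n : ℕ) :
    ∫ ω, ∑ i ∈ Finset.range n, ∑ j ∈ Finset.range n, h.residual (X i ω) (X j ω) ∂P =
      n * (∫ u, wt m u * ((1 - u) * u) ∂unif - ∑ k, ν k) := by
  obtain ⟨C, hC⟩ := h.exists_abs_residual_le
  rw [integral_sum_sum_of_degenerate hX hXm hi h.measurable_residual hC
    h.integral_integral_residual, h.integral_residual_diag]

end EigenSystem

/-! ### The statistic and the quadratic form of the sample -/

/-- The deviation of the exceedance frequency from its mean as a sum of centred indicators. -/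
lemma cnt_div_sub {n : ℕ} (hn : 0 < n) (u : ℝ) (x : ℕ → ℝ) :
    (cnt u (fun i : Fin n => x i) : ℝ) / n - (1 - u) =
      (∑ i ∈ Finset.range n, cind u (x i)) / n := by
  have h : (cnt u (fun i : Fin n => x i) : ℝ) = ∑ i ∈ Finset.range n, ind u (x i) := by
    rw [← Fin.sum_univ_eq_sum_range (fun i => ind u (x i)) n]
    simp [cnt, ind]
  have hn' : (n : ℝ) ≠ 0 := by exact_mod_cast hn.ne'
  rw [h]
  simp only [cind, Finset.sum_sub_distrib, Finset.sum_const, Finset.card_range, nsmul_eq_mul]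
  field_simp

/-- The integrand of the statistic is close to that of the quadratic form. The cubic and linear
error terms are split by the inequality of arithmetic and geometric means, with the weights
balanced for `D` of order `√n`. -/
lemma exists_abs_integrand_le {m : ℕ} (hm : 1 ≤ m) : ∃ C : ℝ, 0 ≤ C ∧ ∀ n : ℕ, 2 * (m + 1) ≤ n →
    ∀ x : ℕ → ℝ, ∀ u ∈ Icc (0 : ℝ) 1,
    |n * (2 / ((m : ℝ) + 1) * stInt m n (cnt u (fun i : Fin n => x i)) (1 - u)) -
      ((m + 1).choose 2 : ℝ) * (wt m u * (∑ i ∈ Finset.range n, cind u (x i)) ^ 2 / n -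
        wt m u * ((1 - u) * u))| ≤
      C * ((∑ i ∈ Finset.range n, cind u (x i)) ^ 4 / √n ^ 5 +
        2 * ((∑ i ∈ Finset.range n, cind u (x i)) ^ 2 / √n ^ 3) + 3 / √n) := by
  obtain ⟨C, hC, h⟩ := abs_stInt_sub_le hm
  refine ⟨C, hC, fun n hn x u hu => ?_⟩
  have hn0 : 0 < n := by omega
  have hnr : (0 : ℝ) < n := by exact_mod_cast hn0
  have hq : 1 - u ∈ Icc (0 : ℝ) 1 := ⟨by linarith [hu.2], by linarith [hu.1]⟩
  have hN : cnt u (fun i : Fin n => x i) ≤ n := by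
    refine (Finset.card_le_univ _).trans (by simp)
  have h1 := h n _ hn hN (1 - u) hq
  rw [cnt_div_sub hn0] at h1
  set D := ∑ i ∈ Finset.range n, cind u (x i)
  set r := √(n : ℝ) with hr
  have hr0 : 0 < r := Real.sqrt_pos.2 hnr
  have hr1 : 1 ≤ r := Real.one_le_sqrt.2 (by exact_mod_cast hn0)
  have hrn : (n : ℝ) = r ^ 2 := (Real.sq_sqrt hnr.le).symm
  have e : n * (2 / ((m : ℝ) + 1) * stInt m n (cnt u (fun i : Fin n => x i)) (1 - u)) -
      ((m + 1).choose 2 : ℝ) * (wt m u * D ^ 2 / n - wt m u * ((1 - u) * u)) =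
      2 / ((m : ℝ) + 1) * (n * stInt m n (cnt u (fun i : Fin n => x i)) (1 - u) -
        ((m + 1).choose 2 : ℝ) * (1 - u) ^ (m - 1) *
          (n * (D / n) ^ 2 - (1 - u) * (1 - (1 - u)))) := by
    unfold wt
    field_simp
    ring
  have h2 : 2 / ((m : ℝ) + 1) ≤ 2 :=
    div_le_self (by norm_num) (by linarith [m.cast_nonneg (α := ℝ)])
  have h3 : n * |D / n| ^ 3 + |D / n| + 1 / n ≤
      (D ^ 4 / r ^ 5 + 2 * (D ^ 2 / r ^ 3) + 3 / r) / 2 := by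
    rw [abs_div, abs_of_pos hnr, hrn, ← sq_abs D, show D ^ 4 = |D| ^ 4 from by
      rw [show (4 : ℕ) = 2 * 2 from rfl, pow_mul, pow_mul, sq_abs]]
    have e1 : r ^ 2 * (|D| / r ^ 2) ^ 3 = |D| ^ 3 / r ^ 4 := by field_simp
    have e2 : |D| ^ 4 / r ^ 5 + |D| ^ 2 / r ^ 3 - 2 * (|D| ^ 3 / r ^ 4) =
        |D| ^ 2 / r ^ 3 * (|D| / r - 1) ^ 2 := by field_simp; ring
    have e3 : |D| ^ 2 / r ^ 3 + 1 / r - 2 * (|D| / r ^ 2) = 1 / r * (|D| / r - 1) ^ 2 := by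
      field_simp; ring
    have e4 : 1 / r ^ 2 ≤ 1 / r := by
      refine one_div_le_one_div_of_le hr0 ?_
      nlinarith
    have e5 : 0 ≤ |D| ^ 2 / r ^ 3 * (|D| / r - 1) ^ 2 := by positivity
    have e6 : 0 ≤ 1 / r * (|D| / r - 1) ^ 2 := by positivity
    have e7 : 3 / r = 3 * (1 / r) := by ring
    rw [e1, e7]
    linarith
  have h4 : 0 ≤ n * |D / n| ^ 3 + |D / n| + 1 / n := by positivity
  rw [e, abs_mul, abs_of_nonneg (by positivity : (0 : ℝ) ≤ 2 / ((m : ℝ) + 1))]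
  calc _ ≤ 2 * (C * (n * |D / n| ^ 3 + |D / n| + 1 / n)) :=
        mul_le_mul h2 h1 (abs_nonneg _) (by norm_num)
    _ = C * (2 * (n * |D / n| ^ 3 + |D / n| + 1 / n)) := by ring
    _ ≤ _ := mul_le_mul_of_nonneg_left (by linarith) hC

section Sample

variable {Ω : Type*} [MeasurableSpace Ω] {P : Measure Ω} [IsProbabilityMeasure P] {X : ℕ → Ω → ℝ}

lemma measurable_statT {m : ℕ} (hm : 1 ≤ m) (hXm : ∀ i, Measurable (X i))
    (hXI : ∀ i ω, X i ω ∈ Icc (0 : ℝ) 1) (n : ℕ) :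
    Measurable fun ω => statT m n (fun i => X i ω) := by
  by_cases hn : m + 1 ≤ n
  · simp only [fun ω => statT_eq hm hn (x := fun i : Fin n => X i ω) fun i => hXI i ω]
    have : StronglyMeasurable fun p : Ω × ℝ =>
        stInt m n (cnt p.2 (fun i : Fin n => X i p.1)) (1 - p.2) :=
      (measurable_stInt_cnt m measurable_snd (by fun_prop)).stronglyMeasurable
    exact this.integral_prod_right'.measurable.const_mul _
  -- there are no subsamples of size `m + 1`, and the statistic is zero
  · have h0 : n.choose (m + 1) = 0 := Nat.choose_eq_zero_of_lt (by omega)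
    simp [statT, h0]

lemma measurable_quadForm (m : ℕ) (hXm : ∀ i, Measurable (X i)) (n : ℕ) :
    Measurable fun ω => ∫ u, wt m u * (∑ i ∈ Finset.range n, cind u (X i ω)) ^ 2 ∂unif := by
  have : StronglyMeasurable fun p : Ω × ℝ =>
      wt m p.2 * (∑ i ∈ Finset.range n, cind p.2 (X i p.1)) ^ 2 :=
    Measurable.stronglyMeasurable (by fun_prop)
  exact this.integral_prod_right'.measurable

lemma abs_sum_cind_le {u : ℝ} (hu : u ∈ Icc (0 : ℝ) 1) (x : ℕ → ℝ) (n : ℕ) :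
    |∑ i ∈ Finset.range n, cind u (x i)| ≤ n :=
  (Finset.abs_sum_le_sum_abs _ _).trans
    ((Finset.sum_le_sum fun i _ => abs_cind_le hu (x i)).trans (by simp))

/-- The statistic is approximated in mean by the centred quadratic form of the sample. -/
theorem exists_integral_abs_statT_sub_le {m : ℕ} (hm : 1 ≤ m) (hX : ∀ i, HasLaw (X i) unif P)
    (hXm : ∀ i, Measurable (X i)) (hXI : ∀ i ω, X i ω ∈ Icc (0 : ℝ) 1) (hi : iIndepFun X P) :
    ∃ C : ℝ, ∀ n : ℕ, 2 * (m + 1) ≤ n →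
      Integrable (fun ω => n * statT m n (fun i => X i ω) - ((m + 1).choose 2 : ℝ) *
        ((∫ u, wt m u * (∑ i ∈ Finset.range n, cind u (X i ω)) ^ 2 ∂unif) / n -
          ∫ u, wt m u * ((1 - u) * u) ∂unif)) P ∧
      ∫ ω, |n * statT m n (fun i => X i ω) - ((m + 1).choose 2 : ℝ) *
        ((∫ u, wt m u * (∑ i ∈ Finset.range n, cind u (X i ω)) ^ 2 ∂unif) / n -
          ∫ u, wt m u * ((1 - u) * u) ∂unif)| ∂P ≤ C / √n := by
  obtain ⟨C, hC, h⟩ := exists_abs_integrand_le hm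
  refine ⟨C * 8, fun n hn => ?_⟩
  have hn0 : 0 < n := by omega
  have hnr : (0 : ℝ) < n := by exact_mod_cast hn0
  set r := √(n : ℝ) with hr
  have hr0 : 0 < r := Real.sqrt_pos.2 hnr
  have hrn : (n : ℝ) = r ^ 2 := (Real.sq_sqrt hnr.le).symm
  set R : Ω → ℝ := fun ω => n * statT m n (fun i => X i ω) - ((m + 1).choose 2 : ℝ) *
        ((∫ u, wt m u * (∑ i ∈ Finset.range n, cind u (X i ω)) ^ 2 ∂unif) / n -
          ∫ u, wt m u * ((1 - u) * u) ∂unif) with hR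
  have hRm : Measurable R := by
    have h1 := measurable_statT hm hXm hXI n
    have h2 := measurable_quadForm m hXm n
    fun_prop
  set B : Ω → ℝ → ℝ := fun ω u => C * ((∑ i ∈ Finset.range n, cind u (X i ω)) ^ 4 / r ^ 5 +
        2 * ((∑ i ∈ Finset.range n, cind u (X i ω)) ^ 2 / r ^ 3) + 3 / r) with hB
  have hBm : Measurable (Function.uncurry B) := by
    have : Function.uncurry B = fun p : Ω × ℝ =>
      C * ((∑ i ∈ Finset.range n, cind p.2 (X i p.1)) ^ 4 / r ^ 5 +
        2 * ((∑ i ∈ Finset.range n, cind p.2 (X i p.1)) ^ 2 / r ^ 3) + 3 / r) := rfl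
    rw [this]
    fun_prop
  have hB0 : ∀ ω u, 0 ≤ B ω u := fun ω u => by positivity
  have hBb : ∀ ω, ∀ u ∈ Icc (0 : ℝ) 1,
      |B ω u| ≤ C * ((n : ℝ) ^ 4 / r ^ 5 + 2 * ((n : ℝ) ^ 2 / r ^ 3) + 3 / r) := fun ω u hu => by
    rw [abs_of_nonneg (hB0 ω u)]
    have hD := abs_sum_cind_le hu (fun i => X i ω) n
    have h4 : (∑ i ∈ Finset.range n, cind u (X i ω)) ^ 4 ≤ (n : ℝ) ^ 4 := by
      rw [← abs_of_nonneg (by positivity : 0 ≤ (∑ i ∈ Finset.range n, cind u (X i ω)) ^ 4), abs_pow]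
      exact pow_le_pow_left₀ (abs_nonneg _) hD 4
    have h2 : (∑ i ∈ Finset.range n, cind u (X i ω)) ^ 2 ≤ (n : ℝ) ^ 2 := by
      rw [← sq_abs]
      exact pow_le_pow_left₀ (abs_nonneg _) hD 2
    simp only [hB]
    gcongr
  have hBi : Integrable (Function.uncurry B) (P.prod unif) := by
    refine Integrable.of_bound hBm.aestronglyMeasurable
      (C * ((n : ℝ) ^ 4 / r ^ 5 + 2 * ((n : ℝ) ^ 2 / r ^ 3) + 3 / r)) ?_
    exact (Measure.quasiMeasurePreserving_snd.ae ae_unif_mem).mono fun p hp => hBb p.1 p.2 hp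
  have hBu : ∀ ω, Integrable (B ω) unif := fun ω => by
    have hm' : Measurable (B ω) := by
      simp only [hB]
      fun_prop
    exact integrable_unif_of_bound hm' _ (hBb ω)
  have hRB : ∀ ω, |R ω| ≤ ∫ u, B ω u ∂unif := fun ω => by
    have hDi : Integrable (fun u => wt m u * (∑ i ∈ Finset.range n, cind u (X i ω)) ^ 2 / n)
        unif := by
      refine integrable_unif_of_bound (by fun_prop) (2 * (n : ℝ) ^ 2 / n) fun u hu => ?_
      rw [abs_div, abs_mul, abs_pow, abs_of_pos hnr]
      have := abs_wt_le m hu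
      have := abs_sum_cind_le hu (fun i => X i ω) n
      gcongr
    have hwi : Integrable (fun u => wt m u * ((1 - u) * u)) unif :=
      Continuous.integrableOn_Icc (by fun_prop)
    have hci : Integrable (fun u => ((m + 1).choose 2 : ℝ) *
        (wt m u * (∑ i ∈ Finset.range n, cind u (X i ω)) ^ 2 / n - wt m u * ((1 - u) * u))) unif :=
      (hDi.sub hwi).const_mul _
    have hsi : Integrable (fun u => (n : ℝ) * (2 / ((m : ℝ) + 1) *
        stInt m n (cnt u (fun i : Fin n => X i ω)) (1 - u))) unif := by
      have hst : Measurable fun u => stInt m n (cnt u (fun i : Fin n => X i ω)) (1 - u) :=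
        measurable_stInt_cnt m measurable_id measurable_const
      refine Integrable.congr ((integrable_unif_of_bound (by fun_prop) _ fun u hu =>
        (h n hn (fun i => X i ω) u hu).trans ((le_abs_self _).trans (hBb ω u hu))).add hci) ?_
      exact Eventually.of_forall fun u => by simp
    have e : R ω = ∫ u, n * (2 / ((m : ℝ) + 1) *
        stInt m n (cnt u (fun i : Fin n => X i ω)) (1 - u)) -
      ((m + 1).choose 2 : ℝ) * (wt m u * (∑ i ∈ Finset.range n, cind u (X i ω)) ^ 2 / n -
        wt m u * ((1 - u) * u)) ∂unif := by
      rw [integral_sub hsi hci, integral_const_mul, integral_const_mul,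
        integral_const_mul, integral_sub hDi hwi, integral_div]
      simp only [hR]
      rw [statT_eq hm (by omega) fun i => hXI i ω]
    rw [e, ← Real.norm_eq_abs]
    refine norm_integral_le_of_norm_le ?_ ?_
    · exact hBu ω
    · exact ae_unif_mem.mono fun u hu => h n hn (fun i => X i ω) u hu
  have hBint : Integrable (fun ω => ∫ u, B ω u ∂unif) P := hBi.integral_prod_left
  refine ⟨hBint.mono' hRm.aestronglyMeasurable (Eventually.of_forall hRB), ?_⟩
  -- the moments of order four and two of the sum are at most `3 n²` and `n`
  have hmom : ∀ u ∈ Icc (0 : ℝ) 1, ∫ ω, B ω u ∂P ≤ C * 8 / r := fun u hu => by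
    have hcm : Measurable (cind u) := measurable_cind measurable_const measurable_id
    have hξ0 : ∀ i, ∫ ω, cind u (X i ω) ∂P = 0 := fun i => by
      rw [← integral_cind hu]
      exact (hX i).integral_comp (f := cind u) hcm.aestronglyMeasurable
    obtain ⟨m2, m4⟩ := integral_sum_sq_pow_four_le (P := P) (ξ := fun i ω => cind u (X i ω))
      (fun i => hcm.comp (hXm i)) (fun i ω => abs_cind_le hu _) hξ0
      (hi.comp (fun _ => cind u) fun _ => hcm) n
    have hD := fun ω => abs_sum_cind_le hu (fun i => X i ω) n
    have i4 : Integrable (fun ω => (∑ i ∈ Finset.range n, cind u (X i ω)) ^ 4 / r ^ 5) P := by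
      refine Integrable.div_const (integrable_of_abs_le (by fun_prop) (C := (n : ℝ) ^ 4)
        fun ω => ?_) _
      rw [abs_pow]
      exact pow_le_pow_left₀ (abs_nonneg _) (hD ω) 4
    have i2 : Integrable (fun ω => 2 * ((∑ i ∈ Finset.range n, cind u (X i ω)) ^ 2 / r ^ 3)) P := by
      refine (Integrable.div_const (integrable_of_abs_le (by fun_prop) (C := (n : ℝ) ^ 2)
        fun ω => ?_) _).const_mul _
      rw [abs_pow]
      exact pow_le_pow_left₀ (abs_nonneg _) (hD ω) 2
    have i42 : Integrable (fun ω => (∑ i ∈ Finset.range n, cind u (X i ω)) ^ 4 / r ^ 5 +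
        2 * ((∑ i ∈ Finset.range n, cind u (X i ω)) ^ 2 / r ^ 3)) P := i4.add i2
    simp only [hB]
    rw [integral_const_mul, integral_add i42 (integrable_const _), integral_add i4 i2,
      integral_div, integral_const_mul, integral_div, integral_const, probReal_univ, one_smul,
      mul_div_assoc]
    refine mul_le_mul_of_nonneg_left ?_ hC
    have b4 : (∫ ω, (∑ i ∈ Finset.range n, cind u (X i ω)) ^ 4 ∂P) / r ^ 5 ≤ 3 / r := by
      rw [div_le_div_iff₀ (by positivity) hr0]
      rw [hrn] at m4
      nlinarith [mul_le_mul_of_nonneg_right m4 hr0.le]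
    have b2 : (∫ ω, (∑ i ∈ Finset.range n, cind u (X i ω)) ^ 2 ∂P) / r ^ 3 ≤ 1 / r := by
      rw [div_le_div_iff₀ (by positivity) hr0]
      rw [hrn] at m2
      nlinarith [mul_le_mul_of_nonneg_right m2 hr0.le]
    have e1 : 8 / r = 3 / r + 2 * (1 / r) + 3 / r := by ring
    linarith
  calc ∫ ω, |R ω| ∂P ≤ ∫ ω, ∫ u, B ω u ∂unif ∂P :=
        integral_mono_of_nonneg (Eventually.of_forall fun ω => abs_nonneg _) hBint
          (Eventually.of_forall hRB)
    _ = ∫ u, ∫ ω, B ω u ∂P ∂unif := integral_integral_swap hBi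
    _ ≤ ∫ _, C * 8 / r ∂unif := integral_mono_ae hBi.integral_prod_right (integrable_const _)
        (ae_unif_mem.mono hmom)
    _ = C * 8 / r := by simp

end Sample

/-! ### Convergence in distribution -/

section Distribution

open scoped RealInnerProductSpace

variable {Ω Ω' : Type*} [MeasurableSpace Ω] [MeasurableSpace Ω'] {P : Measure Ω} {P' : Measure Ω'}
  [IsProbabilityMeasure P] [IsProbabilityMeasure P']

lemma tendstoInDistribution_iff_lipschitz {Y : ℕ → Ω → ℝ} {Z : Ω' → ℝ}
    (hY : ∀ n, AEMeasurable (Y n) P) (hZ : AEMeasurable Z P') :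
    TendstoInDistribution Y atTop Z (fun _ => P) P' ↔
      ∀ f : ℝ → ℝ, (∃ C : ℝ, ∀ x y, dist (f x) (f y) ≤ C) → (∃ L, LipschitzWith L f) →
        Tendsto (fun n => ∫ ω, f (Y n ω) ∂P) atTop (𝓝 (∫ ω, f (Z ω) ∂P')) := by
  have key : ∀ f : ℝ → ℝ, (∃ L, LipschitzWith L f) →
      (∀ n, ∫ x, f x ∂(P.map (Y n)) = ∫ ω, f (Y n ω) ∂P) ∧
      ∫ x, f x ∂(P'.map Z) = ∫ ω, f (Z ω) ∂P' := fun f ⟨L, hf⟩ =>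
    ⟨fun n => integral_map (hY n) hf.continuous.aestronglyMeasurable,
      integral_map hZ hf.continuous.aestronglyMeasurable⟩
  constructor
  · intro h f hC hL
    have := tendsto_iff_forall_lipschitz_integral_tendsto.1 h.tendsto f hC hL
    simpa only [ProbabilityMeasure.coe_mk, (key f hL).1, (key f hL).2] using this
  · intro h
    refine ⟨hY, hZ, tendsto_iff_forall_lipschitz_integral_tendsto.2 fun f hC hL => ?_⟩
    simpa only [ProbabilityMeasure.coe_mk, (key f hL).1, (key f hL).2] using h f hC hL

/-- Convergence together: a sequence that is approximated in mean by sequences with known limits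
in distribution converges to the limit of these limits. -/
lemma tendstoInDistribution_of_approx {Y : ℕ → Ω → ℝ} {V : ℕ → ℕ → Ω → ℝ} {Z : Ω' → ℝ}
    {W : ℕ → Ω' → ℝ} {a b : ℕ → ℝ} (hY : ∀ n, AEMeasurable (Y n) P)
    (hV : ∀ N, TendstoInDistribution (V N) atTop (W N) (fun _ => P) P')
    (hW : TendstoInDistribution W atTop Z (fun _ => P') P')
    (hle : ∀ N, ∀ᶠ n in atTop, Integrable (fun ω => Y n ω - V N n ω) P ∧
      ∫ ω, |Y n ω - V N n ω| ∂P ≤ a N + b n)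
    (ha : Tendsto a atTop (𝓝 0)) (hb : Tendsto b atTop (𝓝 0)) :
    TendstoInDistribution Y atTop Z (fun _ => P) P' := by
  have hVm := fun N => (hV N).forall_aemeasurable
  have hWm := hW.forall_aemeasurable
  rw [tendstoInDistribution_iff_lipschitz hY hW.aemeasurable_limit]
  rintro f ⟨C, hC⟩ ⟨L, hL⟩
  have hfb : ∀ x, ‖f x‖ ≤ |f 0| + C := fun x => by
    have h1 := hC x 0
    rw [Real.dist_eq] at h1
    rw [Real.norm_eq_abs]
    linarith [abs_sub_abs_le_abs_sub (f x) (f 0)]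
  have hfi : ∀ {U : Ω → ℝ}, AEMeasurable U P → Integrable (fun ω => f (U ω)) P := fun hU =>
    Integrable.of_bound (hL.continuous.measurable.comp_aemeasurable hU).aestronglyMeasurable _
      (Eventually.of_forall fun ω => hfb _)
  rw [Metric.tendsto_atTop']
  intro ε hε
  have h1 := (tendstoInDistribution_iff_lipschitz hWm hW.aemeasurable_limit).1 hW f ⟨C, hC⟩ ⟨L, hL⟩
  have hLa : Tendsto (fun N => (L : ℝ) * a N) atTop (𝓝 0) := by simpa using ha.const_mul (L : ℝ)
  have hLb : Tendsto (fun n => (L : ℝ) * b n) atTop (𝓝 0) := by simpa using hb.const_mul (L : ℝ)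
  obtain ⟨N, hN1, hN2⟩ := (((Metric.tendsto_nhds.1 h1) (ε / 4) (by positivity)).and
    (hLa.eventually_lt_const (by positivity : 0 < ε / 4))).exists
  have h2 := (tendstoInDistribution_iff_lipschitz (hVm N) (hWm N)).1 (hV N) f ⟨C, hC⟩ ⟨L, hL⟩
  obtain ⟨n₀, hn₀⟩ := eventually_atTop.1 (((Metric.tendsto_nhds.1 h2) (ε / 4) (by positivity)).and
    ((hLb.eventually_lt_const (by positivity : 0 < ε / 4)).and (hle N)))
  refine ⟨n₀, fun n hn => ?_⟩
  obtain ⟨hn1, hn2, hi, hn3⟩ := hn₀ n hn.le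
  have h3 : |∫ ω, f (Y n ω) ∂P - ∫ ω, f (V N n ω) ∂P| ≤ L * (a N + b n) := by
    rw [← integral_sub (hfi (hY n)) (hfi (hVm N n)), ← Real.norm_eq_abs]
    refine (norm_integral_le_of_norm_le (hi.abs.const_mul (L : ℝ))
      (Eventually.of_forall fun ω => ?_)).trans ?_
    · exact hL.dist_le_mul _ _
    · rw [integral_const_mul]
      exact mul_le_mul_of_nonneg_left hn3 L.2
  rw [Real.dist_eq] at hN1 hn1 ⊢
  rw [abs_lt] at *
  rw [abs_le] at h3
  constructor <;> linarith [h3.1, h3.2]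

/-- The multivariate central limit theorem for the eigenfunctions. -/
lemma EigenSystem.tendstoInDistribution_clt {ι : Type*} [Fintype ι] [DecidableEq ι] {m : ℕ}
    {ν : ι → ℝ} {φ : ι → ℝ → ℝ} (h : EigenSystem m ν φ) {X : ℕ → Ω → ℝ}
    (hX : ∀ i, HasLaw (X i) unif P) (hXm : ∀ i, Measurable (X i)) (hi : iIndepFun X P)
    {τ : ι → Ω' → ℝ} (hτ : ∀ i, HasLaw (τ i) (gaussianReal 0 1) P') (hτi : iIndepFun τ P') :
    TendstoInDistribution
      (fun (n : ℕ) ω => WithLp.toLp 2 fun k => (√n)⁻¹ * ∑ i ∈ Finset.range n, φ k (X i ω))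
      atTop (fun ω => WithLp.toLp 2 fun k => τ k ω) (fun _ => P) P' := by
  have hφm := h.measurable
  have hWm : ∀ n : ℕ, Measurable fun ω => (WithLp.toLp 2 fun k =>
      (√n)⁻¹ * ∑ i ∈ Finset.range n, φ k (X i ω) : EuclideanSpace ℝ ι) := fun n => by fun_prop
  have hτm : ∀ k, AEMeasurable (τ k) P' := fun k => (hτ k).aemeasurable
  have hτm' : AEMeasurable (fun ω => (WithLp.toLp 2 fun k => τ k ω : EuclideanSpace ℝ ι)) P' := by
    fun_prop
  have hlaw : P'.map (fun ω => (WithLp.toLp 2 fun k => τ k ω : EuclideanSpace ℝ ι)) =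
      stdGaussian (EuclideanSpace ℝ ι) := by
    have h1 := (iIndepFun_iff_map_fun_eq_pi_map hτm).1 hτi
    simp only [fun k => (hτ k).map_eq] at h1
    rw [← map_pi_eq_stdGaussian, ← h1, AEMeasurable.map_map_of_aemeasurable (by fun_prop)
      (by fun_prop)]
    rfl
  refine ⟨fun n => (hWm n).aemeasurable, hτm', ProbabilityMeasure.tendsto_iff_tendsto_charFun.2
    fun t => ?_⟩
  simp only [ProbabilityMeasure.coe_mk, hlaw, charFun_stdGaussian]
  -- by the device of Cramér and Wold it suffices to treat the linear combination `g` with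
  -- coefficients `t`, whose variance is `‖t‖²`
  set g : ℝ → ℝ := fun s => ∑ k, t k * φ k s with hg
  have hgm : Measurable g := by fun_prop
  have hg0 : ∫ s, g s ∂unif = 0 := by
    rw [hg, integral_finsetSum _ fun k _ => (h.integrable k).const_mul _]
    simp [integral_const_mul, h.centred]
  have hg2 : ∫ s, g s ^ 2 ∂unif = ‖t‖ ^ 2 := by
    have e : ∀ s, g s ^ 2 = ∑ k, ∑ l, t k * t l * (φ k s * φ l s) := fun s => by
      rw [hg, sq, Finset.sum_mul_sum]
      exact Finset.sum_congr rfl fun k _ => Finset.sum_congr rfl fun l _ => by ring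
    have hin : ∀ k l, Integrable (fun s => t k * t l * (φ k s * φ l s)) unif := fun k l =>
      (h.integrable_sq k l).const_mul _
    simp_rw [e]
    rw [integral_finsetSum _ fun k _ => integrable_finsetSum _ fun l _ => hin k l]
    simp only [fun k => integral_finsetSum (μ := unif) Finset.univ fun l _ => hin k l,
      integral_const_mul, h.orthonormal, EuclideanSpace.real_norm_sq_eq]
    simp [sq]
  have hgb : ∃ C, ∀ s, |g s| ≤ C := by
    choose B hB using h.bounded
    refine ⟨∑ k, |t k| * B k, fun s => (Finset.abs_sum_le_sum_abs _ _).trans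
      (Finset.sum_le_sum fun k _ => ?_)⟩
    rw [abs_mul]
    exact mul_le_mul_of_nonneg_left (hB k s) (abs_nonneg _)
  obtain ⟨C, hC⟩ := hgb
  have hmean : ∫ ω, g (X 0 ω) ∂P = 0 := by
    rw [← hg0]; exact (hX 0).integral_comp hgm.aestronglyMeasurable
  have hmem : MemLp (fun ω => g (X 0 ω)) 2 P :=
    MemLp.of_bound (hgm.comp (hXm 0)).aestronglyMeasurable C (Eventually.of_forall fun ω => hC _)
  have hvar : Var[fun ω => g (X 0 ω); P] = ‖t‖ ^ 2 := by
    rw [variance_of_integral_eq_zero (by fun_prop) hmean, ← hg2]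
    exact (hX 0).integral_comp (f := fun s => g s ^ 2) (hgm.pow_const 2).aestronglyMeasurable
  have hid : ∀ i, IdentDistrib (fun ω => g (X i ω)) (fun ω => g (X 0 ω)) P P := fun i =>
    IdentDistrib.comp (u := g) ⟨(hXm i).aemeasurable, (hXm 0).aemeasurable,
      (hX i).map_eq.trans (hX 0).map_eq.symm⟩ hgm
  have hclt := tendstoInDistribution_inv_sqrt_mul_sum_sub (P := P)
    (P' := gaussianReal 0 (Var[fun ω => g (X 0 ω); P]).toNNReal) (Y := id)
    (X := fun i ω => g (X i ω)) HasLaw.id hmem (hi.comp (fun _ => g) fun _ => hgm) hid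
  have h1 := ProbabilityMeasure.tendsto_iff_tendsto_charFun.1 hclt.tendsto 1
  simp only [ProbabilityMeasure.coe_mk, Measure.map_id, charFun_gaussianReal, hvar, hmean,
    mul_zero, sub_zero] at h1
  convert! h1 using 2 with n
  · rw [charFun_apply, charFun_apply_real, integral_map (hWm n).aemeasurable (by fun_prop),
      integral_map (by fun_prop) (by fun_prop)]
    refine integral_congr_ae (Eventually.of_forall fun ω => ?_)
    have e : (⟪(WithLp.toLp 2 fun k => (√n)⁻¹ * ∑ i ∈ Finset.range n, φ k (X i ω) :
        EuclideanSpace ℝ ι), t⟫ : ℝ) = (√n)⁻¹ * ∑ i ∈ Finset.range n, g (X i ω) := by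
      simp only [PiLp.inner_apply, hg]
      rw [Finset.sum_comm, Finset.mul_sum]
      refine Finset.sum_congr rfl fun k _ => ?_
      simp only [RCLike.inner_apply, conj_trivial]
      rw [← Finset.mul_sum]
      ring
    simp only [e]
    simp
  · simp [neg_div]

end Distribution

/-! ### The limit law -/

instance : SecondCountableTopology L2 :=
  have : Fact ((2 : ENNReal) ≠ ⊤) := ⟨by norm_num⟩
  inferInstance

/-- The series has the finite expectation `∑ ν i`. -/
lemma ae_summable_mul_sq {ν : ℕ → ℝ} (hν : ∀ i, 0 ≤ ν i) (hs : Summable ν) {Ω' : Type*}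
    [MeasurableSpace Ω'] {P' : Measure Ω'} {τ : ℕ → Ω' → ℝ}
    (hτ : ∀ i, HasLaw (τ i) (gaussianReal 0 1) P') :
    ∀ᵐ ω ∂P', Summable fun i => ν i * τ i ω ^ 2 := by
  have hτm : ∀ i, AEMeasurable (τ i) P' := fun i => (hτ i).aemeasurable
  have h2 : ∀ i, ∫⁻ ω, ENNReal.ofReal (ν i * τ i ω ^ 2) ∂P' = ENNReal.ofReal (ν i) := fun i => by
    have hi2 : Integrable (fun x : ℝ => x ^ 2) (gaussianReal 0 1) :=
      (memLp_id_gaussianReal 2).integrable_sq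
    have hi : Integrable (fun ω => τ i ω ^ 2) P' := by
      rw [← (hτ i).map_eq] at hi2
      exact hi2.comp_aemeasurable (hτm i)
    have h1 : ∫ ω, τ i ω ^ 2 ∂P' = 1 := by
      have e := (hτ i).integral_comp (f := fun x => x ^ 2) (by fun_prop)
      have v := variance_fun_id_gaussianReal (μ := 0) (v := 1)
      rw [variance_of_integral_eq_zero (by fun_prop) (by simp)] at v
      exact e.trans (by simpa using v)
    rw [← ofReal_integral_eq_lintegral_ofReal (hi.const_mul _)
      (Eventually.of_forall fun ω => mul_nonneg (hν i) (sq_nonneg _)), integral_const_mul, h1,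
      mul_one]
  have hfin : ∫⁻ ω, ∑' i, ENNReal.ofReal (ν i * τ i ω ^ 2) ∂P' ≠ ⊤ := by
    rw [lintegral_tsum fun i => by fun_prop]
    simp only [h2]
    exact hs.tsum_ofReal_ne_top
  filter_upwards [ae_lt_top' (AEMeasurable.tsum fun i => by fun_prop) hfin] with ω hω
  have := ENNReal.summable_toReal hω.ne
  simpa only [ENNReal.toReal_ofReal (mul_nonneg (hν _) (sq_nonneg _))] using this

section Limit

open scoped RealInnerProductSpace

variable {Ω Ω' : Type*} [MeasurableSpace Ω] [MeasurableSpace Ω'] {P : Measure Ω} {P' : Measure Ω'}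
  [IsProbabilityMeasure P] [IsProbabilityMeasure P']

/-- The limit theorem for samples that take values in `[0,1]` everywhere. -/
theorem exists_limit_of_mem {m : ℕ} (hm : 1 ≤ m) {ν : ℕ → ℝ} (hν : ListsEigenvalues (opS m) ν)
    {X : ℕ → Ω → ℝ} (hX : ∀ i, HasLaw (X i) unif P) (hXm : ∀ i, Measurable (X i))
    (hXI : ∀ i ω, X i ω ∈ Icc (0 : ℝ) 1) (hi : iIndepFun X P)
    {τ : ℕ → Ω' → ℝ} (hτ : ∀ i, HasLaw (τ i) (gaussianReal 0 1) P') (hτi : iIndepFun τ P') :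
    ∃ Z : Ω' → ℝ,
      (∀ᵐ ω ∂P', Tendsto (fun N : ℕ => ∑ i ∈ Finset.range N, ν i * (τ i ω ^ 2 - 1))
        atTop (𝓝 (Z ω))) ∧
      TendstoInDistribution (fun (n : ℕ) (ω : Ω) => (n : ℝ) * statT m n (fun i => X i ω))
        atTop (fun ω => ((m + 1).choose 2 : ℝ) * Z ω) (fun _ => P) P' := by
  classical
  have hg := memLp_feat m
  unfold ListsEigenvalues at hν
  rw [opS_eq_gram hm] at hν
  obtain ⟨e, he, hev, hker⟩ := exists_orthonormal_of_lists (gram_isCompactOperator hg)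
    (gram_isSymmetric hg) hν
  obtain ⟨φ, hφ⟩ := exists_eigenSystem m (fun i : {i // ν i ≠ 0} => i.2) he hev hm
  set κ := ∫ u, wt m u * ((1 - u) * u) ∂unif with hκ
  set c := ((m + 1).choose 2 : ℝ) with hc
  have hc0 : 0 ≤ c := Nat.cast_nonneg _
  have hsum : HasSum ν κ := by
    have := hasSum_eigenvalues hg he hev hker
    rwa [integral_congr_ae (ae_unif_mem.mono fun u hu => norm_sq_feat m hu)] at this
  have hν0 : ∀ i, 0 ≤ ν i := fun i => by
    by_cases h : ν i = 0
    · exact h.ge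
    · exact hφ.nonneg ⟨i, h⟩
  have hτm : ∀ i, AEMeasurable (τ i) P' := fun i => (hτ i).aemeasurable
  -- the indices below `N` that belong to nonzero eigenvalues
  set s : ℕ → Finset ℕ := fun N => (Finset.range N).filter fun i => ν i ≠ 0 with hs
  have hsub : ∀ (N : ℕ) (G : ℕ → ℝ), ∑ k : s N, ν k * G k = ∑ i ∈ Finset.range N, ν i * G i :=
    fun N G => by
      rw [Finset.sum_coe_sort (s N) fun k => ν k * G k, hs]
      exact Finset.sum_filter_of_ne fun i _ h => left_ne_zero_of_mul h
  let f : ∀ N, s N → {i // ν i ≠ 0} := fun N k => ⟨k.1, (Finset.mem_filter.1 k.2).2⟩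
  have hf : ∀ N, Function.Injective (f N) := fun N k l h => by
    have h' : (f N k).1 = (f N l).1 := congrArg _ h
    exact Subtype.ext h'
  have hφN : ∀ N, EigenSystem m (fun k : s N => ν k) fun k => φ (f N k) := fun N => hφ.comp (hf N)
  have hlim := ae_summable_mul_sq hν0 hsum.summable hτ
  set Z : Ω' → ℝ := fun ω => ∑' i, ν i * τ i ω ^ 2 - κ with hZ
  have hZ1 : ∀ᵐ ω ∂P', Tendsto (fun N : ℕ => ∑ i ∈ Finset.range N, ν i * τ i ω ^ 2 - κ)
      atTop (𝓝 (Z ω)) := hlim.mono fun ω hω => hω.hasSum.tendsto_sum_nat.sub_const κ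
  have hW : TendstoInDistribution
      (fun (N : ℕ) ω => c * (∑ i ∈ Finset.range N, ν i * τ i ω ^ 2 - κ)) atTop
      (fun ω => c * Z ω) (fun _ => P') P' := by
    have hWm : ∀ N : ℕ, AEMeasurable
        (fun ω => c * (∑ i ∈ Finset.range N, ν i * τ i ω ^ 2 - κ)) P' := fun N => by fun_prop
    have hWt := hZ1.mono fun ω hω => hω.const_mul c
    exact tendstoInDistribution_of_ae_tendsto hWm
      (aemeasurable_of_tendsto_metrizable_ae' hWm hWt) hWt
  refine ⟨Z, ?_, ?_⟩
  · filter_upwards [hlim] with ω hω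
    have := hω.hasSum.tendsto_sum_nat.sub hsum.tendsto_sum_nat
    refine this.congr fun N => ?_
    rw [← Finset.sum_sub_distrib]
    exact Finset.sum_congr rfl fun i _ => by ring
  obtain ⟨C, hC⟩ := exists_integral_abs_statT_sub_le hm hX hXm hXI hi
  refine tendstoInDistribution_of_approx (W := fun N ω =>
      c * (∑ i ∈ Finset.range N, ν i * τ i ω ^ 2 - κ))
    (V := fun N n ω => c * (∑ k : s N, ν k *
      ((√n)⁻¹ * ∑ i ∈ Finset.range n, φ (f N k) (X i ω)) ^ 2 - κ))
    (a := fun N => c * (κ - ∑ i ∈ Finset.range N, ν i)) (b := fun n : ℕ => C / √n)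
    (fun n => ((measurable_statT hm hXm hXI n).const_mul _).aemeasurable) (fun N => ?_) hW
    (fun N => ?_) ?_ ?_
  · have hcl := (hφN N).tendstoInDistribution_clt hX hXm hi (τ := fun k : s N => τ k)
      (fun k => hτ k) (hτi.precomp Subtype.val_injective)
    have hcont : Continuous fun w : EuclideanSpace ℝ (s N) =>
        c * (∑ k : s N, ν k * w k ^ 2 - κ) := by
      fun_prop
    refine (hcl.continuous_comp hcont).congr (fun n => Eventually.of_forall fun ω => rfl)
      (Eventually.of_forall fun ω => ?_)
    simp only [Function.comp_apply]
    rw [hsub N fun i => τ i ω ^ 2]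
  · filter_upwards [eventually_ge_atTop (2 * (m + 1))] with n hn
    have hnr : (0 : ℝ) < n := by exact_mod_cast (by omega : 0 < n)
    obtain ⟨hi1, hi2⟩ := hC n hn
    set R : Ω → ℝ := fun ω =>
      ∑ i ∈ Finset.range n, ∑ j ∈ Finset.range n, (hφN N).residual (X i ω) (X j ω) with hR
    have hR0 : ∀ ω, 0 ≤ R ω := fun ω => (hφN N).sum_sum_residual_nonneg (fun i => X i ω) n
    have hRint : ∫ ω, R ω ∂P = n * (κ - ∑ i ∈ Finset.range N, ν i) := by
      have h1 := hsub N fun _ => 1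
      simp only [mul_one] at h1
      rw [← h1]
      exact (hφN N).integral_sum_sum_residual hX hXm hi n
    have hRi : Integrable R P := by
      obtain ⟨B, hB⟩ := (hφN N).exists_abs_residual_le
      exact integrable_finsetSum _ fun i _ => integrable_finsetSum _ fun j _ =>
        integrable_of_abs_le ((hφN N).measurable_residual.comp ((hXm i).prodMk (hXm j)))
          fun ω => hB _ _
    -- the error splits into the distance to the full quadratic form and its truncated part
    have hdec : ∀ ω, n * statT m n (fun i => X i ω) - c * (∑ k : s N, ν k *
        ((√n)⁻¹ * ∑ i ∈ Finset.range n, φ (f N k) (X i ω)) ^ 2 - κ) =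
        (n * statT m n (fun i => X i ω) - c *
          ((∫ u, wt m u * (∑ i ∈ Finset.range n, cind u (X i ω)) ^ 2 ∂unif) / n - κ)) +
          c / n * R ω := fun ω => by
      have e1 : ∑ k : s N, ν k * ((√n)⁻¹ * ∑ i ∈ Finset.range n, φ (f N k) (X i ω)) ^ 2 =
          (∑ k : s N, ν k * (∑ i ∈ Finset.range n, φ (f N k) (X i ω)) ^ 2) / n := by
        rw [Finset.sum_div]
        refine Finset.sum_congr rfl fun k _ => ?_
        rw [mul_pow, inv_pow, Real.sq_sqrt hnr.le]
        ring
      rw [e1, hR]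
      simp only
      rw [(hφN N).sum_sum_residual fun i => X i ω]
      ring
    simp only [hdec]
    have hRi' := hRi.const_mul (c / n)
    refine ⟨hi1.add hRi', ?_⟩
    calc _ ≤ ∫ ω, (|n * statT m n (fun i => X i ω) - c *
          ((∫ u, wt m u * (∑ i ∈ Finset.range n, cind u (X i ω)) ^ 2 ∂unif) / n - κ)| +
          c / n * R ω) ∂P := by
          refine integral_mono (hi1.add hRi').abs (hi1.abs.add hRi') fun ω => ?_
          refine (abs_add_le _ _).trans_eq ?_
          rw [abs_of_nonneg (mul_nonneg (div_nonneg hc0 hnr.le) (hR0 ω))]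
      _ ≤ C / √n + c / n * (n * (κ - ∑ i ∈ Finset.range N, ν i)) := by
          rw [integral_add hi1.abs hRi', integral_const_mul, hRint]
          linarith
      _ = _ := by field_simp; ring
  · have := (hsum.tendsto_sum_nat.const_sub κ).const_mul c
    simpa using this
  · exact tendsto_const_nhds.div_atTop
      (Real.tendsto_sqrt_atTop.comp tendsto_natCast_atTop_atTop)

/-- Null sets do not matter: the observations may be replaced by measurable versions with values
in `[0,1]`. -/
theorem exists_limit {m : ℕ} (hm : 1 ≤ m) {ν : ℕ → ℝ} (hν : ListsEigenvalues (opS m) ν)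
    {X : ℕ → Ω → ℝ} (hX : ∀ i, HasLaw (X i) unif P) (hi : iIndepFun X P)
    {τ : ℕ → Ω' → ℝ} (hτ : ∀ i, HasLaw (τ i) (gaussianReal 0 1) P') (hτi : iIndepFun τ P') :
    ∃ Z : Ω' → ℝ,
      (∀ᵐ ω ∂P', Tendsto (fun N : ℕ => ∑ i ∈ Finset.range N, ν i * (τ i ω ^ 2 - 1))
        atTop (𝓝 (Z ω))) ∧
      TendstoInDistribution (fun (n : ℕ) (ω : Ω) => (n : ℝ) * statT m n (fun i => X i ω))
        atTop (fun ω => ((m + 1).choose 2 : ℝ) * Z ω) (fun _ => P) P' := by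
  have hXm : ∀ i, AEMeasurable (X i) P := fun i => (hX i).aemeasurable
  set X' : ℕ → Ω → ℝ := fun i ω => max 0 (min 1 ((hXm i).mk (X i) ω)) with hX'
  have hmk : ∀ i, Measurable ((hXm i).mk (X i)) := fun i => (hXm i).measurable_mk
  have hX'm : ∀ i, Measurable (X' i) := fun i => by fun_prop
  have hae : ∀ i, X i =ᵐ[P] X' i := fun i => by
    have h1 : ∀ᵐ ω ∂P, X i ω ∈ Icc (0 : ℝ) 1 :=
      ae_of_ae_map (hXm i) ((hX i).map_eq.symm ▸ ae_unif_mem)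
    filter_upwards [h1, (hXm i).ae_eq_mk] with ω h2 h3
    simp only [hX', ← h3, min_eq_right h2.2, max_eq_right h2.1]
  obtain ⟨Z, hZ1, hZ2⟩ := exists_limit_of_mem hm hν (X := X')
    (fun i => (hX i).congr (hae i).symm) hX'm
    (fun i ω => ⟨le_max_left _ _, max_le zero_le_one (min_le_left _ _)⟩)
    (hi.congr hae) hτ hτi
  refine ⟨Z, hZ1, hZ2.congr (fun n => ?_) (EventuallyEq.refl _ _)⟩
  filter_upwards [ae_all_iff.2 hae] with ω hω
  simp only [hω]

end Limit

/-- If the second projection vanished, its operator would be zero and so would be the trace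
`∫ w(u) u (1 - u) du`. -/
lemma not_ae_secondProj_eq_zero {m : ℕ} (hm : 1 ≤ m) :
    ¬ ∀ᵐ p ∂(unif.prod unif), secondProj m p.1 p.2 = 0 := by
  intro h
  have h1 : ∀ᵐ p ∂(unif.prod unif), covKer m p.1 p.2 = 0 := by
    filter_upwards [h, secondProj_ae_eq hm] with p hp hq
    exact hq.symm.trans hp
  have h2 := Measure.ae_ae_of_ae_prod h1
  have hgram : ∀ f : L2, gram unif (feat m) f = 0 := fun f => by
    have hf : opS m f = 0 := by
      rw [Lp.eq_zero_iff_ae_eq_zero]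
      filter_upwards [opS_coeFn hm f, h2] with t ht ht'
      rw [ht, Pi.zero_apply]
      refine integral_eq_zero_of_ae (ht'.mono fun s hs => ?_)
      simp only [covKer_symm m s t, hs, zero_mul, Pi.zero_apply]
    rw [opS_eq_gram hm] at hf
    exact hf
  have hsum := hasSum_eigenvalues (memLp_feat m) (ν := fun _ => 0) (e := fun _ => 0)
    ⟨fun i => absurd rfl i.2, fun i => absurd rfl i.2⟩ (fun i => absurd rfl i.2) fun f _ => hgram f
  rw [integral_congr_ae (ae_unif_mem.mono fun u hu => norm_sq_feat m hu), integral_unif] at hsum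
  refine (intervalIntegral.intervalIntegral_pos_of_pos_on
    (f := fun u => wt m u * ((1 - u) * u)) ?_ (fun u hu => ?_) zero_lt_one).ne'
    (hsum.unique hasSum_zero)
  · exact Continuous.intervalIntegrable (by fun_prop) _ _
  · have := hu.1
    have := sub_pos.2 hu.2
    unfold wt
    positivity

end UniformityTest

theorem mainTheorem2 (m : ℕ) (hm : 1 ≤ m) :
    -- under the null hypothesis the first projection vanishes identically
    (∀ s ∈ Icc (0 : ℝ) 1, UniformityTest.firstProj m s = 0) ∧
    -- explicit formula for the second projection
    (∀ s ∈ Icc (0 : ℝ) 1, ∀ t ∈ Icc (0 : ℝ) 1,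
      UniformityTest.secondProj m s t =
        -(2 / ((m : ℝ) * (1 + m) ^ 2 * (2 + m))) *
            (-2 + 2 * (1 - t) ^ m
              + (m : ℝ) ^ 2 * (-(1 - s) ^ (m + 1) + (1 - t) ^ m * t)
              + (m : ℝ) * (-2 * (1 - s) ^ (m + 1) + (1 - t) ^ m + 2 * (1 - t) ^ m * t))
          + 2 / ((m : ℝ) * (1 + m)) *
            (if s < t then (1 - t) ^ m - (1 - s) ^ m else 0)) ∧
    -- the second projection is not zero: the kernel is weakly degenerate
    (¬ ∀ᵐ p ∂(UniformityTest.unif.prod UniformityTest.unif),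
      UniformityTest.secondProj m p.1 p.2 = 0) ∧
    -- limit law of `n T^m_n` under the null hypothesis
    (∃ ν : ℕ → ℝ, UniformityTest.ListsEigenvalues (UniformityTest.opS m) ν) ∧
    (∀ ν : ℕ → ℝ, UniformityTest.ListsEigenvalues (UniformityTest.opS m) ν →
      ∀ {Ω : Type*} [MeasurableSpace Ω] (P : Measure Ω) [IsProbabilityMeasure P]
        (X : ℕ → Ω → ℝ) (_ : ∀ i, HasLaw (X i) UniformityTest.unif P) (_ : iIndepFun X P)
        {Ω' : Type*} [MeasurableSpace Ω'] (P' : Measure Ω') [IsProbabilityMeasure P']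
        (τ : ℕ → Ω' → ℝ) (_ : ∀ i, HasLaw (τ i) (gaussianReal 0 1) P') (_ : iIndepFun τ P'),
        ∃ Z : Ω' → ℝ,
          (∀ᵐ ω ∂P', Tendsto (fun N : ℕ => ∑ i ∈ Finset.range N, ν i * (τ i ω ^ 2 - 1))
            atTop (𝓝 (Z ω))) ∧
          TendstoInDistribution
            (fun (n : ℕ) (ω : Ω) => (n : ℝ) * UniformityTest.statT m n (fun i => X i ω))
            atTop (fun ω => ((m + 1).choose 2 : ℝ) * Z ω) (fun _ => P) P') ∧
    -- reduction of the eigenproblem to the boundary value problem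
    (∀ (ν : ℝ) (f : ℝ → ℝ), UniformityTest.SolvesIntegralEquation m ν f →
      UniformityTest.SolvesBoundaryProblem m ν (fun t => ∫ s in (0 : ℝ)..t, f s)) ∧
    (∀ (ν : ℝ) (y : ℝ → ℝ), UniformityTest.SolvesBoundaryProblem m ν y →
      UniformityTest.SolvesIntegralEquation m ν (derivWithin y (Icc 0 1))) ∧
    (∀ ν : ℝ, ((UniformityTest.opS m).HasEigenvalue ν ∧ ν ≠ 0) ↔
      ∃ y : ℝ → ℝ, UniformityTest.SolvesBoundaryProblem m ν y) := by
  refine ⟨fun s hs => UniformityTest.firstProj_eq_zero hm hs, fun s hs t ht => ?_,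
    UniformityTest.not_ae_secondProj_eq_zero hm, ?_, ?_, ?_, ?_,
    UniformityTest.hasEigenvalue_iff hm⟩
  · rw [UniformityTest.secondProj_eq hm hs ht]
    exact UniformityTest.covKer_formula hm hs ht
  · rw [UniformityTest.opS_eq_gram hm]
    exact UniformityTest.exists_lists
      (UniformityTest.gram_isCompactOperator (UniformityTest.memLp_feat m))
      (UniformityTest.gram_isSymmetric (UniformityTest.memLp_feat m))
  · intro ν hν Ω _ P _ X hX hi Ω' _ P' _ τ hτ hτi
    exact UniformityTest.exists_limit hm hν hX hi hτ hτi
  · exact fun ν f h => UniformityTest.boundary_of_integral hm h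
  · exact fun ν y h => (UniformityTest.integral_of_boundary hm h).1
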